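/- There do not exist $11$ lines in $\mathbb{R}^3$ such that the (Euclidean) distance between every two of them is exactly $1$. Consequently, Littlewood's champagne glass number $N$, that is, the maximum number of congruent infinite circular cylinders that can be arranged in $\mathbb{R}^3$ so that every two of them touch (have a common point, but no common interior point), satisfies $N \le 10$. -/

import Mathlib

/-- Euclidean 3-space. -/
abbrev E3 : Type := EuclideanSpace ℝ (Fin 3)

/-- An affine subspace of `E3` is a line if it is nonempty and its direction is one-dimensional. -/
def IsLine (L : AffineSubspace ℝ E3) : Prop :=
  (L : Set E3).Nonempty ∧ Module.finrank ℝ L.direction = 1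

/-- The distance between two point sets: the infimum of the distances `dist p q` with `p ∈ A` and
`q ∈ B`. (It is used for nonempty sets only.) -/
noncomputable def setDist (A B : Set E3) : ℝ :=
  sInf (Set.image2 dist A B)

/-- `C` is an infinite (solid, closed, circular) cylinder of radius `r`: the set of all points at
distance at most `r` from some line, its axis. -/
def IsCylinder (r : ℝ) (C : Set E3) : Prop :=
  ∃ L : AffineSubspace ℝ E3, IsLine L ∧ C = {x : E3 | Metric.infDist x (L : Set E3) ≤ r}

/-- Two bodies touch if they have a common point but no common interior point. -/
def Touch (C D : Set E3) : Prop :=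
  (C ∩ D).Nonempty ∧ Disjoint (interior C) (interior D)

/-- `S` is a collection of congruent infinite cylinders every two of which touch. -/
def IsTouchingArrangement (S : Set (Set E3)) : Prop :=
  ∃ r : ℝ, 0 < r ∧ (∀ C ∈ S, IsCylinder r C) ∧ S.Pairwise Touch

/-- Littlewood's champagne glass number: the largest number of congruent infinite cylinders that can
be arranged in 3-space so that every two of them touch (`⊤` if there is no bound on that number). -/
noncomputable def champagneGlassNumber : ℕ∞ :=
  sSup {n : ℕ∞ | ∃ S : Set (Set E3), IsTouchingArrangement S ∧ S.encard = n}

/-! ### Sign patterns and their extensions -/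

/-! Let the `i`-th line pass through `p i` with unit direction `u i`, and let `d > 0` be the common
distance. Sliding along two lines to their common perpendicular shows that the reciprocal product
`tripleProduct (p i - p j) (u i) (u j)` is `± d` times the sine of the angle between `u i` and `u
j`. If no two lines are parallel, the family thus determines a symmetric sign pattern. Reversing `u
i` switches the signs at `i`, and negating all moments `p i × u i` negates the whole pattern, so
only the class of the pattern under switching and negation matters. The theorem follows once some
sign patterns are shown to be unrealizable and every pattern on eleven points is shown to contain
one of them.

Two facts about quadratic forms obstruct realizability. The reciprocal products are bilinear in
directions and moments, so their quadratic form vanishes at every linear relation `∑ x i • u i = 0`;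
such relations have codimension at most three. On the other hand, the matrix with entries `1 - sin`
is positive semidefinite, since `1 - √(1 - t ^ 2)` is a limit of polynomials in `t ^ 2` with
nonnegative coefficients and Schur products preserve positivity. Its entrywise product with a
positive semidefinite matrix of positive diagonal is even positive definite
(`Matrix.PosSemidef.sum_mul_one_sub_sqrt_pos`). Hence if the signs, with a suitable positive
diagonal, form a positive semidefinite matrix whose kernel contains a nonzero relation between the
directions, there is a contradiction (`false_of_posSemidef_mulVec_eq_zero`).

This excludes five equal signs (the all-one matrix) and eleven points of the Paley conference matrix
of order 14 (the matrix `S + √13`, of rank seven). A third pattern, a pentagon with two additional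
points, is excluded because the sine matrix is of negative type while the cyclic form of a weighted
pentagon is positive definite in codimension two (`not_isRealizable_of_pentagon`).

That every eleven-point pattern contains one of these three is a finite verification by backward
induction. A pattern on fewer than eleven points cannot occur if each of its one-point extensions
contains a pattern already excluded, because an occurrence among eleven points always extends. The
certificate `patternData` descends in this way to the pattern on two points, which occurs
everywhere.

Parallel lines are treated separately: if two of the lines are parallel, all lines fall into three
classes of pairwise parallel ones, and each class has at most three members, so there are at most
nine lines (`IsEquidistant.inner_sq_ne_one`). Finally, the axes of touching cylinders of radius `r`
are at distance `2 * r`, which gives the bound on the champagne glass number. -/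

/-- The binary digit of `m` at position `i`, in a form that evaluates fast. -/
def natBit (m i : ℕ) : Bool :=
  Nat.beq (Nat.mod (Nat.shiftRight m i) 2) 1

/-- The position of the unordered pair `{i, j}` with `i < j` among all pairs. -/
def pairIndex (i j : ℕ) : ℕ :=
  Nat.add (Nat.div (Nat.mul j (Nat.pred j)) 2) i

/-- The entry `(i, j)` of the symmetric sign pattern encoded by the binary digits of `code`. -/
def edgeBit (code i j : ℕ) : Bool :=
  bif i.blt j then natBit code (pairIndex i j) else natBit code (pairIndex j i)

/-- Up to switching and global negation, the sign pattern `p.2` on `p.1` points occurs in `s`. -/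
def SwitchContains {V : Type*} (s : V → V → Bool) (p : ℕ × ℕ) : Prop :=
  ∃ (f : Fin p.1 → V) (ε : Fin p.1 → Bool) (b : Bool), Function.Injective f ∧
    ∀ i j, i ≠ j → s (f i) (f j) = (edgeBit p.2 i j ^^ ε i ^^ ε j ^^ b)

/-- The sign pattern `code` on `n` points, extended by a point `n` with row `r`. -/
def extBit (n code r x y : ℕ) : Bool :=
  bif x.beq n then natBit r y else bif y.beq n then natBit r x else edgeBit code x y

/-- The first `k` hexadecimal digits of a number. -/
def hexDigits : ℕ → ℕ → List ℕ
  | 0, _ => []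
  | k + 1, c => Nat.mod c 16 :: hexDigits k (Nat.div c 16)

/-- The points `f` of the extended pattern, each with its index and its switching sign. -/
def switchList (n code r target : ℕ) (b : Bool) : List ℕ → List (ℕ × ℕ × Bool)
  | [] => []
  -- Flipping all switching signs changes nothing, so the first may be `false`; the entry with the
  -- first point then determines each of the others.
  | x :: xs => (x, 0, false) ::
      (xs.zipIdx 1).map fun y => (y.1, y.2, extBit n code r x y.1 ^^ edgeBit target 0 y.2 ^^ b)

/-- Compatibility of two entries of a switch list. -/
def switchOK (n code r target : ℕ) (b : Bool) (p q : ℕ × ℕ × Bool) : Bool :=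
  !(p.1.beq q.1) &&
    !(extBit n code r p.1 q.1 ^^ edgeBit target p.2.1 q.2.1 ^^ p.2.2 ^^ q.2.2 ^^ b)

/-- Pairwise compatibility of a switch list. -/
def switchAllOK (n code r target : ℕ) (b : Bool) : List (ℕ × ℕ × Bool) → Bool
  | [] => true
  | p :: ps => ps.all (switchOK n code r target b p) && switchAllOK n code r target b ps

/-- `w` encodes an occurrence of one of the patterns in `table` in the pattern extended by the row
`r`, which uses only entries of this row at the binary digits of the mask `m`. -/
def isOccurrence (table : List (ℕ × ℕ)) (n code m r : ℕ) (w : ℕ × ℕ) : Bool :=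
  match table[Nat.div w.1 2]? with
  | none => false
  | some t =>
    (hexDigits t.1 w.2).all (fun x => natBit m x || x.beq n) &&
      switchAllOK n code r t.2 (Nat.beq (Nat.mod w.1 2) 1)
        (switchList n code r t.2 (Nat.beq (Nat.mod w.1 2) 1) (hexDigits t.1 w.2))

/-- All pairs `(m, r)` of a mask and a row are witnessed, the masks in the `k`-th list being less
than `2 ^ (d + k)`. -/
def checkMasks (table : List (ℕ × ℕ)) (n code : ℕ) :
    List (List (ℕ × ℕ × ℕ × ℕ)) → ℕ → Bool
  | [], _ => true
  | g :: gs, d => g.all (fun w => Nat.blt w.1 (Nat.pow 2 d) &&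
      isOccurrence table n code w.1 w.2.1 w.2.2) && checkMasks table n code gs (Nat.succ d)

/-- The function `f` at an evaluated argument. -/
def atValue {α : Type*} (n : ℕ) (f : ℕ → α) : α :=
  Nat.casesOn n (f 0) fun k => f (Nat.succ k)

/-- Every row with the prescribed first `d` entries agrees on one of the masks with the row that
belongs to it, up to complement; the `k`-th list of masks is tried once `d + k` entries are known. -/
def checkRows (n : ℕ) : List (List (ℕ × ℕ × ℕ × ℕ)) → ℕ → ℕ → Bool
  | [], _, _ => false
  | g :: gs, d, r => g.any (fun w => Nat.beq (Nat.land r w.1) w.2.1 ||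
        Nat.beq (Nat.land r w.1) (Nat.xor w.1 w.2.1)) ||
      (d.blt n && atValue (Nat.succ d) fun d' => checkRows n gs d' r &&
        atValue (Nat.lor r (Nat.pow 2 d)) (checkRows n gs d'))

/-- Each pattern in the list has all its extensions contain one of the `base` patterns or a pattern
that was dealt with before. -/
def checkPatterns (base : List (ℕ × ℕ)) :
    List (ℕ × ℕ) → List (ℕ × ℕ × List (List (ℕ × ℕ × ℕ × ℕ))) → Bool
  | _, [] => true
  -- The bound 11 leaves a point by which an occurrence among eleven points can be extended. The
  -- search over rows starts with one known entry equal to 0, a normalization achieved by switching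
  -- the new point.
  | done, p :: ps => (Nat.blt 0 p.1 && p.1.blt 11 && checkMasks (base ++ done) p.1 p.2.1 p.2.2 1 &&
      checkRows p.1 p.2.2 1 0) && checkPatterns base ((p.1, p.2.1) :: done) ps

/-! ### Soundness of the combinatorial check -/

theorem natBit_eq_testBit (m i : ℕ) : natBit m i = m.testBit i := by
  rw [Bool.eq_iff_iff, natBit, Nat.beq_eq, Nat.testBit_eq_decide_div_mod_eq, decide_eq_true_iff,
    ← Nat.shiftRight_eq_div_pow]
  rfl

theorem atValue_eq {α : Type*} (n : ℕ) (f : ℕ → α) : atValue n f = f n := by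
  cases n <;> rfl

theorem edgeBit_comm (code i j : ℕ) (h : i ≠ j) : edgeBit code i j = edgeBit code j i := by
  unfold edgeBit
  rcases lt_or_gt_of_ne h with h | h
  · have h1 : i.blt j = true := by simpa [Nat.blt_eq] using h
    have h2 : j.blt i = false := by
      rw [Bool.eq_false_iff, Ne, Nat.blt_eq]; omega
    simp [h1, h2]
  · have h1 : j.blt i = true := by simpa [Nat.blt_eq] using h
    have h2 : i.blt j = false := by
      rw [Bool.eq_false_iff, Ne, Nat.blt_eq]; omega
    simp [h1, h2]

theorem extBit_comm (n code r x y : ℕ) (h : x ≠ y) :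
    extBit n code r x y = extBit n code r y x := by
  unfold extBit
  by_cases hx : x = n
  · have hy : y.beq n = false := by
      rw [Bool.eq_false_iff, Ne, Nat.beq_eq]; omega
    simp [hx, hy]
  · have hx' : x.beq n = false := by
      rw [Bool.eq_false_iff, Ne, Nat.beq_eq]; omega
    by_cases hy : y = n
    · simp [hy, hx']
    · have hy' : y.beq n = false := by
        rw [Bool.eq_false_iff, Ne, Nat.beq_eq]; omega
      simp [hx', hy', edgeBit_comm code x y h]

theorem length_hexDigits (k c : ℕ) : (hexDigits k c).length = k := by
  induction k generalizing c with
  | zero => rfl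
  | succ k ih => simp [hexDigits, ih]

theorem switchAllOK_iff_pairwise (n code r target : ℕ) (b : Bool) (l : List (ℕ × ℕ × Bool)) :
    switchAllOK n code r target b l = true ↔
      l.Pairwise fun p q => switchOK n code r target b p q = true := by
  induction l with
  | nil => simp [switchAllOK]
  | cons p ps ih => simp [switchAllOK, ih]

theorem length_switchList (n code r target : ℕ) (b : Bool) (l : List ℕ) :
    (switchList n code r target b l).length = l.length := by
  cases l <;> simp [switchList]

theorem switchList_getElem (n code r target : ℕ) (b : Bool) (l : List ℕ) (i : ℕ)
    (hi : i < l.length) :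
    ∃ e, (switchList n code r target b l)[i]'(by rwa [length_switchList]) = (l[i], i, e) := by
  cases l with
  | nil => simp at hi
  | cons x xs =>
    cases i with
    | zero => exact ⟨false, rfl⟩
    | succ i =>
      simp [switchList, add_comm]

/-- Injectivity and the sign identity are needed only at the mask and at the new point `n`, since a
witness may use no other points. A single witness therefore serves all rows that agree on the mask.
-/
theorem switchContains_of_isOccurrence {V : Type*} {s : V → V → Bool} (hs : ∀ x y, s x y = s y x)
    {table : List (ℕ × ℕ)} {n code m r : ℕ} {w : ℕ × ℕ} (ψ : ℕ → V) (η : ℕ → Bool) (c : Bool)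
    (hinj : ∀ x y, (natBit m x = true ∨ x = n) → (natBit m y = true ∨ y = n) → x ≠ y → ψ x ≠ ψ y)
    (hψ : ∀ x y, (natBit m x = true ∨ x = n) → (natBit m y = true ∨ y = n) → x ≠ y →
      s (ψ x) (ψ y) = (extBit n code r x y ^^ η x ^^ η y ^^ c))
    (h : isOccurrence table n code m r w = true) : ∃ p ∈ table, SwitchContains s p := by
  unfold isOccurrence at h
  cases ht : table[Nat.div w.1 2]? with
  | none => simp [ht] at h
  | some t =>
    simp only [ht, Bool.and_eq_true, List.all_eq_true, Bool.or_eq_true] at h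
    obtain ⟨h1, h2⟩ := h
    refine ⟨t, List.mem_of_getElem? ht, ?_⟩
    set b := Nat.beq (Nat.mod w.1 2) 1
    set l := hexDigits t.1 w.2 with hl
    have hlen : l.length = t.1 := length_hexDigits _ _
    have hok : ∀ i (hi : i < l.length), natBit m l[i] = true ∨ l[i] = n := by
      intro i hi
      have := h1 l[i] (List.getElem_mem hi)
      simpa [Nat.blt_eq, Nat.beq_eq] using this
    rw [switchAllOK_iff_pairwise, List.pairwise_iff_getElem] at h2
    choose e he using fun i (hi : i < l.length) => switchList_getElem n code r t.2 b l i hi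
    have key : ∀ i j (hi : i < l.length) (hj : j < l.length), i < j → l[i] ≠ l[j] ∧
        extBit n code r l[i] l[j] = (edgeBit t.2 i j ^^ e i hi ^^ e j hj ^^ b) := by
      intro i j hi hj hij
      have := h2 i j (by rwa [length_switchList]) (by rwa [length_switchList]) hij
      rw [he i hi, he j hj] at this
      simp only [switchOK, Bool.and_eq_true, Bool.not_eq_true', Bool.eq_false_iff, Ne,
        Nat.beq_eq] at this
      refine ⟨this.1, ?_⟩
      have h3 := this.2
      revert h3
      cases extBit n code r l[i] l[j] <;> cases edgeBit t.2 i j <;> cases e i hi <;>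
        cases e j hj <;> cases b <;> simp
    have hb : ∀ i : Fin t.1, (i : ℕ) < l.length := fun i => by rw [hlen]; exact i.2
    -- Occurrences compose: the switching signs of the pattern in the extension are added to those
    -- of the extension in `s`, and so are the global negations.
    refine ⟨fun i => ψ (l[(i : ℕ)]'(hb i)), fun i => e i (hb i) ^^ η (l[(i : ℕ)]'(hb i)), b ^^ c,
      ?_, ?_⟩
    · intro i j hij
      by_contra hne
      rcases lt_or_gt_of_ne hne with h | h
      · exact hinj _ _ (hok _ (hb i)) (hok _ (hb j)) (key i j (hb i) (hb j) h).1 hij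
      · exact hinj _ _ (hok _ (hb j)) (hok _ (hb i)) (key j i (hb j) (hb i) h).1 hij.symm
    · intro i j hne
      have main : ∀ i j : Fin t.1, i < j → s (ψ (l[(i : ℕ)]'(hb i))) (ψ (l[(j : ℕ)]'(hb j))) =
          (edgeBit t.2 i j ^^ (e i (hb i) ^^ η (l[(i : ℕ)]'(hb i))) ^^
            (e j (hb j) ^^ η (l[(j : ℕ)]'(hb j))) ^^ (b ^^ c)) := by
        intro i j hij
        obtain ⟨k1, k2⟩ := key i j (hb i) (hb j) hij
        rw [hψ _ _ (hok _ (hb i)) (hok _ (hb j)) k1, k2]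
        simp only [Bool.xor_comm, Bool.xor_left_comm, Bool.xor_assoc]
      rcases lt_or_gt_of_ne hne with h | h
      · exact main i j h
      · rw [hs, main j i h, edgeBit_comm _ _ _ (fun h' => hne (Fin.ext h'))]
        simp only [Bool.xor_comm, Bool.xor_left_comm, Bool.xor_assoc]

theorem switchContains_of_agree {V : Type*} {s : V → V → Bool} (hs : ∀ x y, s x y = s y x)
    {table : List (ℕ × ℕ)} {n code : ℕ} (ψ : ℕ → V) (η : ℕ → Bool) (c : Bool)
    (hinj : ∀ x y, x ≤ n → y ≤ n → x ≠ y → ψ x ≠ ψ y)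
    (hψ : ∀ x y, x < n → y < n → x ≠ y → s (ψ x) (ψ y) = (edgeBit code x y ^^ η x ^^ η y ^^ c))
    (m e : ℕ) (w : ℕ × ℕ) (hm : m < 2 ^ n)
    (hrow : ∀ x, m.testBit x = true → s (ψ x) (ψ n) = (e.testBit x ^^ η x ^^ η n ^^ c))
    (h : isOccurrence table n code m e w = true) : ∃ p ∈ table, SwitchContains s p := by
  have hlt : ∀ x, natBit m x = true → x < n := by
    intro x hx
    by_contra hxn
    rw [natBit_eq_testBit, Nat.testBit_lt_two_pow
      (hm.trans_le (Nat.pow_le_pow_right (by norm_num) (not_lt.mp hxn)))] at hx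
    exact absurd hx (by simp)
  have hle : ∀ x, natBit m x = true ∨ x = n → x ≤ n := by
    rintro x (hx | hx)
    · exact (hlt x hx).le
    · exact hx.le
  refine switchContains_of_isOccurrence hs ψ η c
    (fun x y hx hy => hinj x y (hle x hx) (hle y hy)) ?_ h
  have main : ∀ x y, natBit m x = true → (natBit m y = true ∨ y = n) → x ≠ y →
      s (ψ x) (ψ y) = (extBit n code e x y ^^ η x ^^ η y ^^ c) := by
    intro x y hx hy hxy
    have hxn := hlt x hx
    have hx' : x.beq n = false := by
      rw [Bool.eq_false_iff, Ne, Nat.beq_eq]; omega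
    by_cases hyn : y = n
    · rw [hyn, hrow x (by rwa [← natBit_eq_testBit])]
      simp [extBit, hx', natBit_eq_testBit]
    · have hy' : y.beq n = false := by
        rw [Bool.eq_false_iff, Ne, Nat.beq_eq]; omega
      have := hle y hy
      rw [hψ x y hxn (by omega) hxy]
      simp [extBit, hx', hy']
  intro x y hx hy hxy
  rcases hx with hx | hx
  · exact main x y hx hy hxy
  · rcases hy with hy | hy
    · rw [hs, main y x hy (Or.inr hx) hxy.symm, extBit_comm _ _ _ _ _ hxy.symm]
      simp only [Bool.xor_comm, Bool.xor_left_comm]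
    · exact absurd (hx.trans hy.symm) hxy

/-- `checkRows` walks a binary tree of prefixes of the new row; the induction follows the one branch
that the actual entries of `s` prescribe until a witness applies. -/
theorem switchContains_of_checkRows {V : Type*} {s : V → V → Bool} (hs : ∀ x y, s x y = s y x)
    {table : List (ℕ × ℕ)} {n code : ℕ} (ψ : ℕ → V) (η : ℕ → Bool) (c : Bool)
    (hinj : ∀ x y, x ≤ n → y ≤ n → x ≠ y → ψ x ≠ ψ y)
    (hψ : ∀ x y, x < n → y < n → x ≠ y → s (ψ x) (ψ y) = (edgeBit code x y ^^ η x ^^ η y ^^ c))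
    (gs : List (List (ℕ × ℕ × ℕ × ℕ))) (d r : ℕ) (hd : d ≤ n) (hr : r < 2 ^ d)
    (hrow : ∀ x < d, s (ψ x) (ψ n) = (r.testBit x ^^ η x ^^ η n ^^ c))
    (hmask : checkMasks table n code gs d = true)
    (h : checkRows n gs d r = true) : ∃ p ∈ table, SwitchContains s p := by
  induction gs generalizing d r with
  | nil => simp [checkRows] at h
  | cons g gs ih =>
    simp only [checkRows, atValue_eq, Bool.or_eq_true, Bool.and_eq_true, List.any_eq_true] at h
    simp only [checkMasks, Bool.and_eq_true, List.all_eq_true, Nat.blt_eq] at hmask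
    obtain ⟨hmask, hmasks⟩ := hmask
    rcases h with ⟨w, hwg, hw⟩ | ⟨h1, h2, h3⟩
    · obtain ⟨hlt, hocc⟩ := hmask w hwg
      have hlt' : w.1 < 2 ^ d := hlt
      have hbit : ∀ x, w.1.testBit x = true → x < d := by
        intro x hx
        by_contra hxd
        rw [Nat.testBit_lt_two_pow
          (hlt'.trans_le (Nat.pow_le_pow_right (by norm_num) (not_lt.mp hxd)))] at hx
        exact absurd hx (by simp)
      have hmn : w.1 < 2 ^ n := hlt'.trans_le (Nat.pow_le_pow_right (by norm_num) hd)
      rcases hw with hw | hw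
      · have hw : r &&& w.1 = w.2.1 := Nat.eq_of_beq_eq_true hw
        refine switchContains_of_agree hs ψ η c hinj hψ w.1 w.2.1 w.2.2 hmn (fun x hx => ?_) hocc
        rw [hrow x (hbit x hx), ← hw, Nat.testBit_and, hx, Bool.and_true]
      · have hw : r &&& w.1 = w.1 ^^^ w.2.1 := Nat.eq_of_beq_eq_true hw
        -- Switching the new point `n` complements its row and leaves the entries between old points
        -- unchanged.
        refine switchContains_of_agree hs ψ (Function.update η n !η n) c hinj ?_ w.1 w.2.1 w.2.2 hmn
          (fun x hx => ?_) hocc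
        · intro x y hx hy hxy
          rw [Function.update_of_ne hx.ne, Function.update_of_ne hy.ne]
          exact hψ x y hx hy hxy
        · have hxd := hbit x hx
          have := congrArg (fun z => z.testBit x) hw
          simp only [Nat.testBit_and, Nat.testBit_xor, hx, Bool.and_true, Bool.true_xor] at this
          rw [hrow x hxd, Function.update_of_ne (by omega), Function.update_self, this]
          cases w.2.1.testBit x <;> cases η x <;> cases η n <;> simp
    · rw [Nat.blt_eq] at h1
      -- This is entry `d` of the row after the switching and negation are undone; it selects the
      -- branch of the tree.
      by_cases hbit : (s (ψ d) (ψ n) ^^ η d ^^ η n ^^ c) = true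
      · refine ih (d + 1) (r ||| 2 ^ d) h1 ?_ ?_ hmasks h3
        · exact Nat.or_lt_two_pow (hr.trans (Nat.pow_lt_pow_right (by norm_num) (by omega)))
            (Nat.pow_lt_pow_right (by norm_num) (by omega))
        · intro x hx
          rw [Nat.testBit_or]
          rcases Nat.lt_succ_iff_lt_or_eq.mp hx with hx | rfl
          · rw [hrow x hx, Nat.testBit_two_pow_of_ne (by omega)]
            simp
          · rw [Nat.testBit_two_pow_self]
            revert hbit
            cases s (ψ x) (ψ n) <;> cases η x <;> cases η n <;> cases c <;> simp
      · refine ih (d + 1) r h1 (hr.trans (Nat.pow_lt_pow_right (by norm_num) (by omega))) ?_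
          hmasks h2
        intro x hx
        rcases Nat.lt_succ_iff_lt_or_eq.mp hx with hx | rfl
        · exact hrow x hx
        · rw [Nat.testBit_lt_two_pow hr]
          revert hbit
          cases s (ψ x) (ψ n) <;> cases η x <;> cases η n <;> cases c <;> simp

/-- An occurrence on fewer than eleven points misses some `v`. Adding `v` yields a one-point
extension inside `s`, which by the check contains a pattern already known not to occur. -/
theorem not_switchContains_of_checkPatterns {V : Type*} [Fintype V] (hV : Fintype.card V = 11)
    {s : V → V → Bool} (hs : ∀ x y, s x y = s y x) {base : List (ℕ × ℕ)}
    (hbase : ∀ p ∈ base, ¬ SwitchContains s p)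
    (l : List (ℕ × ℕ × List (List (ℕ × ℕ × ℕ × ℕ)))) (done : List (ℕ × ℕ))
    (hdone : ∀ p ∈ done, ¬ SwitchContains s p) (h : checkPatterns base done l = true) :
    ∀ p ∈ l, ¬ SwitchContains s (p.1, p.2.1) := by
  induction l generalizing done with
  | nil => simp
  | cons p ps ih =>
    obtain ⟨n, code, gs⟩ := p
    simp only [checkPatterns, Bool.and_eq_true, Nat.blt_eq] at h
    obtain ⟨⟨⟨⟨hn0, hn⟩, hmasks⟩, hrows⟩, hps⟩ := h
    have hp : ¬ SwitchContains s (n, code) := by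
      rintro ⟨f, ε, b, hf, hfs⟩
      obtain ⟨v, hv⟩ : ∃ v, v ∉ Set.range f := by
        by_contra! hcon
        have hsurj : Function.Surjective f := hcon
        have := Fintype.card_le_of_surjective f hsurj
        simp [hV] at this
        omega
      dsimp only at f ε hf hfs
      let ψ : ℕ → V := fun x => if h : x < n then f ⟨x, h⟩ else v
      -- The sign at the new point `n` is chosen so that its entry with point 0 becomes `false`, as
      -- the starting values `d = 1`, `r = 0` of the search demand.
      let η : ℕ → Bool := fun x => if h : x < n then ε ⟨x, h⟩ else
        if h0 : 0 < n then s (f ⟨0, h0⟩) v ^^ ε ⟨0, h0⟩ ^^ b else false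
      have hψn : ψ n = v := by simp [ψ]
      have hψl : ∀ x (h : x < n), ψ x = f ⟨x, h⟩ := fun x h => by simp [ψ, h]
      have hηl : ∀ x (h : x < n), η x = ε ⟨x, h⟩ := fun x h => by simp [η, h]
      have hinj : ∀ x y, x ≤ n → y ≤ n → x ≠ y → ψ x ≠ ψ y := by
        have key : ∀ x (h : x < n), ψ x ≠ ψ n := fun x h h' => hv ⟨_, by rw [← hψl x h, h', hψn]⟩
        intro x y hx hy hxy
        rcases Nat.lt_or_eq_of_le hx with hx' | hx'
        · rcases Nat.lt_or_eq_of_le hy with hy' | hy'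
          · rw [hψl x hx', hψl y hy']
            intro h
            exact hxy (congrArg Fin.val (hf h))
          · rw [hy']
            exact key x hx'
        · rw [hx']
          exact (key y (by omega)).symm
      have hrow : ∀ x < 1, s (ψ x) (ψ n) = (Nat.testBit 0 x ^^ η x ^^ η n ^^ b) := by
        intro x hx
        obtain rfl : x = 0 := by omega
        have : η n = (s (f ⟨0, hn0⟩) v ^^ ε ⟨0, hn0⟩ ^^ b) := by simp [η, hn0]
        rw [hψl 0 hn0, hψn, hηl 0 hn0, this]
        cases s (f ⟨0, hn0⟩) v <;> cases ε ⟨0, hn0⟩ <;> cases b <;> simp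
      have hold : ∀ x y, x < n → y < n → x ≠ y →
          s (ψ x) (ψ y) = (edgeBit code x y ^^ η x ^^ η y ^^ b) := by
        intro x y hx hy hxy
        rw [hψl x hx, hψl y hy, hηl x hx, hηl y hy]
        exact hfs ⟨x, hx⟩ ⟨y, hy⟩ (fun h => hxy (congrArg Fin.val h))
      obtain ⟨q, hq, hqs⟩ := switchContains_of_checkRows hs ψ η b hinj hold gs 1 0 hn0
        (by norm_num) hrow hmasks hrows
      rcases List.mem_append.mp hq with hq | hq
      · exact hbase q hq hqs
      · exact hdone q hq hqs
    intro q hq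
    rcases List.mem_cons.mp hq with rfl | hq
    · exact hp
    · refine ih _ ?_ hps q hq
      intro q' hq'
      rcases List.mem_cons.mp hq' with rfl | hq'
      · exact hp
      · exact hdone q' hq'

/-! ### The forbidden patterns and the certificate -/

/-- The sign patterns that cannot occur: five points with equal signs, a pentagon with two twins
joined to it, and eleven points of the conference matrix of order fourteen. -/
def forbiddenPatterns : List (ℕ × ℕ) :=
  [(5, 0), (7, 0x124220), (11, 0x2789e4e4c92110)]

set_option maxRecDepth 20000 in
/-- Sign patterns on fewer than eleven points, each with, for each of its extensions by a point, a
witness that this extension contains one of the forbidden patterns or a pattern earlier in the list. A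
witness gives a mask, the entries of the row on this mask up to complement, the index of the
contained pattern with a sign, and the points at which it occurs. -/
def patternData : List (ℕ × ℕ × List (List (ℕ × ℕ × ℕ × ℕ))) :=
  -- In a witness, the third number is `2 * t + b` with `b` the global negation. The index `t` is 0,
  -- 1 or 2 for a forbidden pattern; from 3 on it counts the earlier entries of this list, the most
  -- recent first. The hexadecimal digits of the fourth number, lowest first, are the points. The
  -- inner list at position `k`, counted from 0, is consulted when `k + 1` entries of the row are
  -- known.
  [(10, 0xeab61814a24, [[], [], [], [], [], [], [(0x55, 0x0, 0, 0xa6420), (0x5a, 0x42, 1,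
   0xa6431), (0x66, 0x64, 0, 0xa6521), (0x65, 0x0, 0, 0xa6520)], [(0x8d, 0x8c, 1, 0xa7320),
   (0x93, 0x0, 0, 0xa7410), (0xd7, 0xc0, 2, 0x6a72140), (0xb4, 0x84, 1, 0xa7542), (0xca, 0x42, 1,
   0xa7631)], [(0x198, 0x90, 0, 0xa8743), (0x131, 0x130, 1, 0xa8540), (0x149, 0x0, 0, 0xa8630),
   (0x18f, 0xe, 3, 0x7a83120), (0x107, 0x106, 1, 0xa8210)], [(0x20e, 0x204, 0, 0xa9321), (0x344,
   0x104, 1, 0xa9862), (0x238, 0x210, 0, 0xa9543), (0x273, 0x50, 3, 0xa654091), (0x289, 0x288, 1,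
   0xa9730), (0x3a0, 0x300, 0, 0xa9875), (0x286, 0x204, 0, 0xa9721)]]),
   (10, 0x1d6341814a24, [[], [], [], [], [], [], [(0x55, 0x0, 0, 0xa6420), (0x5a, 0x42, 1,
   0xa6431), (0x69, 0x0, 0, 0xa6530), (0x66, 0x64, 0, 0xa6521), (0x6f, 0x68, 2, 0xa231065)],
   [(0x8d, 0x8c, 1, 0xa7320), (0x93, 0x0, 0, 0xa7410), (0xaa, 0x22, 1, 0xa7531), (0xf3, 0x50, 2,
   0x6a45170), (0xb4, 0x84, 1, 0xa7542)], [(0x10b, 0x0, 0, 0xa8310), (0x131, 0x130, 1, 0xa8540),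
   (0x17a, 0x3a, 3, 0xa835164), (0x16b, 0x140, 2, 0x6a85130), (0x197, 0x92, 2, 0xa842071)],
   [(0x232, 0x220, 0, 0xa9541), (0x207, 0x206, 1, 0xa9210), (0x243, 0x242, 1, 0xa9610), (0x25b,
   0x4a, 3, 0x49a3061), (0x298, 0x90, 0, 0xa9743), (0x28f, 0xe, 3, 0x7a93120), (0x2b9, 0xa0, 2,
   0x75a4093)]]),
   (10, 0x15e341814a24, [[], [], [], [], [], [(0x3f, 0x12, 2, 0x42310a5)], [(0x55, 0x0, 0,
   0xa6420), (0x5a, 0x42, 1, 0xa6431), (0x69, 0x0, 0, 0xa6530)], [(0x8d, 0x8c, 1, 0xa7320),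
   (0x93, 0x0, 0, 0xa7410), (0xaa, 0x22, 1, 0xa7531), (0xd1, 0x0, 0, 0xa7640), (0xd7, 0xc0, 2,
   0x6a72140)], [(0x10b, 0x0, 0, 0xa8310), (0x131, 0x130, 1, 0xa8540), (0x11c, 0x108, 0,
   0xa8432), (0x16b, 0x140, 2, 0x6a85130), (0x152, 0x42, 1, 0xa8641), (0x11f, 0x12, 2,
   0x41a2083)], [(0x232, 0x220, 0, 0xa9541), (0x207, 0x206, 1, 0xa9210), (0x219, 0x218, 1,
   0xa9430), (0x339, 0x38, 3, 0x8a95340), (0x2a1, 0x0, 0, 0xa9750), (0x335, 0x124, 3, 0x59a4280),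
   (0x390, 0x310, 1, 0xa9874)]]),
   (10, 0x367a5814a24, [[], [], [], [], [], [(0x3f, 0xe, 3, 0x51340a2)], [(0x55, 0x0, 0,
   0xa6420), (0x5a, 0x42, 1, 0xa6431), (0x66, 0x64, 0, 0xa6521), (0x69, 0x0, 0, 0xa6530), (0x77,
   0x54, 2, 0xa541062)], [(0x8d, 0x8c, 1, 0xa7320), (0xb8, 0x90, 0, 0xa7543), (0xd7, 0xc0, 2,
   0x6a72140), (0x93, 0x0, 0, 0xa7410), (0xcf, 0xc8, 3, 0x6a21073), (0xcc, 0x8c, 1, 0xa7632)],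
   [(0x10e, 0x104, 0, 0xa8321), (0x134, 0x4, 1, 0xa8542), (0x1c4, 0x84, 1, 0xa8762), (0x143,
   0x142, 1, 0xa8610), (0x119, 0x118, 1, 0xa8430)], [(0x381, 0x0, 0, 0xa9870), (0x207, 0x206, 1,
   0xa9210), (0x231, 0x230, 1, 0xa9540), (0x249, 0x0, 0, 0xa9630), (0x3c9, 0xc0, 2, 0x86a7390),
   (0x32b, 0x208, 3, 0xa983051)]]),
   (10, 0x1c4365814a24, [[], [], [], [], [], [], [(0x55, 0x0, 0, 0xa6420), (0x5a, 0x42, 1,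
   0xa6431)], [(0x8d, 0x8c, 1, 0xa7320), (0xb8, 0x90, 0, 0xa7543), (0x93, 0x0, 0, 0xa7410),
   (0xde, 0x1e, 3, 0xa742163), (0xb7, 0x14, 2, 0x5a42071), (0xa6, 0x24, 0, 0xa7521)], [(0x131,
   0x130, 1, 0xa8540), (0x11c, 0x108, 0, 0xa8432), (0x18a, 0x102, 1, 0xa8731), (0x149, 0x0, 0,
   0xa8630), (0x107, 0x106, 1, 0xa8210), (0x1a4, 0x180, 0, 0xa8752), (0x12a, 0x122, 1, 0xa8531)],
   [(0x20e, 0x4, 0, 0xa9321), (0x234, 0x204, 1, 0xa9542), (0x294, 0x284, 1, 0xa9742), (0x3a0,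
   0x180, 0, 0xa9875), (0x23b, 0xa, 2, 0xa345190), (0x29d, 0x210, 3, 0xa934072), (0x312, 0x100,
   0, 0xa9841), (0x3ff, 0x5e, 4, 0xa8654927031), (0x3ff, 0xea, 4, 0xa2594631780), (0x3ff, 0x2f0,
   4, 0xa8713649520), (0x3ff, 0x358, 4, 0xa8902736145)]]),
   (10, 0x16e341814a24, [[], [], [], [], [], [(0x3f, 0x38, 3, 0x23510a4)], [(0x55, 0x0, 0,
   0xa6420), (0x5a, 0x42, 1, 0xa6431), (0x66, 0x64, 0, 0xa6521)], [(0x8d, 0x8c, 1, 0xa7320),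
   (0x93, 0x0, 0, 0xa7410), (0xe1, 0x0, 0, 0xa7650), (0xd7, 0xc0, 2, 0x6a72140)], [(0x10b, 0x0,
   0, 0xa8310), (0x131, 0x130, 1, 0xa8540), (0x152, 0x42, 1, 0xa8641), (0x197, 0x92, 2,
   0xa842071), (0x1f8, 0x1a0, 3, 0x67a4385)], [(0x238, 0x210, 0, 0xa9543), (0x2a2, 0x222, 1,
   0xa9751), (0x243, 0x242, 1, 0xa9610), (0x2f1, 0x50, 2, 0xa695470), (0x333, 0x32, 3,
   0x8a94150), (0x25e, 0x6, 3, 0x6a93241), (0x348, 0x200, 0, 0xa9863), (0x305, 0x304, 1,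
   0xa9820), (0x29b, 0x92, 2, 0xa913074)]]),
   (10, 0x5e585814a24, [[], [], [], [], [], [(0x3f, 0xa, 2, 0x35410a2), (0x3f, 0x32, 3,
   0x34120a5)], [(0x55, 0x0, 0, 0xa6420), (0x5a, 0x42, 1, 0xa6431), (0x66, 0x64, 0, 0xa6521)],
   [(0x8d, 0x8c, 1, 0xa7320), (0xb8, 0x90, 0, 0xa7543), (0xd7, 0xc0, 2, 0x6a72140)], [(0x183,
   0x0, 0, 0xa8710), (0x1e0, 0xa0, 1, 0xa8765), (0x119, 0x118, 1, 0xa8430), (0x194, 0x84, 1,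
   0xa8742), (0x14f, 0x104, 2, 0x81620a3)], [(0x348, 0x300, 0, 0xa9863), (0x306, 0x206, 1,
   0xa9821), (0x243, 0x242, 1, 0xa9610), (0x381, 0x0, 0, 0xa9870), (0x355, 0x104, 2, 0x9a28064),
   (0x22c, 0x20c, 1, 0xa9532), (0x219, 0x218, 1, 0xa9430), (0x254, 0x200, 0, 0xa9642), (0x232,
   0x220, 0, 0xa9541), (0x388, 0x380, 0, 0xa9873), (0x2e0, 0xa0, 1, 0xa9765), (0x3ff, 0x136, 4,
   0x3a956782410), (0x3ff, 0x1c4, 5, 0x5a738964201), (0x3ff, 0x1ea, 5, 0x5721a396840), (0x3ff,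
   0x2f0, 4, 0x3940a578621)]]),
   (10, 0x1d0b61814a24, [[], [], [], [], [], [(0x3f, 0xa, 2, 0x35410a2)], [(0x55, 0x0, 0,
   0xa6420), (0x5a, 0x42, 1, 0xa6431), (0x69, 0x0, 0, 0xa6530), (0x66, 0x64, 0, 0xa6521)],
   [(0x8d, 0x8c, 1, 0xa7320), (0x93, 0x0, 0, 0xa7410), (0xcf, 0xc8, 3, 0x6a21073), (0xfa, 0xa2,
   3, 0x7a65431), (0xb4, 0x84, 1, 0xa7542), (0xd7, 0xc0, 2, 0x6a72140)], [(0x198, 0x90, 0,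
   0xa8743), (0x131, 0x130, 1, 0xa8540), (0x1c4, 0x184, 1, 0xa8762), (0x1ae, 0xe, 3, 0xa782153),
   (0x192, 0x100, 0, 0xa8741), (0x11c, 0x108, 0, 0xa8432), (0x107, 0x106, 1, 0xa8210)], [(0x324,
   0x100, 0, 0xa9852), (0x2a2, 0x22, 1, 0xa9751), (0x20b, 0x0, 0, 0xa9310), (0x311, 0x310, 1,
   0xa9840), (0x238, 0x10, 0, 0xa9543), (0x273, 0x62, 3, 0x96540a1)]]),
   (10, 0x1dab01814a24, [[], [], [], [], [], [], [(0x55, 0x0, 0, 0xa6420), (0x5a, 0x42, 1,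
   0xa6431), (0x69, 0x0, 0, 0xa6530)], [(0x8d, 0x8c, 1, 0xa7320), (0x93, 0x0, 0, 0xa7410), (0xaa,
   0x22, 1, 0xa7531), (0xd7, 0xc0, 2, 0x6a72140), (0xfa, 0xa2, 3, 0x7a65431)], [(0x10b, 0x0, 0,
   0xa8310), (0x131, 0x130, 1, 0xa8540), (0x198, 0x90, 0, 0xa8743), (0x116, 0x6, 1, 0xa8421)],
   [(0x232, 0x220, 0, 0xa9541), (0x219, 0x218, 1, 0xa9430), (0x20e, 0x204, 0, 0xa9321), (0x243,
   0x242, 1, 0xa9610), (0x30f, 0x104, 2, 0x9a82031), (0x339, 0x38, 3, 0x8a95340)]]),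
   (10, 0x1b6585814a24, [[], [], [], [], [], [(0x3f, 0x1c, 3, 0x54210a3), (0x3f, 0x24, 2,
   0x53420a1)], [(0x55, 0x0, 0, 0xa6420), (0x5a, 0x42, 1, 0xa6431)], [(0x8d, 0x8c, 1, 0xa7320),
   (0xb8, 0x90, 0, 0xa7543), (0x93, 0x0, 0, 0xa7410), (0xd7, 0xc0, 2, 0x6a72140), (0xcc, 0x8c, 1,
   0xa7632)], [(0x119, 0x118, 1, 0xa8430), (0x125, 0x0, 0, 0xa8520), (0x194, 0x84, 1, 0xa8742)],
   [(0x231, 0x230, 1, 0xa9540), (0x249, 0x0, 0, 0xa9630), (0x21c, 0x208, 0, 0xa9432), (0x207,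
   0x206, 1, 0xa9210), (0x339, 0x38, 3, 0x9a85340), (0x2ab, 0xa, 3, 0xa173095), (0x2b6, 0x214, 2,
   0x95a4271), (0x285, 0x284, 1, 0xa9720), (0x298, 0x90, 0, 0xa9743), (0x270, 0x230, 1,
   0xa9654)]]),
   (10, 0x136585814a24, [[], [], [], [], [], [(0x3f, 0x24, 2, 0x53420a1), (0x3f, 0x32, 3,
   0x34120a5)], [(0x55, 0x0, 0, 0xa6420), (0x5a, 0x42, 1, 0xa6431), (0x69, 0x0, 0, 0xa6530)],
   [(0x8d, 0x8c, 1, 0xa7320), (0xb8, 0x90, 0, 0xa7543), (0x93, 0x0, 0, 0xa7410), (0xd7, 0xc0, 2,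
   0x6a72140), (0xb7, 0x14, 2, 0x5a42071), (0xcc, 0x8c, 1, 0xa7632), (0xde, 0x1e, 3, 0xa742163)],
   [(0x119, 0x118, 1, 0xa8430), (0x125, 0x0, 0, 0xa8520), (0x194, 0x84, 1, 0xa8742), (0x116, 0x6,
   1, 0xa8421), (0x173, 0x62, 3, 0x86540a1)], [(0x231, 0x230, 1, 0xa9540), (0x249, 0x0, 0,
   0xa9630), (0x21c, 0x208, 0, 0xa9432), (0x207, 0x206, 1, 0xa9210), (0x339, 0x38, 3, 0x9a85340),
   (0x23b, 0xa, 3, 0xa143095), (0x270, 0x230, 1, 0xa9654), (0x3ff, 0x5e, 4, 0x39a56782410),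
   (0x3ff, 0xf0, 5, 0x67a43928501), (0x3ff, 0x1ea, 5, 0x59a81704623), (0x3ff, 0x3c4, 4,
   0x89a02736145)]]),
   (10, 0xae5e9014a24, [[], [], [], [], [], [(0x3f, 0x24, 2, 0x53420a1), (0x3f, 0x32, 3,
   0x34120a5), (0x3f, 0x38, 3, 0x23510a4)], [(0x55, 0x0, 0, 0xa6420), (0x5a, 0x42, 1, 0xa6431),
   (0x69, 0x0, 0, 0xa6530), (0x66, 0x64, 0, 0xa6521)], [(0xf0, 0x30, 1, 0xa7654), (0xaa, 0x22, 1,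
   0xa7531), (0x9c, 0x8, 0, 0xa7432)], [(0x107, 0x106, 1, 0xa8210), (0x132, 0x120, 0, 0xa8541),
   (0x1c8, 0x180, 0, 0xa8763), (0x119, 0x118, 1, 0xa8430), (0x12c, 0x10c, 1, 0xa8532), (0x1a1,
   0x0, 0, 0xa8750)], [(0x360, 0x220, 1, 0xa9865), (0x2c2, 0x240, 0, 0xa9761), (0x289, 0x288, 1,
   0xa9730), (0x24c, 0x20c, 1, 0xa9632), (0x2a4, 0x200, 0, 0xa9752), (0x238, 0x210, 0, 0xa9543),
   (0x30a, 0x300, 0, 0xa9831)]]),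
   (10, 0xfaf09014a24, [[], [], [], [], [], [], [(0x55, 0x0, 0, 0xa6420), (0x5a, 0x42, 1,
   0xa6431), (0x77, 0x54, 2, 0xa541062), (0x66, 0x64, 0, 0xa6521)], [(0xa5, 0x0, 0, 0xa7520),
   (0xf0, 0x30, 1, 0xa7654), (0x9c, 0x8, 0, 0xa7432), (0xaa, 0x22, 1, 0xa7531), (0x93, 0x0, 0,
   0xa7410), (0xcf, 0x46, 3, 0x76230a1)], [(0x10b, 0x0, 0, 0xa8310), (0x131, 0x130, 1, 0xa8540),
   (0x186, 0x6, 1, 0xa8721), (0x198, 0x90, 0, 0xa8743), (0x13d, 0x124, 3, 0x34a2085)], [(0x292,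
   0x200, 0, 0xa9741), (0x289, 0x288, 1, 0xa9730), (0x268, 0x200, 0, 0xa9653), (0x234, 0x4, 1,
   0xa9542), (0x3a0, 0x300, 0, 0xa9875), (0x2c4, 0x4, 1, 0xa9762), (0x378, 0x220, 2, 0x8a54396),
   (0x3c9, 0x188, 3, 0x89a6370)]]),
   (9, 0x6a1814a24, [[], [], [], [], [], [(0x3f, 0x26, 3, 0x4523091), (0x3f, 0x32, 3,
   0x3412095)], [(0x55, 0x0, 0, 0x96420), (0x5a, 0x42, 1, 0x96431), (0x66, 0x64, 0, 0x96521)],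
   [(0x8d, 0x8c, 1, 0x97320), (0xe1, 0x0, 0, 0x97650), (0xe7, 0xe0, 2, 0x9271065), (0x93, 0x0, 0,
   0x97410), (0xb4, 0x84, 1, 0x97542), (0xf3, 0x50, 2, 0x6945170), (0xaa, 0x22, 1, 0x97531)],
   [(0x10e, 0x104, 0, 0x98321), (0x198, 0x190, 0, 0x98743), (0x1c4, 0x84, 1, 0x98762), (0x1a2,
   0x122, 1, 0x98751), (0x15b, 0x52, 3, 0x4983061), (0x143, 0x142, 1, 0x98610), (0x1b6, 0x36, 3,
   0x4892175), (0x152, 0x142, 1, 0x98641), (0x123, 0x122, 1, 0x98510), (0x19e, 0x180, 2,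
   0x7294183)]]),
   (9, 0x341814a24, [[], [], [], [], [], [(0x3f, 0xe, 3, 0x5134092), (0x3f, 0x1c, 3, 0x5421093),
   (0x3f, 0x24, 2, 0x5342091)], [(0x55, 0x0, 0, 0x96420), (0x5a, 0x42, 1, 0x96431), (0x69, 0x0,
   0, 0x96530), (0x6f, 0x68, 2, 0x9231065)], [(0x8d, 0x8c, 1, 0x97320), (0x93, 0x0, 0, 0x97410),
   (0xfc, 0xa4, 3, 0x9564372), (0xaa, 0x22, 1, 0x97531), (0xca, 0x42, 1, 0x97631), (0xb4, 0x84,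
   1, 0x97542), (0xd1, 0x0, 0, 0x97640), (0xe1, 0x0, 0, 0x97650)], [(0x10b, 0x0, 0, 0x98310),
   (0x131, 0x130, 1, 0x98540), (0x11c, 0x108, 0, 0x98432), (0x1c1, 0x0, 0, 0x98760), (0x197,
   0x92, 2, 0x9842071), (0x126, 0x24, 0, 0x98521), (0x152, 0x42, 1, 0x98641), (0x16b, 0x140, 2,
   0x6985130), (0x19e, 0x180, 2, 0x9374182), (0x1ff, 0x15e, 28, 0x9876543210), (0x1ff, 0x16e, 22,
   0x9876543210), (0x1ff, 0x1d6, 30, 0x9876543210)]]),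
   (9, 0xb61814a24, [[], [], [], [], [], [(0x3f, 0x12, 2, 0x4231095), (0x3f, 0xa, 2, 0x3541092),
   (0x3f, 0x14, 2, 0x4152093), (0x3f, 0x38, 3, 0x2351094)], [(0x55, 0x0, 0, 0x96420), (0x5a,
   0x42, 1, 0x96431), (0x69, 0x0, 0, 0x96530), (0x66, 0x64, 0, 0x96521)], [(0x8d, 0x8c, 1,
   0x97320), (0x93, 0x0, 0, 0x97410), (0xaa, 0x22, 1, 0x97531), (0xd7, 0xc0, 2, 0x6972140),
   (0xf3, 0x50, 2, 0x6945170), (0xb4, 0x84, 1, 0x97542), (0xfc, 0xa4, 3, 0x9564372)], [(0x198,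
   0x90, 0, 0x98743), (0x131, 0x130, 1, 0x98540), (0x1c4, 0x184, 1, 0x98762), (0x11c, 0x108, 0,
   0x98432), (0x18f, 0xe, 3, 0x7983120), (0x107, 0x106, 1, 0x98210), (0x192, 0x100, 0, 0x98741),
   (0x1ff, 0xea, 34, 0x9876543210), (0x1ff, 0x1d0, 20, 0x9876543210), (0x1ff, 0x1da, 31,
   0x6798142530)]]),
   (9, 0x7a5814a24, [[], [], [], [], [], [(0x3f, 0x32, 3, 0x3412095), (0x3f, 0xe, 3, 0x5134092)],
   [(0x55, 0x0, 0, 0x96420), (0x5a, 0x42, 1, 0x96431), (0x7d, 0x24, 2, 0x9543260), (0x69, 0x0, 0,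
   0x96530), (0x77, 0x54, 2, 0x9541062)], [(0x8d, 0x8c, 1, 0x97320), (0xb8, 0x90, 0, 0x97543),
   (0x93, 0x0, 0, 0x97410), (0xd7, 0xc0, 2, 0x6972140), (0xcc, 0x8c, 1, 0x97632), (0xde, 0x1e, 3,
   0x9742163), (0xca, 0x42, 1, 0x97631), (0xcf, 0xc8, 3, 0x6921073)], [(0x10e, 0x104, 0,
   0x98321), (0x134, 0x4, 1, 0x98542), (0x119, 0x118, 1, 0x98430), (0x168, 0x100, 0, 0x98653),
   (0x143, 0x142, 1, 0x98610), (0x16d, 0x64, 2, 0x9328065), (0x123, 0x122, 1, 0x98510), (0x1c2,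
   0x142, 1, 0x98761), (0x1ba, 0x18a, 2, 0x8493175), (0x1c4, 0x84, 1, 0x98762), (0x1ff, 0x36, 30,
   0x9876543210), (0x1ff, 0x58, 36, 0x178952643), (0x1ff, 0x5e, 36, 0x4268951703), (0x1ff, 0xf0,
   30, 0x9867503124)]]),
   (9, 0x585814a24, [[], [], [], [], [], [(0x3f, 0x32, 3, 0x3412095), (0x3f, 0xe, 3, 0x5134092),
   (0x3f, 0x38, 3, 0x2351094), (0x3f, 0x3e, 3, 0x4253190)], [(0x55, 0x0, 0, 0x96420), (0x5a,
   0x42, 1, 0x96431), (0x69, 0x0, 0, 0x96530), (0x66, 0x64, 0, 0x96521), (0x7d, 0x24, 2,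
   0x9543260)], [(0x8d, 0x8c, 1, 0x97320), (0xb8, 0x90, 0, 0x97543), (0xd7, 0xc0, 2, 0x6972140),
   (0xa6, 0x24, 0, 0x97521), (0xca, 0x42, 1, 0x97631), (0x93, 0x0, 0, 0x97410)], [(0x183, 0x0, 0,
   0x98710), (0x1e0, 0xa0, 1, 0x98765), (0x119, 0x118, 1, 0x98430), (0x125, 0x0, 0, 0x98520),
   (0x12a, 0x22, 1, 0x98531), (0x116, 0x6, 1, 0x98421), (0x15b, 0x1a, 3, 0x6891043), (0x194,
   0x84, 1, 0x98742), (0x14f, 0x104, 2, 0x8162093), (0x173, 0x62, 3, 0x8654091), (0x173, 0x172,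
   3, 0x8564190), (0x1ff, 0x5e, 26, 0x9876543210), (0x1ff, 0x7a, 38, 0x179852643), (0x1ff, 0xf0,
   26, 0x4759063821), (0x1ff, 0xfa, 38, 0x6897420531), (0x1ff, 0x136, 18, 0x9876543210), (0x1ff,
   0x1b6, 20, 0x9876543210), (0x1ff, 0x1c4, 26, 0x3927058461), (0x1ff, 0x1ea, 26,
   0x7190548632)]]),
   (9, 0x5e9014a24, [[], [], [], [], [], [(0x3f, 0x3e, 3, 0x4253190), (0x3f, 0xe, 3, 0x5134092),
   (0x3f, 0x14, 2, 0x4152093)], [(0x55, 0x0, 0, 0x96420), (0x5a, 0x42, 1, 0x96431), (0x69, 0x0,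
   0, 0x96530), (0x66, 0x64, 0, 0x96521), (0x7d, 0x24, 2, 0x9543260)], [(0xf0, 0x30, 1, 0x97654),
   (0x93, 0x0, 0, 0x97410), (0x9c, 0x8, 0, 0x97432), (0xaa, 0x22, 1, 0x97531), (0xa5, 0x0, 0,
   0x97520), (0xcf, 0xe, 3, 0x7316092), (0xcf, 0x8c, 3, 0x6721093), (0xcf, 0xce, 3, 0x7263190)],
   [(0x107, 0x106, 1, 0x98210), (0x132, 0x120, 0, 0x98541), (0x1c8, 0x180, 0, 0x98763), (0x119,
   0x118, 1, 0x98430), (0x12c, 0x10c, 1, 0x98532), (0x143, 0x142, 1, 0x98610), (0x186, 0x106, 1,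
   0x98721), (0x1a1, 0x0, 0, 0x98750), (0x1ff, 0xae, 18, 0x9876543210), (0x1ff, 0xba, 26,
   0x7896014532), (0x1ff, 0xea, 26, 0x5894036712), (0x1ff, 0xfa, 35, 0x7698051342), (0x1ff,
   0x170, 26, 0x6897215430), (0x1ff, 0x1d0, 26, 0x4895237610), (0x1ff, 0x1f0, 35,
   0x6798241350)]]),
   (9, 0xb41814a24, [[], [], [], [], [], [], [(0x55, 0x0, 0, 0x96420), (0x5a, 0x42, 1, 0x96431),
   (0x69, 0x0, 0, 0x96530), (0x6f, 0x68, 2, 0x9231065), (0x65, 0x0, 0, 0x96520)], [(0x8d, 0x8c,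
   1, 0x97320), (0x93, 0x0, 0, 0x97410), (0xaa, 0x22, 1, 0x97531), (0xf3, 0x50, 2, 0x6945170),
   (0xe1, 0x0, 0, 0x97650), (0xbd, 0xa4, 3, 0x5934072), (0xca, 0x42, 1, 0x97631), (0xd7, 0xc0, 2,
   0x6972140)], [(0x10b, 0x0, 0, 0x98310), (0x131, 0x130, 1, 0x98540), (0x198, 0x90, 0, 0x98743),
   (0x1c2, 0x42, 1, 0x98761), (0x126, 0x24, 0, 0x98521), (0x1ea, 0x2a, 3, 0x9658371), (0x152,
   0x42, 1, 0x98641), (0x10e, 0x4, 0, 0x98321), (0x185, 0x184, 1, 0x98720), (0x16d, 0x28, 2,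
   0x8593260), (0x19e, 0x80, 2, 0x7294183), (0x1ff, 0xda, 39, 0x718942536), (0x1ff, 0xfa, 24,
   0x6072895341)]]),
   (9, 0xb45814a24, [[], [], [], [], [], [(0x3f, 0x1c, 3, 0x5421093)], [(0x55, 0x0, 0, 0x96420),
   (0x5a, 0x42, 1, 0x96431), (0x66, 0x64, 0, 0x96521)], [(0x8d, 0x8c, 1, 0x97320), (0xb8, 0x90,
   0, 0x97543), (0x93, 0x0, 0, 0x97410), (0xd7, 0xc0, 2, 0x6972140), (0xd1, 0x0, 0, 0x97640),
   (0xcf, 0xc8, 3, 0x6921073), (0xcc, 0x8c, 1, 0x97632), (0xa6, 0x24, 0, 0x97521), (0xde, 0x1e,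
   3, 0x9742163)], [(0x10e, 0x4, 0, 0x98321), (0x131, 0x130, 1, 0x98540), (0x1c4, 0x184, 1,
   0x98762), (0x149, 0x0, 0, 0x98630), (0x1b5, 0x114, 3, 0x5974280), (0x198, 0x90, 0, 0x98743),
   (0x1c2, 0x42, 1, 0x98761), (0x17a, 0x3a, 3, 0x9835164), (0x152, 0x42, 1, 0x98641), (0x14f,
   0x148, 2, 0x9162083), (0x1ad, 0xa8, 3, 0x9835270)]]),
   (9, 0xb01814a24, [[], [], [], [], [], [(0x3f, 0xa, 2, 0x3541092), (0x3f, 0x12, 2, 0x4231095)],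
   [(0x55, 0x0, 0, 0x96420), (0x5a, 0x42, 1, 0x96431), (0x69, 0x0, 0, 0x96530), (0x66, 0x64, 0,
   0x96521), (0x6f, 0x68, 2, 0x9231065)], [(0x8d, 0x8c, 1, 0x97320), (0x93, 0x0, 0, 0x97410),
   (0xaa, 0x22, 1, 0x97531), (0xf3, 0x50, 2, 0x6945170), (0xe1, 0x0, 0, 0x97650), (0xfc, 0xa4, 3,
   0x9564372), (0xca, 0x42, 1, 0x97631), (0xd7, 0xc0, 2, 0x6972140)], [(0x10b, 0x0, 0, 0x98310),
   (0x131, 0x130, 1, 0x98540), (0x198, 0x90, 0, 0x98743), (0x1c2, 0x42, 1, 0x98761), (0x1ea,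
   0x2a, 3, 0x9658371), (0x145, 0x0, 0, 0x98620), (0x152, 0x42, 1, 0x98641), (0x17c, 0x124, 3,
   0x9436285), (0x1ff, 0xfa, 42, 0x1750234896), (0x1ff, 0x15e, 42, 0x1820543796), (0x1ff, 0x1d6,
   42, 0x8679312504), (0x1ff, 0x1da, 30, 0x9876543210), (0x1ff, 0x1ea, 42, 0x7689415203)]]),
   (9, 0x365814a24, [[], [], [], [], [], [(0x3f, 0x38, 3, 0x2351094), (0x3f, 0x24, 2, 0x5342091),
   (0x3f, 0x32, 3, 0x3412095)], [(0x55, 0x0, 0, 0x96420), (0x5a, 0x42, 1, 0x96431), (0x66, 0x64,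
   0, 0x96521), (0x69, 0x0, 0, 0x96530)], [(0x8d, 0x8c, 1, 0x97320), (0xb8, 0x90, 0, 0x97543),
   (0x93, 0x0, 0, 0x97410), (0xcc, 0x8c, 1, 0x97632), (0xd7, 0xc0, 2, 0x6972140), (0xb7, 0x14, 2,
   0x5942071), (0xa6, 0x24, 0, 0x97521)], [(0x131, 0x130, 1, 0x98540), (0x149, 0x0, 0, 0x98630),
   (0x11c, 0x108, 0, 0x98432), (0x107, 0x106, 1, 0x98210), (0x170, 0x130, 1, 0x98654), (0x1a4,
   0x180, 0, 0x98752), (0x1c1, 0x0, 0, 0x98760), (0x12a, 0x122, 1, 0x98531), (0x16d, 0x28, 2,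
   0x8593260), (0x1ab, 0x10a, 3, 0x7593081), (0x1ff, 0x5a, 34, 0x4862107935), (0x1ff, 0x5e, 36,
   0x658473912), (0x1ff, 0x7a, 42, 0x8976543210), (0x1ff, 0xea, 36, 0x6073258914), (0x1ff, 0xf0,
   28, 0x5136482790), (0x1ff, 0xfa, 34, 0x2304165987), (0x1ff, 0x158, 28, 0x8976543210), (0x1ff,
   0x1c4, 40, 0x9876543210)]]),
   (9, 0x5e1814a24, [[], [], [], [], [], [(0x3f, 0x32, 3, 0x3412095), (0x3f, 0xa, 2, 0x3541092),
   (0x3f, 0xe, 3, 0x5134092)], [(0x55, 0x0, 0, 0x96420), (0x5a, 0x42, 1, 0x96431), (0x69, 0x0, 0,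
   0x96530), (0x66, 0x64, 0, 0x96521)], [(0x8d, 0x8c, 1, 0x97320), (0x93, 0x0, 0, 0x97410),
   (0xb4, 0x84, 1, 0x97542), (0xd1, 0x0, 0, 0x97640), (0xbd, 0xa4, 3, 0x5934072), (0xf3, 0x50, 2,
   0x6945170), (0xaa, 0x22, 1, 0x97531), (0xbe, 0x3e, 3, 0x4392175), (0xe7, 0xe0, 2, 0x9271065)],
   [(0x143, 0x142, 1, 0x98610), (0x132, 0x120, 0, 0x98541), (0x119, 0x118, 1, 0x98430), (0x154,
   0x100, 0, 0x98642), (0x1c7, 0xc0, 3, 0x9627081), (0x19e, 0x194, 2, 0x7284193), (0x1c2, 0x142,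
   1, 0x98761), (0x19d, 0x98, 3, 0x9874230), (0x107, 0x106, 1, 0x98210), (0x175, 0x64, 2,
   0x9458062), (0x18f, 0x86, 3, 0x7893120), (0x19e, 0x18a, 2, 0x8374192), (0x1ff, 0xea, 36,
   0x4135092786), (0x1ff, 0x134, 46, 0x8976543210), (0x1ff, 0x1b0, 46, 0x1920543786), (0x1ff,
   0x1d0, 36, 0x4835697210)]]),
   (9, 0xc45814a24, [[], [], [], [], [], [(0x3f, 0x26, 3, 0x4523091), (0x3f, 0x3e, 3, 0x4253190),
   (0x3f, 0x32, 3, 0x3412095), (0x3f, 0xe, 3, 0x5134092), (0x3f, 0x1c, 3, 0x5421093), (0x3f,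
   0x38, 3, 0x2351094)], [(0x55, 0x0, 0, 0x96420), (0x5a, 0x42, 1, 0x96431), (0x66, 0x64, 0,
   0x96521), (0x69, 0x0, 0, 0x96530)], [(0x8d, 0x8c, 1, 0x97320), (0xb8, 0x90, 0, 0x97543),
   (0xcc, 0x8c, 1, 0x97632), (0xd7, 0xc0, 2, 0x6972140), (0x93, 0x0, 0, 0x97410), (0xca, 0x42, 1,
   0x97631), (0xcf, 0xc8, 3, 0x6921073), (0xde, 0x1e, 3, 0x9742163)], [(0x10e, 0x4, 0, 0x98321),
   (0x134, 0x104, 1, 0x98542), (0x16e, 0x124, 2, 0x6985321), (0x1b5, 0x114, 3, 0x5794082),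
   (0x17a, 0x130, 3, 0x8935164), (0x170, 0x30, 1, 0x98654), (0x185, 0x184, 1, 0x98720), (0x194,
   0x184, 1, 0x98742), (0x1ff, 0x5e, 40, 0x2648519370), (0x1ff, 0xea, 44, 0x5714286930), (0x1ff,
   0xf6, 50, 0x7896541032), (0x1ff, 0x136, 44, 0x8976543210), (0x1ff, 0x158, 40, 0x3827059461),
   (0x1ff, 0x1f0, 40, 0x7463159820)]]),
   (9, 0xf09014a24, [[], [], [], [], [], [(0x3f, 0x1c, 3, 0x5421093)], [(0x55, 0x0, 0, 0x96420),
   (0x5a, 0x42, 1, 0x96431), (0x69, 0x0, 0, 0x96530), (0x7d, 0x24, 2, 0x9543260), (0x65, 0x0, 0,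
   0x96520)], [(0xa5, 0x0, 0, 0x97520), (0xaa, 0x22, 1, 0x97531), (0xf0, 0x30, 1, 0x97654),
   (0xcf, 0xce, 3, 0x7263190), (0x95, 0x0, 0, 0x97420), (0xcf, 0x8c, 3, 0x6721093)], [(0x10b,
   0x0, 0, 0x98310), (0x131, 0x130, 1, 0x98540), (0x186, 0x6, 1, 0x98721), (0x162, 0x60, 0,
   0x98651), (0x198, 0x90, 0, 0x98743), (0x1c1, 0x1c0, 1, 0x98760), (0x12c, 0xc, 1, 0x98532),
   (0x14c, 0xc, 1, 0x98632), (0x1cd, 0x144, 3, 0x3792086), (0x1ff, 0x7a, 40, 0x3850769412),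
   (0x1ff, 0xba, 40, 0x1840679532), (0x1ff, 0xda, 40, 0x1870549632), (0x1ff, 0xea, 40,
   0x3860459712), (0x1ff, 0xfa, 30, 0x9876543210), (0x1ff, 0x15e, 49, 0x6789241350), (0x1ff,
   0x1ae, 49, 0x7689253140)]]),
   (8, 0x1814a24, [[], [], [], [], [], [(0x3f, 0xa, 2, 0x3541082), (0x3f, 0xe, 3, 0x5134082),
   (0x3f, 0x12, 2, 0x4231085), (0x3f, 0x32, 3, 0x3412085), (0x3f, 0x14, 2, 0x4152083), (0x3f,
   0x3e, 3, 0x4253180)], [(0x55, 0x0, 0, 0x86420), (0x5a, 0x42, 1, 0x86431), (0x69, 0x0, 0,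
   0x86530), (0x66, 0x64, 0, 0x86521)], [(0x8d, 0x8c, 1, 0x87320), (0x93, 0x0, 0, 0x87410),
   (0xb4, 0x84, 1, 0x87542), (0xaa, 0x22, 1, 0x87531), (0xde, 0x1e, 3, 0x8742163), (0xf3, 0x50,
   2, 0x6845170), (0xe7, 0xe0, 2, 0x8271065), (0xfc, 0xa4, 3, 0x8564372), (0xca, 0x42, 1,
   0x87631), (0xd1, 0x0, 0, 0x87640), (0xff, 0x34, 28, 0x876543210), (0xff, 0x5e, 10,
   0x876543210), (0xff, 0x6a, 30, 0x876543210), (0xff, 0x6e, 29, 0x768045231), (0xff, 0xb0, 14,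
   0x876543210), (0xff, 0xb4, 18, 0x876543210), (0xff, 0xb6, 26, 0x876543210), (0xff, 0xba, 29,
   0x867210543), (0xff, 0xd0, 11, 0x867210543), (0xff, 0xd6, 28, 0x678312504), (0xff, 0xda, 15,
   0x687501243), (0xff, 0xea, 27, 0x867210543), (0xff, 0xf6, 31, 0x768032541), (0xff, 0xfa, 19,
   0x867210543)]]),
   (8, 0x5814a24, [[], [], [], [], [], [(0x3f, 0x32, 3, 0x3412085), (0x3f, 0x38, 3, 0x2351084),
   (0x3f, 0x3e, 3, 0x4253180)], [(0x55, 0x0, 0, 0x86420), (0x5a, 0x42, 1, 0x86431), (0x66, 0x64,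
   0, 0x86521), (0x69, 0x0, 0, 0x86530), (0x7d, 0x24, 2, 0x8543260), (0x77, 0x54, 2, 0x8541062)],
   [(0x8d, 0x8c, 1, 0x87320), (0xb8, 0x90, 0, 0x87543), (0x93, 0x0, 0, 0x87410), (0xcf, 0xc8, 3,
   0x6821073), (0xde, 0x1e, 3, 0x8742163), (0xa6, 0x24, 0, 0x87521), (0xca, 0x42, 1, 0x87631),
   (0xbb, 0xa, 2, 0x5813074), (0xcc, 0x8c, 1, 0x87632), (0xff, 0x30, 30, 0x786234510), (0xff,
   0x36, 14, 0x876543210), (0xff, 0x3a, 29, 0x768532014), (0xff, 0x58, 24, 0x876543210), (0xff,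
   0x5a, 13, 0x17835246), (0xff, 0x5e, 24, 0x867503124), (0xff, 0x7a, 26, 0x876543210), (0xff,
   0xb0, 20, 0x786234510), (0xff, 0xb4, 18, 0x876543210), (0xff, 0xb6, 20, 0x687130524), (0xff,
   0xba, 32, 0x687420531), (0xff, 0xc4, 10, 0x876543210), (0xff, 0xea, 10, 0x31586742), (0xff,
   0xf0, 14, 0x867503124), (0xff, 0xf6, 30, 0x687130524), (0xff, 0xfa, 29, 0x678531420)]]),
   (8, 0x9014a24, [[], [], [], [], [], [(0x3f, 0xe, 3, 0x5134082), (0x3f, 0x3e, 3, 0x4253180)],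
   [(0x55, 0x0, 0, 0x86420), (0x5a, 0x42, 1, 0x86431), (0x66, 0x64, 0, 0x86521), (0x69, 0x0, 0,
   0x86530), (0x6f, 0x68, 2, 0x8231065), (0x77, 0x54, 2, 0x8541062), (0x7d, 0x24, 2, 0x8543260)],
   [(0xf0, 0x30, 1, 0x87654), (0x9c, 0x8, 0, 0x87432), (0x93, 0x0, 0, 0x87410), (0xaa, 0x22, 1,
   0x87531), (0xa5, 0x0, 0, 0x87520), (0x9f, 0x92, 2, 0x8213074), (0xcf, 0xe, 3, 0x7316082),
   (0xcf, 0xce, 3, 0x7263180), (0xcf, 0x46, 3, 0x7623081), (0xcf, 0x8c, 3, 0x6721083), (0xff,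
   0x5e, 24, 0x876543210), (0xff, 0x6e, 19, 0x678254031), (0xff, 0x70, 15, 0x678430215), (0xff,
   0x7a, 15, 0x678412035), (0xff, 0x9e, 19, 0x768245013), (0xff, 0xae, 24, 0x845673210), (0xff,
   0xb0, 15, 0x768510234), (0xff, 0xba, 15, 0x768532014), (0xff, 0xd0, 15, 0x458610237), (0xff,
   0xda, 15, 0x458632017), (0xff, 0xe0, 15, 0x548730216), (0xff, 0xea, 15, 0x548712036), (0xff,
   0xf0, 10, 0x876543210), (0xff, 0xfa, 10, 0x867453012)]]),
   (8, 0x5c14a24, [[], [], [], [], [], [(0x3f, 0xa, 2, 0x3541082), (0x3f, 0x3e, 3, 0x4253180),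
   (0x3f, 0x0, 2, 0x5432180), (0x3f, 0xe, 3, 0x5134082), (0x3f, 0x24, 2, 0x5342081), (0x3f, 0x32,
   3, 0x3412085)], [(0x55, 0x0, 0, 0x86420), (0x5a, 0x42, 1, 0x86431), (0x66, 0x64, 0, 0x86521),
   (0x69, 0x0, 0, 0x86530), (0x6f, 0x68, 2, 0x8231065), (0x77, 0x54, 2, 0x8541062)], [(0x87,
   0x86, 1, 0x87210), (0xb8, 0x90, 0, 0x87543), (0xcc, 0x8c, 1, 0x87632), (0xa3, 0xa2, 1,
   0x87510), (0xd1, 0x0, 0, 0x87640), (0x96, 0x86, 1, 0x87421), (0x8d, 0x8c, 1, 0x87320), (0xcf,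
   0x48, 3, 0x8316072), (0xf5, 0x14, 2, 0x8457260), (0xff, 0x34, 18, 0x786234510), (0xff, 0x36,
   13, 0x687254031), (0xff, 0x3a, 25, 0x768532014), (0xff, 0x44, 30, 0x768024351), (0xff, 0x4c,
   19, 0x678214305), (0xff, 0x56, 28, 0x768521304), (0xff, 0x5a, 12, 0x768104235), (0xff, 0x5e,
   27, 0x687135240), (0xff, 0x76, 16, 0x786541032), (0xff, 0x7a, 19, 0x687043152), (0xff, 0xb0,
   32, 0x786234510), (0xff, 0xb4, 24, 0x678140253), (0xff, 0xc4, 33, 0x687043152), (0xff, 0xc8,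
   26, 0x745683210), (0xff, 0xd8, 28, 0x372681045), (0xff, 0xda, 17, 0x687135240), (0xff, 0xe0,
   18, 0x768053421), (0xff, 0xf0, 31, 0x687253140)]]),
   (8, 0xb014a24, [[], [], [], [], [], [], [(0x55, 0x0, 0, 0x86420), (0x5a, 0x42, 1, 0x86431),
   (0x66, 0x64, 0, 0x86521), (0x69, 0x0, 0, 0x86530), (0x6f, 0x68, 2, 0x8231065), (0x77, 0x54, 2,
   0x8541062), (0x7d, 0x24, 2, 0x8543260)], [(0x96, 0x6, 1, 0x87421), (0x99, 0x98, 1, 0x87430),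
   (0xa5, 0x0, 0, 0x87520), (0xaa, 0x22, 1, 0x87531), (0x9f, 0x92, 3, 0x2381074), (0xbb, 0x8a, 3,
   0x5481073), (0xbe, 0x3e, 3, 0x5483271), (0xdb, 0x1a, 3, 0x6781043), (0xde, 0xce, 3,
   0x6783241), (0xe7, 0xa4, 2, 0x8671052), (0xed, 0x44, 2, 0x8673250), (0xf5, 0x60, 2,
   0x7685420), (0xfa, 0xf2, 3, 0x8765431), (0xff, 0x2c, 30, 0x786543210), (0xff, 0x34, 30,
   0x786234510), (0xff, 0x4c, 30, 0x485673210), (0xff, 0x5e, 30, 0x180673245), (0xff, 0x70, 30,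
   0x382674510), (0xff, 0x7a, 30, 0x180674532), (0xff, 0xae, 30, 0x382671045), (0xff, 0xb6, 30,
   0x485671032), (0xff, 0xc4, 30, 0x485237610), (0xff, 0xd6, 30, 0x786541032), (0xff, 0xe0, 30,
   0x382547610), (0xff, 0xea, 30, 0x180547632)]]),
   (7, 0x14a24, [[], [], [], [], [], [(0x3f, 0xe, 3, 0x5134072), (0x3f, 0x32, 3, 0x3412075),
   (0x3f, 0x3e, 3, 0x4253170), (0x3f, 0x0, 2, 0x5432170), (0x3f, 0xa, 2, 0x3541072), (0x3f, 0x12,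
   2, 0x4231075)], [(0x55, 0x0, 0, 0x76420), (0x5a, 0x42, 1, 0x76431), (0x66, 0x64, 0, 0x76521),
   (0x69, 0x0, 0, 0x76530), (0x6f, 0x68, 2, 0x7231065), (0x77, 0x54, 2, 0x7541062), (0x7d, 0x24,
   2, 0x7543260), (0x7f, 0xc, 14, 0x76543210), (0x7f, 0x1e, 14, 0x76013245), (0x7f, 0x2c, 12,
   0x76543210), (0x7f, 0x2e, 8, 0x76543210), (0x7f, 0x30, 14, 0x76234510), (0x7f, 0x34, 12,
   0x76234510), (0x7f, 0x36, 8, 0x76234510), (0x7f, 0x3a, 14, 0x76014532), (0x7f, 0x44, 12,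
   0x67024351), (0x7f, 0x48, 10, 0x76543210), (0x7f, 0x4c, 8, 0x76014532), (0x7f, 0x50, 10,
   0x76234510), (0x7f, 0x56, 12, 0x76541032), (0x7f, 0x58, 6, 0x76543210), (0x7f, 0x5a, 10,
   0x76014532), (0x7f, 0x5e, 8, 0x76541032), (0x7f, 0x60, 12, 0x67053421), (0x7f, 0x6a, 12,
   0x67251403), (0x7f, 0x6e, 14, 0x76231045), (0x7f, 0x70, 8, 0x76013245), (0x7f, 0x76, 14,
   0x76541032), (0x7f, 0x7a, 8, 0x76231045)]]),
   (6, 0x4a24, [[], [], [], [], [], [(0x3f, 0x0, 2, 0x5432160), (0x3f, 0xa, 2, 0x3541062), (0x3f,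
   0xe, 3, 0x5134062), (0x3f, 0x12, 2, 0x4231065), (0x3f, 0x14, 2, 0x4152063), (0x3f, 0x1c, 3,
   0x5421063), (0x3f, 0x24, 2, 0x5342061), (0x3f, 0x26, 3, 0x4523061), (0x3f, 0x28, 2,
   0x5213064), (0x3f, 0x32, 3, 0x3412065), (0x3f, 0x38, 3, 0x2351064), (0x3f, 0x3e, 3,
   0x4253160), (0x3f, 0x2, 6, 0x6543210), (0x3f, 0x4, 6, 0x6345120), (0x3f, 0x6, 7, 0x6403251),
   (0x3f, 0x8, 6, 0x6451230), (0x3f, 0xc, 7, 0x6504312), (0x3f, 0x10, 6, 0x6512340), (0x3f, 0x16,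
   6, 0x6520413), (0x3f, 0x18, 7, 0x6452301), (0x3f, 0x1a, 6, 0x6534201), (0x3f, 0x1e, 7,
   0x6314250), (0x3f, 0x20, 6, 0x6432150), (0x3f, 0x22, 7, 0x6540321), (0x3f, 0x2a, 6,
   0x6410352), (0x3f, 0x2c, 6, 0x6502431), (0x3f, 0x2e, 7, 0x6253140), (0x3f, 0x30, 7,
   0x6513402), (0x3f, 0x34, 6, 0x6350241), (0x3f, 0x36, 7, 0x6524130), (0x3f, 0x3a, 7,
   0x6531420), (0x3f, 0x3c, 7, 0x6425310)]]),
   (10, 0x13eaa4c30224, [[], [], [], [], [(0x1f, 0x12, 6, 0xa43210)], [(0x2b, 0x0, 0, 0xa5310),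
   (0x33, 0x0, 0, 0xa5410)], [(0x47, 0x46, 1, 0xa6210), (0x5a, 0x42, 1, 0xa6431), (0x5d, 0x50, 6,
   0x6a4320)], [(0x9a, 0x82, 1, 0xa7431), (0xcc, 0xc8, 0, 0xa7632), (0xd1, 0x0, 0, 0xa7640),
   (0xea, 0x60, 6, 0x7a5631), (0x96, 0x86, 1, 0xa7421), (0xb8, 0x18, 1, 0xa7543)], [(0x1a1,
   0x1a0, 1, 0xa8750), (0x1a6, 0xa4, 6, 0x78a521), (0x115, 0x0, 0, 0xa8420), (0x1d8, 0x90, 6,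
   0x7a8643), (0x172, 0x60, 6, 0x8a5641)], [(0x219, 0x218, 1, 0xa9430), (0x232, 0x200, 0,
   0xa9541), (0x28b, 0x88, 6, 0x93a710)]]),
   (10, 0x1eadc4430224, [[], [], [], [], [(0x1f, 0x12, 8, 0xa43210)], [(0x2b, 0x0, 0, 0xa5310)],
   [(0x47, 0x46, 1, 0xa6210), (0x69, 0x0, 0, 0xa6530)], [(0x95, 0x0, 0, 0xa7420), (0x9a, 0x82, 1,
   0xa7431), (0x8f, 0x88, 8, 0x7a3210), (0xac, 0xc, 1, 0xa7532), (0xc9, 0x0, 0, 0xa7630)],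
   [(0x10d, 0x10c, 1, 0xa8320), (0x14b, 0xa, 8, 0xa38610)], [(0x2a1, 0x2a0, 1, 0xa9750), (0x2c8,
   0x200, 0, 0xa9763), (0x239, 0x30, 8, 0x95a430), (0x236, 0x24, 8, 0x5a9421), (0x306, 0x204, 0,
   0xa9821), (0x2d4, 0x250, 8, 0xa97642), (0x20e, 0x204, 0, 0xa9321), (0x252, 0x242, 1, 0xa9641),
   (0x309, 0x308, 1, 0xa9830)]]),
   (10, 0xf03a58b0a24, [[], [], [], [], [], [(0x35, 0x0, 0, 0xa5420), (0x3a, 0x22, 1, 0xa5431)],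
   [(0x47, 0x46, 1, 0xa6210), (0x5c, 0x48, 0, 0xa6432)], [(0x8d, 0x8c, 1, 0xa7320), (0x93, 0x0,
   0, 0xa7410), (0xa6, 0x24, 0, 0xa7521), (0xf0, 0x50, 1, 0xa7654), (0xca, 0x42, 1, 0xa7631)],
   [(0x10e, 0x104, 0, 0xa8321), (0x194, 0x84, 1, 0xa8742), (0x1c1, 0x0, 0, 0xa8760), (0x119,
   0x118, 1, 0xa8430)], [(0x262, 0x60, 0, 0xa9651), (0x2a1, 0x2a0, 1, 0xa9750), (0x298, 0x90, 0,
   0xa9743), (0x348, 0x108, 1, 0xa9863), (0x216, 0x6, 1, 0xa9421)]]),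
   (9, 0x363430224, [[], [], [], [], [], [(0x2b, 0x0, 0, 0x95310), (0x35, 0x0, 0, 0x95420),
   (0x3e, 0x2c, 12, 0x593421), (0x33, 0x0, 0, 0x95410)], [(0x47, 0x46, 1, 0x96210), (0x66, 0x46,
   1, 0x96521), (0x69, 0x0, 0, 0x96530)], [(0x99, 0x98, 1, 0x97430), (0x8e, 0x84, 0, 0x97321),
   (0xea, 0x48, 12, 0x975631), (0xcd, 0xc0, 12, 0x697320), (0xf2, 0x50, 12, 0x975641)], [(0x1c1,
   0x0, 0, 0x98760), (0x1a8, 0x88, 1, 0x98753), (0x165, 0x60, 12, 0x859620), (0x107, 0x106, 1,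
   0x98210), (0x18b, 0x108, 12, 0x893710), (0x11c, 0x108, 0, 0x98432), (0x163, 0x60, 12,
   0x859610)]]),
   (9, 0xba4c30224, [[], [], [], [], [(0x1f, 0x12, 14, 0x943210)], [(0x2b, 0x0, 0, 0x95310),
   (0x33, 0x0, 0, 0x95410), (0x35, 0x0, 0, 0x95420), (0x3e, 0x2c, 14, 0x593421)], [(0x47, 0x46,
   1, 0x96210), (0x56, 0x46, 1, 0x96421), (0x66, 0x46, 1, 0x96521)], [(0x9a, 0x82, 1, 0x97431),
   (0xcc, 0xc8, 0, 0x97632), (0xd1, 0x0, 0, 0x97640), (0xea, 0x60, 14, 0x795631), (0xf4, 0x60,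
   14, 0x795642), (0xb8, 0x18, 1, 0x97543)], [(0x1a1, 0x1a0, 1, 0x98750), (0x132, 0x100, 0,
   0x98541), (0x1a6, 0xa4, 14, 0x789521), (0x119, 0x118, 1, 0x98430), (0x12a, 0x100, 0, 0x98531),
   (0x153, 0x50, 14, 0x849610)]]),
   (9, 0xbe4830224, [[], [], [], [], [], [(0x2b, 0x0, 0, 0x95310)], [(0x47, 0x46, 1, 0x96210),
   (0x71, 0x0, 0, 0x96540), (0x5a, 0x42, 1, 0x96431), (0x69, 0x0, 0, 0x96530)], [(0xb8, 0x18, 1,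
   0x97543), (0xcc, 0xc8, 0, 0x97632), (0xa7, 0x22, 16, 0x957210), (0xe2, 0x42, 1, 0x97651),
   (0x8b, 0x0, 0, 0x97310), (0x93, 0x0, 0, 0x97410), (0xb6, 0x94, 16, 0x579421)], [(0x192, 0x100,
   0, 0x98741), (0x1a1, 0x1a0, 1, 0x98750), (0x163, 0x60, 16, 0x859610), (0x10d, 0x10c, 1,
   0x98320), (0x11e, 0xc, 16, 0x893421), (0x12a, 0x100, 0, 0x98531), (0x119, 0x118, 1,
   0x98430)]]),
   (9, 0x9a2cf0224, [[], [], [], [], [], [(0x2b, 0x0, 0, 0x95310), (0x35, 0x0, 0, 0x95420),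
   (0x33, 0x0, 0, 0x95410)], [(0x47, 0x46, 1, 0x96210), (0x78, 0x58, 1, 0x96543), (0x5e, 0xc, 18,
   0x693421), (0x66, 0x46, 1, 0x96521)], [(0xd2, 0xc0, 0, 0x97641), (0x9b, 0xa, 18, 0x934710)],
   [(0x1a2, 0x182, 1, 0x98751), (0x161, 0x0, 0, 0x98650), (0x119, 0x118, 1, 0x98430), (0x10e,
   0x104, 0, 0x98321), (0x196, 0x94, 18, 0x789421), (0x152, 0x140, 0, 0x98641), (0x183, 0x182, 1,
   0x98710), (0x14a, 0x140, 0, 0x98631), (0x174, 0x70, 18, 0x956842), (0x138, 0x118, 1,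
   0x98543)]]),
   (9, 0xaa4c30224, [[], [], [], [], [(0x1f, 0x12, 20, 0x943210)], [(0x2b, 0x0, 0, 0x95310),
   (0x33, 0x0, 0, 0x95410), (0x3e, 0x2c, 20, 0x593421)], [(0x47, 0x46, 1, 0x96210), (0x56, 0x46,
   1, 0x96421)], [(0x9a, 0x82, 1, 0x97431), (0xcc, 0xc8, 0, 0x97632), (0xd1, 0x0, 0, 0x97640),
   (0xea, 0x60, 20, 0x795631), (0xf4, 0x60, 20, 0x795642), (0xb8, 0x18, 1, 0x97543), (0xad, 0x28,
   20, 0x759320)], [(0x1a1, 0x1a0, 1, 0x98750), (0x1a6, 0xa4, 20, 0x789521), (0x115, 0x0, 0,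
   0x98420), (0x12a, 0x100, 0, 0x98531), (0x164, 0x44, 1, 0x98652), (0x139, 0x30, 20, 0x859430),
   (0x1ff, 0x13e, 18, 0x9876543210), (0x1ff, 0x1dc, 18, 0x9215643870)]]),
   (9, 0x3e4c30224, [[], [], [], [], [(0x1f, 0x12, 22, 0x943210)], [(0x2b, 0x0, 0, 0x95310),
   (0x35, 0x0, 0, 0x95420), (0x3e, 0x2c, 22, 0x593421)], [(0x47, 0x46, 1, 0x96210), (0x66, 0x46,
   1, 0x96521), (0x5d, 0x50, 22, 0x694320)], [(0x9a, 0x82, 1, 0x97431), (0xcc, 0xc8, 0, 0x97632),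
   (0xd1, 0x0, 0, 0x97640), (0xe5, 0x60, 22, 0x759620), (0x87, 0x86, 1, 0x97210), (0xb8, 0x18, 1,
   0x97543)], [(0x158, 0x118, 1, 0x98643), (0x134, 0x100, 0, 0x98542), (0x1e8, 0x160, 22,
   0x968753), (0x1c2, 0x1c0, 0, 0x98761), (0x14b, 0x48, 22, 0x839610), (0x10d, 0x10c, 1,
   0x98320), (0x12a, 0x100, 0, 0x98531), (0x1ff, 0x1aa, 20, 0x8976543210), (0x1ff, 0x1b4, 20,
   0x1487302596)]]),
   (9, 0x3e4830224, [[], [], [], [], [(0x1f, 0x12, 24, 0x943210)], [(0x2b, 0x0, 0, 0x95310)],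
   [(0x47, 0x46, 1, 0x96210), (0x71, 0x0, 0, 0x96540), (0x5a, 0x42, 1, 0x96431)], [(0xb8, 0x18,
   1, 0x97543), (0xcc, 0xc8, 0, 0x97632), (0x93, 0x0, 0, 0x97410), (0xe2, 0x42, 1, 0x97651),
   (0xa7, 0x22, 24, 0x957210), (0x8e, 0x4, 0, 0x97321), (0x8b, 0x0, 0, 0x97310), (0xf4, 0x60, 24,
   0x795642)], [(0x10d, 0x10c, 1, 0x98320), (0x12a, 0x100, 0, 0x98531), (0x153, 0x50, 24,
   0x849610), (0x11e, 0xc, 24, 0x893421), (0x107, 0x106, 1, 0x98210), (0x119, 0x118, 1, 0x98430),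
   (0x132, 0x100, 0, 0x98541), (0x1c4, 0x1c0, 0, 0x98762), (0x16c, 0x8, 24, 0x896532)]]),
   (9, 0xdc4430224, [[], [], [], [], [(0x1f, 0x12, 26, 0x943210)], [(0x2b, 0x0, 0, 0x95310),
   (0x35, 0x0, 0, 0x95420)], [(0x47, 0x46, 1, 0x96210), (0x69, 0x0, 0, 0x96530)], [(0x95, 0x0, 0,
   0x97420), (0x9a, 0x82, 1, 0x97431), (0xac, 0xc, 1, 0x97532), (0xdc, 0x50, 26, 0x946732),
   (0xc9, 0x0, 0, 0x97630), (0x8f, 0x88, 26, 0x793210), (0xa7, 0x24, 26, 0x759210), (0xb8, 0x18,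
   1, 0x97543), (0xe4, 0x44, 1, 0x97652)], [(0x1c2, 0xc0, 0, 0x98761), (0x119, 0x118, 1,
   0x98430), (0x136, 0x124, 26, 0x598421), (0x14b, 0xa, 26, 0x938610), (0x194, 0x100, 0,
   0x98742), (0x145, 0x144, 1, 0x98620), (0x1c8, 0x100, 0, 0x98763), (0x117, 0x12, 26, 0x948210),
   (0x1ff, 0x1b4, 24, 0x6539741082), (0x1ff, 0x1b6, 24, 0x7381409625), (0x1ff, 0x1ea, 22,
   0x9876543210)]]),
   (9, 0xfc2d10224, [[], [], [], [], [], [(0x2b, 0x0, 0, 0x95310), (0x33, 0x0, 0, 0x95410)],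
   [(0x5a, 0x42, 1, 0x96431), (0x55, 0x0, 0, 0x96420), (0x76, 0x24, 28, 0x596421), (0x4f, 0x48,
   28, 0x693210)], [(0x87, 0x86, 1, 0x97210), (0x9c, 0x88, 0, 0x97432), (0xea, 0xa0, 28,
   0x759631), (0xa6, 0x86, 1, 0x97521)], [(0x161, 0x160, 1, 0x98650), (0x1c2, 0xc0, 0, 0x98761),
   (0x18b, 0xa, 28, 0x938710), (0x117, 0x12, 28, 0x948210), (0x146, 0x44, 0, 0x98621), (0x11a,
   0x2, 1, 0x98431)]]),
   (9, 0xe25cf0224, [[], [], [], [], [], [(0x2b, 0x0, 0, 0x95310), (0x35, 0x0, 0, 0x95420),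
   (0x3e, 0x2c, 30, 0x593421), (0x33, 0x0, 0, 0x95410)], [(0x47, 0x46, 1, 0x96210), (0x78, 0x58,
   1, 0x96543), (0x59, 0x58, 1, 0x96430), (0x66, 0x46, 1, 0x96521)], [(0xca, 0xc0, 0, 0x97631),
   (0x96, 0x86, 1, 0x97421), (0xdc, 0x98, 30, 0x749632), (0xb9, 0x30, 30, 0x759430), (0xaa, 0x80,
   0, 0x97531), (0xf0, 0x50, 1, 0x97654)], [(0x154, 0x40, 0, 0x98642), (0x12c, 0xc, 1, 0x98532),
   (0x171, 0x30, 30, 0x958640), (0x1b0, 0x10, 1, 0x98754), (0x14e, 0x148, 30, 0x938621), (0x1c4,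
   0xc0, 0, 0x98762)]]),
   (9, 0x3a58b0a24, [[], [], [], [], [(0x1f, 0x12, 32, 0x943210)], [(0x35, 0x0, 0, 0x95420),
   (0x3a, 0x22, 1, 0x95431), (0x2f, 0x28, 32, 0x593210)], [(0x47, 0x46, 1, 0x96210), (0x5c, 0x48,
   0, 0x96432), (0x6e, 0x40, 32, 0x953621), (0x69, 0x0, 0, 0x96530), (0x73, 0x30, 32, 0x649510)],
   [(0x8d, 0x8c, 1, 0x97320), (0xa6, 0x24, 0, 0x97521), (0x9e, 0x80, 32, 0x973421), (0xe5, 0x60,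
   32, 0x759620), (0xd6, 0xd4, 32, 0x679421)], [(0x10e, 0x104, 0, 0x98321), (0x194, 0x84, 1,
   0x98742), (0x1c1, 0x0, 0, 0x98760), (0x164, 0x44, 1, 0x98652), (0x1a5, 0x104, 32, 0x985720),
   (0x119, 0x118, 1, 0x98430), (0x14d, 0x140, 32, 0x698320), (0x1ff, 0xf0, 26, 0x9876543210)]]),
   (8, 0x3430224, [[], [], [], [], [(0x1f, 0x12, 34, 0x843210)], [(0x2b, 0x0, 0, 0x85310), (0x35,
   0x0, 0, 0x85420), (0x33, 0x0, 0, 0x85410), (0x3e, 0x2c, 34, 0x583421)], [(0x47, 0x46, 1,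
   0x86210), (0x66, 0x46, 1, 0x86521), (0x7c, 0x50, 34, 0x846532), (0x71, 0x0, 0, 0x86540),
   (0x5d, 0x50, 34, 0x684320), (0x69, 0x0, 0, 0x86530)], [(0x99, 0x98, 1, 0x87430), (0x8e, 0x84,
   0, 0x87321), (0xe1, 0x0, 0, 0x87650), (0xcb, 0x48, 34, 0x738610), (0xb8, 0x98, 1, 0x87543),
   (0xb6, 0x14, 34, 0x578421), (0x97, 0x14, 34, 0x748210), (0xea, 0x48, 34, 0x875631), (0xcd,
   0xc0, 34, 0x687320), (0xec, 0xc0, 34, 0x876532), (0xff, 0x36, 26, 0x876543210), (0xff, 0xe8,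
   26, 0x824561730)]]),
   (8, 0xb430224, [[], [], [], [], [(0x1f, 0x12, 36, 0x843210)], [(0x2b, 0x0, 0, 0x85310), (0x33,
   0x0, 0, 0x85410), (0x3e, 0x2c, 36, 0x583421)], [(0x47, 0x46, 1, 0x86210), (0x71, 0x0, 0,
   0x86540), (0x66, 0x46, 1, 0x86521), (0x5a, 0x42, 1, 0x86431), (0x5d, 0x50, 36, 0x684320),
   (0x7c, 0x50, 36, 0x846532)], [(0x99, 0x98, 1, 0x87430), (0xcc, 0x48, 0, 0x87632), (0xe2, 0xc2,
   1, 0x87651), (0xf4, 0xe0, 36, 0x785642), (0x8e, 0x84, 0, 0x87321), (0xb8, 0x98, 1, 0x87543),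
   (0x97, 0x14, 36, 0x748210), (0xb6, 0x14, 36, 0x578421), (0xd5, 0x14, 36, 0x847620)]]),
   (8, 0x4c30224, [[], [], [], [], [(0x1f, 0x12, 38, 0x843210)], [(0x2b, 0x0, 0, 0x85310), (0x33,
   0x0, 0, 0x85410), (0x3e, 0x2c, 38, 0x583421), (0x35, 0x0, 0, 0x85420)], [(0x47, 0x46, 1,
   0x86210), (0x5a, 0x42, 1, 0x86431), (0x66, 0x46, 1, 0x86521), (0x5d, 0x50, 38, 0x684320)],
   [(0x9a, 0x82, 1, 0x87431), (0xcc, 0xc8, 0, 0x87632), (0xd1, 0x0, 0, 0x87640), (0xea, 0x60, 38,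
   0x785631), (0xb8, 0x18, 1, 0x87543), (0x87, 0x86, 1, 0x87210), (0xad, 0x28, 38, 0x758320),
   (0xae, 0xac, 38, 0x738521), (0xff, 0x3e, 20, 0x876543210), (0xff, 0xaa, 22, 0x876543210),
   (0xff, 0xb4, 23, 0x834267501), (0xff, 0xba, 28, 0x876543210), (0xff, 0xdc, 21, 0x834267501),
   (0xff, 0xf4, 29, 0x834267501)]]),
   (8, 0x4830224, [[], [], [], [], [(0x1f, 0x12, 40, 0x843210)], [(0x2b, 0x0, 0, 0x85310), (0x33,
   0x0, 0, 0x85410), (0x3e, 0x2c, 40, 0x583421)], [(0x47, 0x46, 1, 0x86210), (0x71, 0x0, 0,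
   0x86540), (0x5a, 0x42, 1, 0x86431), (0x7c, 0x50, 40, 0x846532), (0x5d, 0x50, 40, 0x684320)],
   [(0xb8, 0x18, 1, 0x87543), (0xcc, 0xc8, 0, 0x87632), (0x93, 0x0, 0, 0x87410), (0xe2, 0x42, 1,
   0x87651), (0xa7, 0x22, 40, 0x857210), (0x8e, 0x4, 0, 0x87321), (0x8b, 0x0, 0, 0x87310), (0xf4,
   0x60, 40, 0x785642), (0xad, 0x28, 40, 0x758320), (0xb6, 0x94, 40, 0x578421), (0xff, 0x3e, 20,
   0x876543210), (0xff, 0x7c, 20, 0x254716830), (0xff, 0xb6, 20, 0x836457210), (0xff, 0xbe, 28,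
   0x876543210), (0xff, 0xf4, 20, 0x831457260), (0xff, 0xfc, 28, 0x871543260)]]),
   (8, 0x2d10224, [[], [], [], [], [(0x1f, 0x12, 42, 0x843210)], [(0x2b, 0x0, 0, 0x85310), (0x3e,
   0x2c, 42, 0x583421), (0x33, 0x0, 0, 0x85410)], [(0x5a, 0x42, 1, 0x86431), (0x55, 0x0, 0,
   0x86420), (0x6c, 0xc, 1, 0x86532), (0x4f, 0x48, 42, 0x683210), (0x78, 0x18, 1, 0x86543)],
   [(0x87, 0x86, 1, 0x87210), (0x9c, 0x88, 0, 0x87432), (0xea, 0xa0, 42, 0x758631), (0xc9, 0x0,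
   0, 0x87630), (0x9b, 0xa, 42, 0x834710), (0xd3, 0x50, 42, 0x748610), (0xd6, 0x4, 42, 0x786421),
   (0xe4, 0x84, 1, 0x87652), (0xba, 0xb0, 42, 0x758431), (0xce, 0x80, 42, 0x863721), (0xff, 0x3a,
   34, 0x45863721), (0xff, 0x3e, 33, 0x708642153), (0xff, 0xba, 33, 0x208637154), (0xff, 0xdc,
   31, 0x46273185), (0xff, 0xfc, 18, 0x876543210)]]),
   (8, 0x4430224, [[], [], [], [], [], [(0x2b, 0x0, 0, 0x85310), (0x3e, 0x2c, 44, 0x583421),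
   (0x33, 0x0, 0, 0x85410), (0x35, 0x0, 0, 0x85420)], [(0x47, 0x46, 1, 0x86210), (0x5a, 0x42, 1,
   0x86431), (0x69, 0x0, 0, 0x86530)], [(0x95, 0x0, 0, 0x87420), (0x9a, 0x82, 1, 0x87431), (0xac,
   0xc, 1, 0x87532), (0xc9, 0x0, 0, 0x87630), (0x8f, 0x88, 44, 0x783210), (0xea, 0x60, 44,
   0x785631), (0xb8, 0x18, 1, 0x87543), (0xdc, 0x50, 44, 0x846732), (0xe4, 0x44, 1, 0x87652),
   (0xd1, 0x0, 0, 0x87640), (0xb6, 0x24, 44, 0x587421), (0xce, 0x40, 44, 0x873621), (0xff, 0x3a,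
   26, 0x781043265), (0xff, 0x3e, 29, 0x157842603), (0xff, 0x7a, 24, 0x204816735), (0xff, 0xb4,
   26, 0x428061753), (0xff, 0xb6, 29, 0x243851607), (0xff, 0xdc, 22, 0x876543210), (0xff, 0xea,
   22, 0x836457120), (0xff, 0xf4, 24, 0x382057164), (0xff, 0xfa, 32, 0x781043265), (0xff, 0xfc,
   32, 0x382057164)]]),
   (8, 0x3c30224, [[], [], [], [], [(0x1f, 0x12, 46, 0x843210)], [(0x2b, 0x0, 0, 0x85310), (0x35,
   0x0, 0, 0x85420), (0x3e, 0x2c, 46, 0x583421)], [(0x47, 0x46, 1, 0x86210), (0x66, 0x46, 1,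
   0x86521), (0x5a, 0x42, 1, 0x86431), (0x5d, 0x50, 46, 0x684320), (0x7c, 0x50, 46, 0x846532)],
   [(0x99, 0x98, 1, 0x87430), (0xa6, 0x86, 1, 0x87521), (0xe1, 0x0, 0, 0x87650), (0xea, 0x48, 46,
   0x875631), (0x8d, 0x8c, 1, 0x87320), (0xb8, 0x98, 1, 0x87543), (0xd3, 0x50, 46, 0x748610),
   (0xd5, 0x50, 46, 0x748620), (0xf2, 0x50, 46, 0x875641), (0xf4, 0x50, 46, 0x875642), (0xff,
   0x2a, 30, 0x376458120), (0xff, 0x34, 24, 0x283561740), (0xff, 0x36, 28, 0x605821374), (0xff,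
   0x3a, 29, 0x734218056), (0xff, 0x3e, 24, 0x781043265), (0xff, 0x6a, 29, 0x461750832), (0xff,
   0xb4, 29, 0x461705832), (0xff, 0xe0, 24, 0x781543260), (0xff, 0xe4, 29, 0x734218506), (0xff,
   0xe8, 28, 0x650821374), (0xff, 0xea, 24, 0x283061745), (0xff, 0xf4, 30, 0x376408125)]]),
   (8, 0xc8b0a24, [[], [], [], [], [], [(0x35, 0x0, 0, 0x85420), (0x3a, 0x22, 1, 0x85431), (0x2f,
   0x28, 48, 0x583210)], [(0x47, 0x46, 1, 0x86210), (0x5c, 0x48, 0, 0x86432), (0x76, 0x4, 48,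
   0x685421), (0x5b, 0xa, 48, 0x834610), (0x69, 0x0, 0, 0x86530)], [(0x8b, 0x0, 0, 0x87310),
   (0xd2, 0x40, 0, 0x87641), (0xb8, 0x18, 1, 0x87543), (0xc5, 0xc4, 1, 0x87620), (0xa6, 0x24, 0,
   0x87521), (0x9d, 0x90, 48, 0x784320), (0xec, 0x40, 48, 0x876532), (0xf1, 0x30, 48,
   0x857640)]]),
   (8, 0x5430224, [[], [], [], [], [], [(0x2b, 0x0, 0, 0x85310), (0x3e, 0x2c, 50, 0x583421)],
   [(0x47, 0x46, 1, 0x86210), (0x5a, 0x42, 1, 0x86431), (0x71, 0x0, 0, 0x86540), (0x69, 0x0, 0,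
   0x86530), (0x7c, 0x50, 50, 0x846532)], [(0x95, 0x0, 0, 0x87420), (0xe4, 0x44, 1, 0x87652),
   (0x8e, 0x84, 0, 0x87321), (0xb9, 0x30, 50, 0x758430), (0xb6, 0x24, 50, 0x587421), (0xcb, 0x48,
   50, 0x738610), (0xcd, 0xc0, 50, 0x687320), (0xf8, 0x30, 50, 0x678543), (0xaa, 0x80, 0,
   0x87531), (0x9c, 0x8, 0, 0x87432), (0xd1, 0x0, 0, 0x87640), (0xf2, 0x60, 50, 0x785641), (0xff,
   0x1e, 34, 0x386457120), (0xff, 0xa6, 34, 0x786543210), (0xff, 0xbe, 35, 0x157306248), (0xff,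
   0xd8, 42, 0x724516830), (0xff, 0xdc, 32, 0x405783621), (0xff, 0xe8, 42, 0x315426870), (0xff,
   0xea, 32, 0x504387612), (0xff, 0xf8, 41, 0x734268051), (0xff, 0xfa, 30, 0x731408265), (0xff,
   0xfc, 30, 0x372508164)]]),
   (8, 0x7cf0224, [[], [], [], [], [], [(0x2b, 0x0, 0, 0x85310), (0x35, 0x0, 0, 0x85420)],
   [(0x47, 0x46, 1, 0x86210), (0x78, 0x58, 1, 0x86543), (0x5e, 0xc, 52, 0x683421), (0x66, 0x46,
   1, 0x86521)], [(0xd2, 0xc0, 0, 0x87641), (0x99, 0x98, 1, 0x87430), (0xe3, 0x60, 52, 0x758610),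
   (0x87, 0x86, 1, 0x87210), (0xca, 0xc0, 0, 0x87631), (0xd4, 0xc0, 0, 0x87642), (0x9e, 0xc, 52,
   0x783421), (0xe5, 0x60, 52, 0x758620), (0xff, 0x6, 30, 0x671043285), (0xff, 0x18, 30,
   0x674012385), (0xff, 0xaa, 30, 0x247356081), (0xff, 0xb4, 30, 0x245370681)]]),
   (8, 0x3cf0224, [[], [], [], [], [], [(0x2b, 0x0, 0, 0x85310), (0x35, 0x0, 0, 0x85420)],
   [(0x47, 0x46, 1, 0x86210), (0x78, 0x58, 1, 0x86543), (0x5e, 0xc, 54, 0x683421), (0x59, 0x58,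
   1, 0x86430), (0x66, 0x46, 1, 0x86521)], [(0xd2, 0xc0, 0, 0x87641), (0x99, 0x98, 1, 0x87430),
   (0xa6, 0x86, 1, 0x87521), (0xca, 0xc0, 0, 0x87631), (0xd4, 0xc0, 0, 0x87642), (0x9e, 0xc, 54,
   0x783421), (0x87, 0x86, 1, 0x87210), (0xb8, 0x98, 1, 0x87543), (0xe1, 0x0, 0, 0x87650), (0xff,
   0x6a, 43, 0x461750832), (0xff, 0x74, 43, 0x471605832), (0xff, 0xaa, 43, 0x471650832), (0xff,
   0xb4, 43, 0x461705832)]]),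
   (8, 0x2cf0224, [[], [], [], [], [(0x1f, 0x12, 56, 0x843210)], [(0x2b, 0x0, 0, 0x85310), (0x35,
   0x0, 0, 0x85420)], [(0x47, 0x46, 1, 0x86210), (0x78, 0x58, 1, 0x86543), (0x5e, 0xc, 56,
   0x683421), (0x59, 0x58, 1, 0x86430), (0x4d, 0x4c, 1, 0x86320)], [(0xd2, 0xc0, 0, 0x87641),
   (0xa6, 0x86, 1, 0x87521), (0x9c, 0x88, 0, 0x87432), (0xba, 0xb0, 56, 0x758431), (0xcb, 0x88,
   56, 0x783610), (0x87, 0x86, 1, 0x87210), (0xd4, 0xc0, 0, 0x87642), (0x9b, 0xa, 56, 0x834710),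
   (0xe1, 0x0, 0, 0x87650), (0xce, 0x8c, 56, 0x738621), (0xff, 0x64, 47, 0x471605832), (0xff,
   0x9a, 42, 0x876543210), (0xff, 0xba, 47, 0x471650832)]]),
   (8, 0x6d10224, [[], [], [], [], [(0x1f, 0x12, 58, 0x843210)], [(0x2b, 0x0, 0, 0x85310), (0x3e,
   0x2c, 58, 0x583421)], [(0x5a, 0x42, 1, 0x86431), (0x55, 0x0, 0, 0x86420), (0x6c, 0xc, 1,
   0x86532), (0x4f, 0x48, 58, 0x683210), (0x78, 0x18, 1, 0x86543), (0x76, 0x24, 58, 0x586421),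
   (0x67, 0x24, 58, 0x658210)], [(0x87, 0x86, 1, 0x87210), (0xb2, 0x80, 0, 0x87541), (0x9c, 0x88,
   0, 0x87432), (0x9b, 0xa, 58, 0x834710), (0xc9, 0x0, 0, 0x87630), (0xe5, 0x44, 58, 0x865720),
   (0xb4, 0x80, 0, 0x87542), (0xe2, 0xc0, 0, 0x87651), (0xae, 0xac, 58, 0x738521), (0xce, 0x80,
   58, 0x863721), (0xd6, 0x4, 58, 0x786421), (0xff, 0xba, 50, 0x268543701), (0xff, 0xf4, 50,
   0x138456702)]]),
   (8, 0x5cf0224, [[], [], [], [], [(0x1f, 0x12, 60, 0x843210)], [(0x2b, 0x0, 0, 0x85310), (0x35,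
   0x0, 0, 0x85420), (0x33, 0x0, 0, 0x85410), (0x3e, 0x2c, 60, 0x583421)], [(0x47, 0x46, 1,
   0x86210), (0x78, 0x58, 1, 0x86543), (0x66, 0x46, 1, 0x86521)], [(0x8d, 0x8c, 1, 0x87320),
   (0xca, 0xc0, 0, 0x87631), (0xe3, 0x60, 60, 0x758610), (0xbc, 0xb8, 60, 0x748532), (0x87, 0x86,
   1, 0x87210), (0xe5, 0x60, 60, 0x758620), (0x9b, 0x12, 60, 0x843710), (0xd3, 0x90, 60,
   0x784610), (0x96, 0x86, 1, 0x87421), (0xf0, 0x50, 1, 0x87654), (0xb9, 0x30, 60, 0x758430),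
   (0xd5, 0x90, 60, 0x784620), (0xff, 0x1c, 41, 0x720486153), (0xff, 0x3c, 50, 0x413865027),
   (0xff, 0xe2, 34, 0x876543210), (0xff, 0xe8, 50, 0x750821364), (0xff, 0xea, 41, 0x463782510)]]),
   (8, 0xf150224, [[], [], [], [], [(0x1f, 0x12, 62, 0x843210)], [(0x2b, 0x0, 0, 0x85310), (0x33,
   0x0, 0, 0x85410), (0x35, 0x0, 0, 0x85420), (0x3e, 0x2c, 62, 0x583421)], [(0x55, 0x0, 0,
   0x86420), (0x6d, 0x24, 62, 0x856320), (0x4e, 0x44, 0, 0x86321), (0x6a, 0x40, 0, 0x86531),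
   (0x5c, 0x8, 0, 0x86432), (0x5b, 0x12, 62, 0x843610), (0x67, 0x24, 62, 0x658210), (0x76, 0x24,
   62, 0x586421), (0x79, 0x30, 62, 0x658430)], [(0x99, 0x98, 1, 0x87430), (0xa6, 0x6, 1,
   0x87521), (0xe1, 0xe0, 1, 0x87650), (0x96, 0x6, 1, 0x87421), (0x9a, 0x2, 1, 0x87431), (0xc9,
   0xc8, 1, 0x87630), (0xe4, 0x4, 1, 0x87652), (0xff, 0x18, 47, 0x621387504), (0xff, 0x38, 53,
   0x52487631), (0xff, 0x58, 53, 0x260487513), (0xff, 0x5c, 47, 0x260487513), (0xff, 0x60, 47,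
   0x312687405), (0xff, 0x68, 53, 0x312687405), (0xff, 0x6a, 47, 0x130587426), (0xff, 0x70, 53,
   0x41587362), (0xff, 0x78, 48, 0x564821307), (0xff, 0x7a, 53, 0x243687150), (0xff, 0x7c, 53,
   0x156387240), (0xff, 0x7e, 47, 0x156387240), (0xff, 0x86, 53, 0x634287051), (0xff, 0x8e, 47,
   0x365187042), (0xff, 0xc6, 47, 0x52487631)]]),
   (8, 0x5d10224, [[], [], [], [], [], [(0x2b, 0x0, 0, 0x85310), (0x3e, 0x2c, 64, 0x583421),
   (0x35, 0x0, 0, 0x85420)], [(0x5a, 0x42, 1, 0x86431), (0x55, 0x0, 0, 0x86420), (0x6c, 0xc, 1,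
   0x86532), (0x78, 0x18, 1, 0x86543), (0x4f, 0x48, 64, 0x683210), (0x67, 0x24, 64, 0x658210),
   (0x76, 0x24, 64, 0x586421)], [(0x87, 0x86, 1, 0x87210), (0xe2, 0xc0, 0, 0x87651), (0xe9, 0x48,
   64, 0x865730), (0xaa, 0x80, 0, 0x87531), (0x9b, 0x12, 64, 0x843710), (0xbc, 0xb8, 64,
   0x748532), (0xb9, 0x30, 64, 0x758430), (0xf4, 0xb0, 64, 0x856742), (0x8d, 0x8c, 1, 0x87320),
   (0xcb, 0x48, 64, 0x738610), (0xff, 0xea, 45, 0x265704318), (0xff, 0xf4, 44, 0x13427568)]]),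
   (8, 0x58b0a24, [[], [], [], [], [(0x1f, 0x12, 66, 0x843210)], [(0x35, 0x0, 0, 0x85420), (0x3a,
   0x22, 1, 0x85431), (0x2f, 0x28, 66, 0x583210)], [(0x47, 0x46, 1, 0x86210), (0x5c, 0x48, 0,
   0x86432), (0x69, 0x0, 0, 0x86530), (0x5b, 0xa, 66, 0x834610), (0x73, 0x30, 66, 0x648510),
   (0x76, 0x4, 66, 0x685421)], [(0x93, 0x0, 0, 0x87410), (0x8d, 0x8c, 1, 0x87320), (0xf0, 0x50,
   1, 0x87654), (0xa6, 0x24, 0, 0x87521), (0x9e, 0x80, 66, 0x873421), (0xe3, 0xc0, 66, 0x687510),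
   (0xec, 0x8, 66, 0x786532), (0xb9, 0x30, 66, 0x758430), (0xbc, 0xb8, 66, 0x748532), (0xff,
   0x3a, 38, 0x876543210), (0xff, 0xf0, 38, 0x741358620)]]),
   (8, 0x6d20224, [[], [], [], [], [(0x1f, 0x12, 68, 0x843210)], [(0x2b, 0x0, 0, 0x85310), (0x33,
   0x0, 0, 0x85410), (0x3e, 0x2c, 68, 0x583421)], [(0x78, 0x18, 1, 0x86543), (0x53, 0x0, 0,
   0x86410), (0x76, 0x54, 68, 0x568421), (0x4b, 0x0, 0, 0x86310), (0x6d, 0x28, 68, 0x658320)],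
   [(0x87, 0x86, 1, 0x87210), (0x9c, 0x88, 0, 0x87432), (0xe4, 0xc0, 0, 0x87652), (0x9b, 0xa, 68,
   0x834710), (0xad, 0x28, 68, 0x758320), (0xae, 0xac, 68, 0x738521), (0xb4, 0x80, 0, 0x87542),
   (0xcc, 0xc8, 0, 0x87632), (0xd5, 0x50, 68, 0x748620), (0xda, 0xd0, 68, 0x768431), (0xe3, 0x42,
   68, 0x865710)]]),
   (7, 0x30224, [[], [], [], [], [(0x1f, 0x12, 70, 0x743210)], [(0x2b, 0x0, 0, 0x75310), (0x35,
   0x0, 0, 0x75420), (0x3e, 0x2c, 70, 0x573421), (0x33, 0x0, 0, 0x75410)], [(0x47, 0x46, 1,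
   0x76210), (0x5a, 0x42, 1, 0x76431), (0x66, 0x46, 1, 0x76521), (0x71, 0x0, 0, 0x76540), (0x69,
   0x0, 0, 0x76530), (0x5d, 0x50, 70, 0x674320), (0x7c, 0x50, 70, 0x746532), (0x7f, 0x1a, 40,
   0x76543210), (0x7f, 0x1e, 28, 0x76543210), (0x7f, 0x22, 30, 0x76543210), (0x7f, 0x24, 34,
   0x76543210), (0x7f, 0x26, 36, 0x76543210), (0x7f, 0x2a, 24, 0x76543210), (0x7f, 0x34, 29,
   0x34627051), (0x7f, 0x36, 24, 0x31407625), (0x7f, 0x3a, 36, 0x71043265), (0x7f, 0x3e, 30,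
   0x31407625), (0x7f, 0x58, 40, 0x31547620), (0x7f, 0x5a, 38, 0x76543210), (0x7f, 0x5c, 28,
   0x24516730), (0x7f, 0x60, 30, 0x31457620), (0x7f, 0x64, 36, 0x71543260), (0x7f, 0x68, 24,
   0x31457620), (0x7f, 0x6a, 29, 0x34627501), (0x7f, 0x74, 24, 0x76043215), (0x7f, 0x78, 36,
   0x76043215), (0x7f, 0x7a, 34, 0x76043215), (0x7f, 0x7c, 30, 0x76043215)]]),
   (7, 0x150224, [[], [], [], [], [(0x1f, 0x12, 72, 0x743210)], [(0x2b, 0x0, 0, 0x75310), (0x33,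
   0x0, 0, 0x75410), (0x35, 0x0, 0, 0x75420), (0x3e, 0x2c, 72, 0x573421)], [(0x55, 0x0, 0,
   0x76420), (0x4e, 0x44, 0, 0x76321), (0x67, 0x24, 72, 0x657210), (0x5c, 0x8, 0, 0x76432),
   (0x6a, 0x40, 0, 0x76531), (0x5b, 0x12, 72, 0x743610), (0x6d, 0x24, 72, 0x756320), (0x76, 0x24,
   72, 0x576421), (0x79, 0x30, 72, 0x657430), (0x7f, 0x6, 26, 0x67543210), (0x7f, 0xe, 31,
   0x65713402), (0x7f, 0x18, 31, 0x21736054), (0x7f, 0x1c, 33, 0x65342107), (0x7f, 0x1e, 33,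
   0x43250617), (0x7f, 0x38, 26, 0x7325416), (0x7f, 0x46, 31, 0x34726501), (0x7f, 0x4e, 33,
   0x30126547), (0x7f, 0x58, 26, 0x27106435), (0x7f, 0x5c, 31, 0x14705623), (0x7f, 0x5e, 33,
   0x12305647), (0x7f, 0x60, 31, 0x6724135), (0x7f, 0x62, 33, 0x34651207), (0x7f, 0x66, 33,
   0x56140327), (0x7f, 0x68, 26, 0x37021654), (0x7f, 0x6a, 31, 0x25704316), (0x7f, 0x6e, 33,
   0x41062537), (0x7f, 0x70, 26, 0x7614523), (0x7f, 0x78, 14, 0x76543210), (0x7f, 0x7a, 26,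
   0x27534601), (0x7f, 0x7c, 26, 0x17465302), (0x7f, 0x7e, 31, 0x43762510)]]),
   (7, 0xf0224, [[], [], [], [], [(0x1f, 0x12, 74, 0x743210)], [(0x2b, 0x0, 0, 0x75310), (0x35,
   0x0, 0, 0x75420)], [(0x47, 0x46, 1, 0x76210), (0x78, 0x58, 1, 0x76543), (0x4d, 0x4c, 1,
   0x76320), (0x66, 0x46, 1, 0x76521), (0x59, 0x58, 1, 0x76430), (0x5e, 0xc, 74, 0x673421),
   (0x7f, 0x6, 32, 0x67543210), (0x7f, 0xe, 39, 0x65713402), (0x7f, 0x16, 22, 0x76543210), (0x7f,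
   0x18, 32, 0x31574620), (0x7f, 0x1a, 22, 0x13574620), (0x7f, 0x1c, 39, 0x65742103), (0x7f,
   0x1e, 24, 0x76543210), (0x7f, 0x2a, 35, 0x43250716), (0x7f, 0x2e, 18, 0x76543210), (0x7f,
   0x34, 35, 0x12350746), (0x7f, 0x36, 40, 0x5721364), (0x7f, 0x3a, 40, 0x5734261), (0x7f, 0x3c,
   18, 0x76512340), (0x7f, 0x3e, 26, 0x76543210), (0x7f, 0x60, 26, 0x13475602), (0x7f, 0x62, 18,
   0x13475602), (0x7f, 0x64, 40, 0x50734261), (0x7f, 0x68, 40, 0x50721364), (0x7f, 0x6a, 35,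
   0x12305746), (0x7f, 0x70, 18, 0x42175603), (0x7f, 0x74, 35, 0x43205716)]]),
   (7, 0x110224, [[], [], [], [], [(0x1f, 0x12, 76, 0x743210)], [(0x2b, 0x0, 0, 0x75310), (0x3e,
   0x2c, 76, 0x573421), (0x33, 0x0, 0, 0x75410), (0x35, 0x0, 0, 0x75420)], [(0x5a, 0x42, 1,
   0x76431), (0x55, 0x0, 0, 0x76420), (0x6c, 0xc, 1, 0x76532), (0x4f, 0x48, 76, 0x673210), (0x78,
   0x18, 1, 0x76543), (0x67, 0x24, 76, 0x657210), (0x76, 0x24, 76, 0x576421), (0x7f, 0x6, 36,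
   0x67543210), (0x7f, 0x16, 38, 0x76543210), (0x7f, 0x26, 38, 0x73456120), (0x7f, 0x2e, 16,
   0x76543210), (0x7f, 0x30, 19, 0x3745621), (0x7f, 0x36, 22, 0x76543210), (0x7f, 0x3a, 30,
   0x23570641), (0x7f, 0x3e, 42, 0x24170635), (0x7f, 0x4e, 31, 0x30126547), (0x7f, 0x56, 16,
   0x73456120), (0x7f, 0x5c, 37, 0x65742103), (0x7f, 0x5e, 20, 0x13465702), (0x7f, 0x6a, 37,
   0x34751206), (0x7f, 0x6e, 20, 0x26534701), (0x7f, 0x74, 30, 0x6741532), (0x7f, 0x76, 42,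
   0x15270364), (0x7f, 0x7a, 39, 0x41573026), (0x7f, 0x7c, 39, 0x52476013), (0x7f, 0x7e, 25,
   0x34762510)]]),
   (7, 0x120224, [[], [], [], [], [(0x1f, 0x12, 78, 0x743210)], [(0x2b, 0x0, 0, 0x75310), (0x35,
   0x0, 0, 0x75420), (0x33, 0x0, 0, 0x75410), (0x3e, 0x2c, 78, 0x573421)], [(0x78, 0x18, 1,
   0x76543), (0x4e, 0x4, 0, 0x76321), (0x53, 0x0, 0, 0x76410), (0x67, 0x22, 78, 0x756210), (0x4b,
   0x0, 0, 0x76310), (0x5d, 0x50, 78, 0x674320), (0x6d, 0x28, 78, 0x657320), (0x76, 0x54, 78,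
   0x567421), (0x7f, 0x6, 42, 0x67543210), (0x7f, 0xe, 44, 0x31456270), (0x7f, 0x16, 23,
   0x43726051), (0x7f, 0x26, 23, 0x56723041), (0x7f, 0x2e, 24, 0x62107435), (0x7f, 0x36, 14,
   0x76543210), (0x7f, 0x3c, 32, 0x23065741), (0x7f, 0x3e, 23, 0x65724130), (0x7f, 0x46, 44,
   0x61543270), (0x7f, 0x4e, 49, 0x41705632), (0x7f, 0x56, 24, 0x42017653), (0x7f, 0x58, 32,
   0x24156730), (0x7f, 0x5e, 44, 0x50634271), (0x7f, 0x68, 32, 0x25143760), (0x7f, 0x6e, 44,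
   0x40365271), (0x7f, 0x74, 32, 0x26034751), (0x7f, 0x76, 23, 0x34725160), (0x7f, 0x78, 41,
   0x60145327), (0x7f, 0x7c, 41, 0x51036427), (0x7f, 0x7e, 42, 0x57634201)]]),
   (7, 0xb0a24, [[], [], [], [], [(0x1f, 0x12, 80, 0x743210)], [(0x35, 0x0, 0, 0x75420), (0x3a,
   0x22, 1, 0x75431), (0x2f, 0x28, 80, 0x573210)], [(0x47, 0x46, 1, 0x76210), (0x5c, 0x48, 0,
   0x76432), (0x69, 0x0, 0, 0x76530), (0x5b, 0xa, 80, 0x734610), (0x6e, 0x40, 80, 0x753621),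
   (0x73, 0x30, 80, 0x647510), (0x76, 0x4, 80, 0x675421), (0x7f, 0x1a, 26, 0x63574102), (0x7f,
   0x1e, 42, 0x23754016), (0x7f, 0x20, 42, 0x65743210), (0x7f, 0x24, 26, 0x25734610), (0x7f,
   0x2c, 18, 0x76543210), (0x7f, 0x3a, 18, 0x51347602), (0x7f, 0x44, 26, 0x46702513), (0x7f,
   0x4c, 42, 0x52760314), (0x7f, 0x54, 42, 0x56720413), (0x7f, 0x5a, 42, 0x64753012), (0x7f,
   0x60, 26, 0x65743210), (0x7f, 0x64, 36, 0x76543210), (0x7f, 0x6c, 26, 0x52760314), (0x7f,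
   0x70, 18, 0x72534610), (0x7f, 0x74, 26, 0x56720413), (0x7f, 0x7c, 42, 0x40762315)]]),
   (7, 0xb0224, [[], [], [], [], [(0x1f, 0x12, 82, 0x743210)], [(0x2b, 0x0, 0, 0x75310), (0x35,
   0x0, 0, 0x75420), (0x33, 0x0, 0, 0x75410), (0x3e, 0x2c, 82, 0x573421)], [(0x47, 0x46, 1,
   0x76210), (0x5c, 0x48, 0, 0x76432), (0x66, 0x46, 1, 0x76521), (0x5b, 0xa, 82, 0x734610),
   (0x7a, 0x70, 82, 0x657431), (0x69, 0x0, 0, 0x76530), (0x7f, 0x18, 52, 0x31574620), (0x7f,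
   0x1a, 38, 0x56734201), (0x7f, 0x1c, 50, 0x27516430), (0x7f, 0x1e, 30, 0x67543210), (0x7f,
   0x22, 44, 0x67543210), (0x7f, 0x24, 27, 0x43627051), (0x7f, 0x26, 22, 0x24357160), (0x7f,
   0x3a, 28, 0x42516703), (0x7f, 0x3c, 22, 0x36521704), (0x7f, 0x3e, 27, 0x34267501), (0x7f,
   0x58, 50, 0x67512340), (0x7f, 0x5a, 30, 0x27534610), (0x7f, 0x5c, 47, 0x65342107), (0x7f,
   0x60, 27, 0x34267051), (0x7f, 0x62, 22, 0x63457120), (0x7f, 0x64, 28, 0x42016753), (0x7f,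
   0x78, 22, 0x42561703), (0x7f, 0x7a, 27, 0x43627501), (0x7f, 0x7c, 44, 0x67043215)]]),
   (6, 0x224, [[], [], [], [], [(0x1f, 0x12, 84, 0x643210)], [(0x2b, 0x0, 0, 0x65310), (0x35,
   0x0, 0, 0x65420), (0x33, 0x0, 0, 0x65410), (0x3e, 0x2c, 84, 0x563421), (0x3f, 0x6, 18,
   0x6543210), (0x3f, 0xe, 19, 0x5613402), (0x3f, 0x16, 6, 0x6543210), (0x3f, 0x18, 18,
   0x6512340), (0x3f, 0x1a, 6, 0x6512340), (0x3f, 0x1c, 19, 0x5642103), (0x3f, 0x1e, 14,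
   0x6543210), (0x3f, 0x20, 15, 0x631425), (0x3f, 0x22, 12, 0x6543210), (0x3f, 0x24, 10,
   0x6543210), (0x3f, 0x26, 13, 0x5140326), (0x3f, 0x28, 10, 0x6512340), (0x3f, 0x2a, 16,
   0x6543210), (0x3f, 0x2e, 12, 0x2106435), (0x3f, 0x30, 12, 0x2156430), (0x3f, 0x34, 16,
   0x2156430), (0x3f, 0x36, 10, 0x1260354), (0x3f, 0x38, 13, 0x145326), (0x3f, 0x3a, 10,
   0x4360251), (0x3f, 0x3c, 12, 0x6043215), (0x3f, 0x3e, 15, 0x5631420)]]),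
   (6, 0xa24, [[], [], [], [], [(0x1f, 0x12, 86, 0x643210)], [(0x35, 0x0, 0, 0x65420), (0x3a,
   0x22, 1, 0x65431), (0x2f, 0x28, 86, 0x563210), (0x3f, 0x4, 12, 0x3451260), (0x3f, 0x6, 15,
   0x5640321), (0x3f, 0xc, 15, 0x564213), (0x3f, 0xe, 9, 0x5613402), (0x3f, 0x10, 14, 0x1564320),
   (0x3f, 0x14, 8, 0x5620413), (0x3f, 0x16, 10, 0x6543210), (0x3f, 0x1a, 14, 0x3564102), (0x3f,
   0x1e, 13, 0x2450163), (0x3f, 0x20, 14, 0x5643210), (0x3f, 0x24, 8, 0x5602431), (0x3f, 0x2a,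
   14, 0x1465302), (0x3f, 0x2c, 10, 0x6451230), (0x3f, 0x2e, 13, 0x2540361), (0x3f, 0x30, 11,
   0x6452301), (0x3f, 0x34, 12, 0x3541062), (0x3f, 0x36, 15, 0x4652301), (0x3f, 0x3a, 11,
   0x5631420), (0x3f, 0x3c, 15, 0x5642103), (0x3f, 0x3e, 9, 0x5631420)]]),
   (5, 0x224, [[], [], [], [], [(0x1f, 0x12, 88, 0x543210), (0x1f, 0x0, 8, 0x543210), (0x1f, 0x2,
   6, 0x543210), (0x1f, 0x4, 8, 0x534201), (0x1f, 0x6, 9, 0x540321), (0x1f, 0x8, 8, 0x521304),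
   (0x1f, 0xa, 8, 0x541032), (0x1f, 0xc, 6, 0x53421), (0x1f, 0xe, 9, 0x513402), (0x1f, 0x10, 6,
   0x154320), (0x1f, 0x14, 8, 0x520413), (0x1f, 0x16, 6, 0x251403), (0x1f, 0x18, 9, 0x532014),
   (0x1f, 0x1a, 6, 0x534201), (0x1f, 0x1c, 9, 0x542103), (0x1f, 0x1e, 9, 0x531420)]]),
   (8, 0xfc63080, [[], [], [], [(0xf, 0x0, 0, 0x83210)], [(0x17, 0x6, 6, 0x41820), (0x17, 0x14,
   6, 0x28410)], [(0x36, 0x12, 1, 0x85421), (0x27, 0x22, 6, 0x25810), (0x2d, 0x8, 6, 0x83520),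
   (0x3a, 0x12, 1, 0x85431), (0x3c, 0x38, 6, 0x54832)], [(0x56, 0x12, 1, 0x86421), (0x63, 0x0, 0,
   0x86510)], [(0x93, 0x92, 1, 0x87410), (0x9c, 0x80, 0, 0x87432), (0x8b, 0x2, 6, 0x81730)]]),
   (8, 0xfc41080, [[], [], [], [(0xf, 0x0, 0, 0x83210)], [(0x17, 0x6, 8, 0x41820), (0x17, 0x14,
   8, 0x28410)], [(0x36, 0x12, 1, 0x85421), (0x27, 0x22, 8, 0x25810), (0x2e, 0x28, 8, 0x38521),
   (0x2d, 0xc, 8, 0x52830), (0x39, 0x0, 0, 0x85430)], [(0x71, 0x0, 0, 0x86540), (0x6c, 0x24, 1,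
   0x86532), (0x59, 0x18, 8, 0x63840)], [(0x93, 0x92, 1, 0x87410), (0xc6, 0x80, 0, 0x87621)]]),
   (7, 0x63080, [[], [], [], [(0xf, 0x0, 0, 0x73210)], [(0x17, 0x6, 10, 0x41720), (0x17, 0x14,
   10, 0x27410), (0x1d, 0x0, 0, 0x74320)], [(0x36, 0x12, 1, 0x75421), (0x27, 0x22, 10, 0x25710),
   (0x2d, 0x8, 10, 0x73520), (0x3a, 0x12, 1, 0x75431), (0x3c, 0x38, 10, 0x54732), (0x27, 0x6, 10,
   0x52710), (0x2b, 0x22, 10, 0x35710)], [(0x47, 0x6, 10, 0x62710), (0x56, 0x12, 1, 0x76421),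
   (0x63, 0x0, 0, 0x76510), (0x7f, 0x7e, 8, 0x76543210)]]),
   (7, 0x41080, [[], [], [], [(0xf, 0x0, 0, 0x73210)], [(0x17, 0x6, 12, 0x41720), (0x17, 0x14,
   12, 0x27410)], [(0x36, 0x12, 1, 0x75421), (0x27, 0x22, 12, 0x25710), (0x2e, 0x28, 12,
   0x37521), (0x2d, 0xc, 12, 0x52730), (0x39, 0x0, 0, 0x75430)], [(0x71, 0x0, 0, 0x76540), (0x6c,
   0x24, 1, 0x76532), (0x59, 0x18, 12, 0x63740), (0x4b, 0x42, 12, 0x36710), (0x7f, 0x7e, 8,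
   0x76543210)]]),
   (6, 0x4880, [[], [], [], [(0xf, 0x0, 0, 0x63210)], [(0x17, 0x6, 14, 0x41620), (0x17, 0x14, 14,
   0x26410), (0x1d, 0x0, 0, 0x64320)], [(0x33, 0x32, 1, 0x65410), (0x2b, 0xa, 14, 0x51630),
   (0x2b, 0x28, 14, 0x36510), (0x36, 0x32, 1, 0x65421), (0x3c, 0x28, 14, 0x45632), (0x3c, 0x18,
   14, 0x54632), (0x2d, 0x0, 0, 0x65320), (0x3a, 0x32, 1, 0x65431)]]),
   (6, 0x3080, [[], [], [], [(0xf, 0x0, 0, 0x63210)], [(0x17, 0x6, 16, 0x41620), (0x17, 0x14, 16,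
   0x26410), (0x1d, 0x0, 0, 0x64320)], [(0x36, 0x12, 1, 0x65421), (0x27, 0x22, 16, 0x25610),
   (0x2d, 0x8, 16, 0x63520), (0x3a, 0x12, 1, 0x65431), (0x3c, 0x38, 16, 0x54632), (0x27, 0x6, 16,
   0x52610), (0x2b, 0x22, 16, 0x35610), (0x3f, 0xc, 10, 0x6543210), (0x3f, 0x3e, 11,
   0x4136025)]]),
   (6, 0x1080, [[], [], [], [(0xf, 0x0, 0, 0x63210)], [(0x17, 0x6, 18, 0x41620), (0x17, 0x14, 18,
   0x26410), (0x1b, 0xa, 18, 0x41630), (0x1b, 0x18, 18, 0x36410)], [(0x36, 0x12, 1, 0x65421),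
   (0x27, 0x22, 18, 0x25610), (0x2e, 0x28, 18, 0x36521), (0x39, 0x0, 0, 0x65430), (0x2d, 0xc, 18,
   0x52630), (0x3f, 0x8, 10, 0x6543210), (0x3f, 0x36, 13, 0x5234106), (0x3f, 0x3e, 10,
   0x5462103)]]),
   (6, 0x1980, [[], [], [], [(0xf, 0x0, 0, 0x63210)], [(0x17, 0x2, 20, 0x61420), (0x17, 0x4, 20,
   0x62410), (0x1b, 0x18, 20, 0x36410)], [(0x2b, 0xa, 20, 0x51630), (0x2d, 0x28, 20, 0x36520),
   (0x3a, 0x10, 20, 0x65341), (0x36, 0x30, 0, 0x65421), (0x27, 0x2, 20, 0x61520), (0x3f, 0x8, 14,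
   0x5462130), (0x3f, 0x16, 14, 0x2163045), (0x3f, 0x26, 14, 0x2163054), (0x3f, 0x32, 14,
   0x5463012), (0x3f, 0x34, 14, 0x5463021), (0x3f, 0x36, 13, 0x5234106), (0x3f, 0x3e, 14,
   0x5462103)]]),
   (5, 0x80, [[], [], [], [(0xf, 0x0, 0, 0x53210)], [(0x17, 0x6, 22, 0x41520), (0x17, 0x14, 22,
   0x25410), (0x1d, 0x0, 0, 0x54320), (0x1b, 0xa, 22, 0x41530), (0x1b, 0x18, 22, 0x35410), (0x1f,
   0x4, 8, 0x543210), (0x1f, 0x8, 8, 0x542310), (0x1f, 0xc, 10, 0x543210), (0x1f, 0x12, 12,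
   0x543210), (0x1f, 0x16, 10, 0x543012), (0x1f, 0x1a, 10, 0x542013), (0x1f, 0x1e, 8,
   0x453102)]]),
   (5, 0x180, [[], [], [], [(0xf, 0x0, 0, 0x53210)], [(0x17, 0x2, 24, 0x51420), (0x17, 0x4, 24,
   0x52410), (0x1b, 0x18, 24, 0x35410), (0x1b, 0xa, 24, 0x41530), (0x1d, 0x18, 24, 0x35420),
   (0x1f, 0x6, 8, 0x543210), (0x1f, 0x8, 12, 0x452130), (0x1f, 0x12, 12, 0x453012), (0x1f, 0x14,
   12, 0x453021), (0x1f, 0x16, 11, 0x235104), (0x1f, 0x1e, 12, 0x452103)]]),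
   (4, 0x0, [[], [], [], [(0xf, 0x0, 0, 0x43210), (0xf, 0x2, 8, 0x43210), (0xf, 0x4, 8, 0x43120),
   (0xf, 0x6, 6, 0x43210), (0xf, 0x8, 8, 0x42130), (0xf, 0xa, 6, 0x42310), (0xf, 0xc, 6,
   0x41320), (0xf, 0xe, 8, 0x43201)]]),
   (4, 0x10, [[], [], [], [(0xf, 0x6, 28, 0x31420), (0xf, 0xc, 28, 0x24310), (0xf, 0x0, 10,
   0x34210), (0xf, 0x2, 8, 0x12430), (0xf, 0x4, 9, 0x3421), (0xf, 0x8, 8, 0x32410), (0xf, 0xa,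
   11, 0x24301), (0xf, 0xe, 9, 0x24310)]]),
   (3, 0x0, [[], [], [(0x7, 0x0, 8, 0x3210), (0x7, 0x2, 6, 0x3210), (0x7, 0x4, 6, 0x3120), (0x7,
   0x6, 6, 0x3201)]]),
   (2, 0x0, [[], [(0x3, 0x0, 6, 0x210), (0x3, 0x2, 7, 0x210)]])]

set_option maxRecDepth 100000 in
theorem checkPatterns_patternData : checkPatterns forbiddenPatterns [] patternData = true := by
  decide +kernel

/-! ### Every sign pattern on eleven points contains a forbidden one -/

/-- If no forbidden pattern occurred, no pattern of the certificate would. But the certificate ends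
with the pattern on two points, which always occurs because a single sign can be switched away. -/
theorem exists_switchContains_forbiddenPatterns {V : Type*} [Fintype V] (hV : Fintype.card V = 11)
    {s : V → V → Bool} (hs : ∀ x y, s x y = s y x) :
    ∃ p ∈ forbiddenPatterns, SwitchContains s p := by
  by_contra! h
  have hmem : ∃ p ∈ patternData, (p.1, p.2.1) = (2, 0) :=
    ⟨patternData.getLast (by simp [patternData]), List.getLast_mem _, by decide +kernel⟩
  obtain ⟨p, hp, hp'⟩ := hmem
  have hno := not_switchContains_of_checkPatterns hV hs h patternData [] (by simp)
    checkPatterns_patternData p hp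
  rw [hp'] at hno
  obtain ⟨x, y, hxy⟩ := Fintype.exists_pair_of_one_lt_card (α := V) (by omega)
  refine hno ⟨![x, y], ![false, s x y], false, ?_, ?_⟩
  · intro i j hij
    fin_cases i <;> fin_cases j <;> simp_all
  · have e1 : edgeBit 0 0 1 = false := by decide
    have e2 : edgeBit 0 1 0 = false := by decide
    intro i j hij
    fin_cases i <;> fin_cases j <;> simp_all

/-! ### The sine kernel -/

-- The limit is the smaller root of `a = (t ^ 2 + a ^ 2) / 2`. The iteration starts at 0 and uses
-- only sums, products and a positive factor, operations that survive as Schur products of positive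
-- semidefinite matrices.
open Filter Topology in
theorem tendsto_one_sub_sqrt_one_sub_sq {t : ℝ} (ht : |t| ≤ 1) :
    Tendsto (fun n => (fun a : ℝ => (t ^ 2 + a ^ 2) / 2)^[n] 0) atTop (𝓝 (1 - √(1 - t ^ 2))) := by
  set g : ℝ → ℝ := fun a => (t ^ 2 + a ^ 2) / 2 with hg
  set p : ℝ := 1 - √(1 - t ^ 2) with hp
  have ht2 : t ^ 2 ≤ 1 := by rw [sq_le_one_iff_abs_le_one]; exact ht
  have hsq : √(1 - t ^ 2) ^ 2 = 1 - t ^ 2 := Real.sq_sqrt (by linarith)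
  have hsn : 0 ≤ √(1 - t ^ 2) := Real.sqrt_nonneg _
  have hp1 : p ≤ 1 := by linarith
  have hgp : g p = p := by
    simp only [hg, hp]
    nlinarith
  have hbound : ∀ n, 0 ≤ g^[n] 0 ∧ g^[n] 0 ≤ p ∧ g^[n] 0 ≤ g^[n + 1] 0 := by
    intro n
    induction n with
    | zero =>
      refine ⟨le_rfl, ?_, ?_⟩
      · simp only [Function.iterate_zero, id]
        nlinarith
      · simp only [Function.iterate_succ, Function.iterate_zero, Function.comp, id, hg]
        positivity
    | succ n ih =>
      obtain ⟨h0, h1, h2⟩ := ih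
      rw [Function.iterate_succ_apply' g (n + 1)]
      rw [Function.iterate_succ_apply' g n] at h2 ⊢
      refine ⟨by simp only [hg]; positivity, ?_, ?_⟩
      · rw [← hgp]
        simp only [hg]
        nlinarith
      · simp only [hg] at h2 ⊢
        nlinarith
  have hmono : Monotone fun n => g^[n] 0 := monotone_nat_of_le_succ fun n => (hbound n).2.2
  have hbdd : BddAbove (Set.range fun n => g^[n] 0) :=
    ⟨p, by rintro _ ⟨n, rfl⟩; exact (hbound n).2.1⟩
  have hlim := tendsto_atTop_ciSup hmono hbdd
  set L := ⨆ n, g^[n] 0 with hL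
  have hLp : L ≤ p := ciSup_le fun n => (hbound n).2.1
  have hgc : Continuous g := by simp only [hg]; fun_prop
  have hfix : g L = L := isFixedPt_of_tendsto_iterate hlim hgc.continuousAt
  -- The fixed point equation says `(1 - L) ^ 2 = 1 - t ^ 2`, and `L ≤ p ≤ 1` selects the
  -- nonnegative root.
  have : √(1 - t ^ 2) = 1 - L := by
    rw [Real.sqrt_eq_iff_mul_self_eq (by linarith) (by linarith)]
    simp only [hg] at hfix
    nlinarith
  rwa [show p = L by rw [hp, this]; ring]

theorem Matrix.posSemidef_iff_sum_nonneg {ι : Type*} [Fintype ι] {A : Matrix ι ι ℝ} :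
    A.PosSemidef ↔ (∀ i j, A i j = A j i) ∧ ∀ x : ι → ℝ, 0 ≤ ∑ i, ∑ j, A i j * x i * x j := by
  rw [Matrix.posSemidef_iff_dotProduct_mulVec]
  have h : ∀ x : ι → ℝ, star x ⬝ᵥ A.mulVec x = ∑ i, ∑ j, A i j * x i * x j := by
    intro x
    simp only [dotProduct, Matrix.mulVec, Finset.mul_sum, star_trivial]
    exact Finset.sum_congr rfl fun i _ => Finset.sum_congr rfl fun j _ => by ring
  simp only [h]
  refine and_congr ?_ Iff.rfl
  rw [Matrix.IsHermitian.ext_iff]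
  simp only [star_trivial]
  exact ⟨fun h i j => h j i, fun h i j => h j i⟩

-- By the Schur product theorem every iterate, taken entrywise, is positive semidefinite, and this
-- passes to the limit. For a Gram matrix `T` of unit vectors the entries are one minus the sines of
-- the angles.
open Filter Topology in
theorem Matrix.PosSemidef.one_sub_sqrt_one_sub_sq {ι : Type*} [Fintype ι] {T : Matrix ι ι ℝ}
    (hT : T.PosSemidef) (h1 : ∀ i j, |T i j| ≤ 1) :
    (Matrix.of fun i j => 1 - √(1 - T i j ^ 2)).PosSemidef := by
  have key : ∀ n, (Matrix.of fun i j =>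
      (fun a : ℝ => (T i j ^ 2 + a ^ 2) / 2)^[n] 0).PosSemidef := by
    intro n
    induction n with
    | zero => exact Matrix.PosSemidef.zero
    | succ n ih =>
      have h : (Matrix.of fun i j => (fun a : ℝ => (T i j ^ 2 + a ^ 2) / 2)^[n + 1] 0) =
          (1 / 2 : ℝ) • (T.hadamard T + Matrix.hadamard
            (Matrix.of fun i j => (fun a : ℝ => (T i j ^ 2 + a ^ 2) / 2)^[n] 0)
            (Matrix.of fun i j => (fun a : ℝ => (T i j ^ 2 + a ^ 2) / 2)^[n] 0)) := by
        ext i j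
        simp only [Function.iterate_succ_apply', Matrix.of_apply, Matrix.smul_apply,
          Matrix.add_apply, Matrix.hadamard_apply, smul_eq_mul]
        ring
      rw [h]
      exact ((hT.hadamard hT).add (ih.hadamard ih)).smul (by norm_num)
  simp only [Matrix.posSemidef_iff_sum_nonneg, Matrix.of_apply] at key hT ⊢
  refine ⟨fun i j => by rw [hT.1 i j], fun x => ?_⟩
  refine ge_of_tendsto' (f := fun n => ∑ i, ∑ j,
    (fun a : ℝ => (T i j ^ 2 + a ^ 2) / 2)^[n] 0 * x i * x j) (x := atTop) ?_ fun n => (key n).2 x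
  exact tendsto_finsetSum _ fun i _ => tendsto_finsetSum _ fun j _ =>
    ((tendsto_one_sub_sqrt_one_sub_sq (h1 i j)).mul_const _).mul_const _

-- Semidefiniteness is immediate from the Schur product theorem; the point is strictness. The
-- entrywise powers of `P = 1 - √(1 - T ^ 2)` tend to the identity matrix, so a null vector of the
-- form for `A ∘ P` that was also null for all higher powers would be null for the diagonal of `A`.
-- The relation `P ^ 2 = 2 * P - T ^ 2` supplies this propagation.
open Filter Topology in
theorem Matrix.PosSemidef.sum_mul_one_sub_sqrt_pos {ι : Type*} [Fintype ι] {A T : Matrix ι ι ℝ}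
    (hA : A.PosSemidef) (hA0 : ∀ i, 0 < A i i) (hT : T.PosSemidef) (hT1 : ∀ i, T i i = 1)
    (hlt : ∀ i j, i ≠ j → |T i j| < 1) {x : ι → ℝ} (hx : x ≠ 0) :
    0 < ∑ i, ∑ j, A i j * (1 - √(1 - T i j ^ 2)) * x i * x j := by
  classical
  have hle : ∀ i j, |T i j| ≤ 1 := by
    intro i j
    rcases eq_or_ne i j with rfl | h
    · simp [hT1]
    · exact (hlt i j h).le
  set P : Matrix ι ι ℝ := Matrix.of fun i j => 1 - √(1 - T i j ^ 2) with hP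
  have hPpsd : P.PosSemidef := hT.one_sub_sqrt_one_sub_sq hle
  have hPsq : ∀ i j, P i j ^ 2 = 2 * P i j - T i j ^ 2 := by
    intro i j
    have : √(1 - T i j ^ 2) ^ 2 = 1 - T i j ^ 2 := Real.sq_sqrt (by
      have := sq_le_one_iff_abs_le_one (T i j) |>.2 (hle i j)
      linarith)
    simp only [hP, Matrix.of_apply]
    nlinarith
  have hpow : ∀ k, (Matrix.of fun i j => A i j * P i j ^ k).PosSemidef := by
    intro k
    induction k with
    | zero =>
      convert hA using 1
      ext i j
      simp
    | succ k ih =>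
      have h : (Matrix.of fun i j => A i j * P i j ^ (k + 1)) =
          (Matrix.of fun i j => A i j * P i j ^ k).hadamard P := by
        ext i j
        simp only [Matrix.of_apply, Matrix.hadamard_apply, pow_succ]
        ring
      rw [h]
      exact ih.hadamard hPpsd
  have hpowT : ∀ k, (Matrix.of fun i j => A i j * P i j ^ k * T i j ^ 2).PosSemidef := by
    intro k
    have h : (Matrix.of fun i j => A i j * P i j ^ k * T i j ^ 2) =
        ((Matrix.of fun i j => A i j * P i j ^ k).hadamard T).hadamard T := by
      ext i j
      simp only [Matrix.of_apply, Matrix.hadamard_apply]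
      ring
    rw [h]
    exact ((hpow k).hadamard hT).hadamard hT
  set F : ℕ → ℝ := fun k => ∑ i, ∑ j, A i j * P i j ^ k * x i * x j with hF
  have hF0 : ∀ k, 0 ≤ F k := fun k => (Matrix.posSemidef_iff_sum_nonneg.1 (hpow k)).2 x
  -- The deficit is the form of `A ∘ P ^ k ∘ T ∘ T`, again positive semidefinite. Since also `0 ≤
  -- F`, vanishing at 1 forces vanishing at all larger exponents.
  have hFle : ∀ k, F (k + 2) ≤ 2 * F (k + 1) := by
    intro k
    have h := (Matrix.posSemidef_iff_sum_nonneg.1 (hpowT k)).2 x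
    have : F (k + 2) = 2 * F (k + 1) - ∑ i, ∑ j, A i j * P i j ^ k * T i j ^ 2 * x i * x j := by
      simp only [hF, Finset.mul_sum, ← Finset.sum_sub_distrib]
      refine Finset.sum_congr rfl fun i _ => Finset.sum_congr rfl fun j _ => ?_
      rw [pow_add, hPsq, pow_succ]
      ring
    simp only [Matrix.of_apply] at h
    linarith
  have hFone : F 1 = ∑ i, ∑ j, A i j * (1 - √(1 - T i j ^ 2)) * x i * x j := by
    simp [hF, hP]
  rw [← hFone]
  refine lt_of_le_of_ne (hF0 1) fun hzero => ?_
  have hall : ∀ k, F (k + 1) = 0 := by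
    intro k
    induction k with
    | zero => exact hzero.symm
    | succ k ih => exact le_antisymm (by linarith [hFle k]) (hF0 _)
  have hP0 : ∀ i j, 0 ≤ P i j := by
    intro i j
    simp only [hP, Matrix.of_apply, sub_nonneg]
    exact Real.sqrt_le_one.2 (by nlinarith [sq_nonneg (T i j)])
  have hPlt : ∀ i j, i ≠ j → P i j < 1 := by
    intro i j hij
    have := (sq_lt_one_iff_abs_lt_one (T i j)).2 (hlt i j hij)
    have : 0 < √(1 - T i j ^ 2) := Real.sqrt_pos.2 (by linarith)
    simp only [hP, Matrix.of_apply]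
    linarith
  -- Off the diagonal `0 ≤ P i j < 1`, while `P i i = 1`: only the diagonal of `A` remains in the
  -- limit.
  have hlim : Tendsto F atTop (𝓝 (∑ i, ∑ j, A i j * (if i = j then 1 else 0) * x i * x j)) := by
    refine tendsto_finsetSum _ fun i _ => tendsto_finsetSum _ fun j _ =>
      ((Tendsto.const_mul _ ?_).mul_const _).mul_const _
    split_ifs with h
    · subst h
      have h1 : P i i = 1 := by simp [hP, hT1]
      exact tendsto_const_nhds.congr fun k => by rw [h1, one_pow]
    · exact tendsto_pow_atTop_nhds_zero_of_lt_one (hP0 i j) (hPlt i j h)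
  have hlim0 : Tendsto F atTop (𝓝 0) := by
    rw [← tendsto_add_atTop_iff_nat 1]
    simp [hall]
  have heq := tendsto_nhds_unique hlim hlim0
  obtain ⟨i₀, hi₀⟩ := Function.ne_iff.1 hx
  replace hi₀ : x i₀ ≠ 0 := hi₀
  have hpos : 0 < ∑ i, A i i * x i ^ 2 :=
    Finset.sum_pos' (fun i _ => mul_nonneg (hA0 i).le (sq_nonneg _))
      ⟨i₀, Finset.mem_univ _, mul_pos (hA0 i₀) (by positivity)⟩
  refine hpos.ne' ?_
  rw [← heq]
  refine Finset.sum_congr rfl fun i _ => ?_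
  simp only [mul_ite, mul_one, mul_zero, ite_mul, zero_mul, Finset.sum_ite_eq, Finset.mem_univ,
    if_true]
  ring

/-! ### Sign patterns of families of lines -/

/-- There are unit vectors `u i`, pairwise not parallel, and vectors `m i` such that the reciprocal
product of the lines with Plücker coordinates `(u i, m i)` and `(u j, m j)` is `σ i j` times the
sine of the angle between `u i` and `u j`. -/
def IsRealizable {ι : Type*} (σ : ι → ι → ℝ) : Prop :=
  ∃ u m : ι → E3, (∀ i, ‖u i‖ = 1) ∧ (∀ i j, i ≠ j → |inner ℝ (u i) (u j)| < 1) ∧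
    ∀ i j, inner ℝ (u i) (m j) + inner ℝ (u j) (m i) = σ i j * √(1 - inner ℝ (u i) (u j) ^ 2)

/-! ### Linear relations between directions, and five equal signs -/

theorem exists_ne_zero_sum_smul_eq_zero {ι F : Type*} [Fintype ι] [AddCommGroup F] [Module ℝ F]
    [FiniteDimensional ℝ F] (w : ι → F) (h : Module.finrank ℝ F < Fintype.card ι) :
    ∃ c : ι → ℝ, c ≠ 0 ∧ ∑ i, c i • w i = 0 := by
  have : ¬ LinearIndependent ℝ w := fun hw => by
    have := hw.fintype_card_le_finrank
    omega
  obtain ⟨c, hc, i, hi⟩ := Fintype.not_linearIndependent_iff.1 this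
  exact ⟨c, fun h0 => hi (by simp [h0]), hc⟩

section Reciprocal

variable {ι F : Type*} [Fintype ι] [NormedAddCommGroup F] [InnerProductSpace ℝ F]

theorem sum_inner_mul_mul (u v : ι → F) (x y : ι → ℝ) :
    ∑ i, ∑ j, inner ℝ (u i) (v j) * x i * y j = inner ℝ (∑ i, x i • u i) (∑ j, y j • v j) := by
  rw [sum_inner]
  refine Finset.sum_congr rfl fun i _ => ?_
  rw [inner_sum]
  refine Finset.sum_congr rfl fun j _ => ?_
  rw [real_inner_smul_left, real_inner_smul_right]
  ring

theorem posSemidef_of_inner (u : ι → F) :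
    (Matrix.of fun i j => (inner ℝ (u i) (u j) : ℝ)).PosSemidef := by
  rw [Matrix.posSemidef_iff_sum_nonneg]
  refine ⟨fun i j => real_inner_comm _ _, fun x => ?_⟩
  simp only [Matrix.of_apply, sum_inner_mul_mul]
  exact real_inner_self_nonneg

/-- By bilinearity each half of the sum is the inner product of `∑ x i • u i` with `∑ x i • m i`. -/
theorem sum_reciprocal_eq_zero {u : ι → F} (m : ι → F) {x : ι → ℝ} (hx : ∑ i, x i • u i = 0) :
    ∑ i, ∑ j, (inner ℝ (u i) (m j) + inner ℝ (u j) (m i) : ℝ) * x i * x j = 0 := by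
  have h1 := sum_inner_mul_mul u m x x
  have h2 := sum_inner_mul_mul m u x x
  rw [hx, inner_zero_left] at h1
  rw [hx, inner_zero_right] at h2
  calc _ = ∑ i, ∑ j, (inner ℝ (u i) (m j) : ℝ) * x i * x j +
        ∑ i, ∑ j, (inner ℝ (m i) (u j) : ℝ) * x i * x j := by
        simp only [← Finset.sum_add_distrib]
        refine Finset.sum_congr rfl fun i _ => Finset.sum_congr rfl fun j _ => ?_
        rw [real_inner_comm (u j) (m i)]
        ring
    _ = 0 := by rw [h1, h2, add_zero]

end Reciprocal

/-- A matrix with positive diagonal which is positive semidefinite and has a kernel vector that is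
a linear relation between the directions cannot have the sign pattern of a family of lines. -/
theorem false_of_posSemidef_mulVec_eq_zero {ι : Type*} [Fintype ι] {A : Matrix ι ι ℝ}
    (hA : A.PosSemidef) (hA0 : ∀ i, 0 < A i i) {u m : ι → E3} (hu : ∀ i, ‖u i‖ = 1)
    (hlt : ∀ i j, i ≠ j → |inner ℝ (u i) (u j)| < 1)
    (hm : ∀ i j, inner ℝ (u i) (m j) + inner ℝ (u j) (m i) =
      A i j * √(1 - inner ℝ (u i) (u j) ^ 2))
    {x : ι → ℝ} (hx0 : x ≠ 0) (hx : ∑ i, x i • u i = 0) (hAx : ∀ i, ∑ j, A i j * x j = 0) :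
    False := by
  -- The form of `A ∘ (1 - sin)` is positive at `x`. Yet the form of `A` vanishes there because `x`
  -- is in its kernel, and the form of `A ∘ sin` vanishes because it is the reciprocal form at a
  -- linear relation.
  have h1 := hA.sum_mul_one_sub_sqrt_pos hA0 (posSemidef_of_inner u)
    (fun i => by simp [hu i]) hlt hx0
  have h2 := sum_reciprocal_eq_zero m hx
  have h3 : ∑ i, ∑ j, A i j * x i * x j = 0 := by
    refine Finset.sum_eq_zero fun i _ => ?_
    calc _ = x i * ∑ j, A i j * x j := by
          rw [Finset.mul_sum]
          exact Finset.sum_congr rfl fun j _ => by ring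
      _ = 0 := by rw [hAx, mul_zero]
  simp only [hm] at h2
  have h4 : ∑ i, ∑ j, A i j * (1 - √(1 - (Matrix.of fun i j => (inner ℝ (u i) (u j) : ℝ)) i j ^ 2))
      * x i * x j = ∑ i, ∑ j, A i j * x i * x j -
        ∑ i, ∑ j, A i j * √(1 - inner ℝ (u i) (u j) ^ 2) * x i * x j := by
    simp only [← Finset.sum_sub_distrib, Matrix.of_apply]
    exact Finset.sum_congr rfl fun i _ => Finset.sum_congr rfl fun j _ => by ring
  linarith

theorem not_isRealizable_five : ¬ IsRealizable fun _ _ : Fin 5 => (1 : ℝ) := by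
  rintro ⟨u, m, hu, hlt, hm⟩
  -- Five unknowns against 1 + 3 conditions: `x` is in the kernel of the all-one matrix and is a
  -- relation between the directions.
  obtain ⟨x, hx0, hx⟩ := exists_ne_zero_sum_smul_eq_zero (fun i => ((1 : ℝ), u i)) (by simp)
  have hx1 := congrArg Prod.fst hx
  have hx2 := congrArg Prod.snd hx
  simp only [Prod.smul_mk, Prod.fst_sum, Prod.snd_sum, smul_eq_mul, mul_one, Prod.fst_zero,
    Prod.snd_zero] at hx1 hx2
  refine false_of_posSemidef_mulVec_eq_zero (A := Matrix.of fun _ _ => 1) ?_ (by simp) hu hlt hm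
    hx0 hx2 (by simp [hx1])
  refine Matrix.posSemidef_iff_sum_nonneg.2 ⟨by simp, fun y => ?_⟩
  simp only [Matrix.of_apply, one_mul, ← Finset.mul_sum, ← Finset.sum_mul]
  exact mul_self_nonneg _

/-! ### The pentagon with two twins -/

/-- A quadratic form whose kernel is of negative type is nonpositive on vectors whose pairing with
some row of the kernel vanishes. -/
theorem sum_sqrt_mul_mul_nonpos {ι : Type*} [Fintype ι] {u : ι → E3} (hu : ∀ i, ‖u i‖ = 1)
    (a : ι) {x : ι → ℝ} (hx : ∑ j, √(1 - inner ℝ (u a) (u j) ^ 2) * x j = 0) :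
    ∑ i, ∑ j, √(1 - inner ℝ (u i) (u j) ^ 2) * x i * x j ≤ 0 := by
  classical
  set D : ι → ι → ℝ := fun i j => √(1 - inner ℝ (u i) (u j) ^ 2) with hD
  have hsymm : ∀ i j, D i j = D j i := fun i j => by simp only [hD, real_inner_comm]
  have hdiag : ∀ i, D i i = 0 := fun i => by simp [hD, hu i]
  have hP := (posSemidef_of_inner u).one_sub_sqrt_one_sub_sq fun i j => by
    simpa [hu] using abs_real_inner_le_norm (u i) (u j)
  have hneg : ∀ z : ι → ℝ, ∑ i, z i = 0 → ∑ i, ∑ j, D i j * z i * z j ≤ 0 := by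
    intro z hz
    have h := (Matrix.posSemidef_iff_sum_nonneg.1 hP).2 z
    have : ∑ i, ∑ j, z i * z j = 0 := by rw [← Finset.sum_mul_sum, hz, zero_mul]
    have h' : ∑ i, ∑ j, (1 - D i j) * z i * z j =
        ∑ i, ∑ j, z i * z j - ∑ i, ∑ j, D i j * z i * z j := by
      simp only [← Finset.sum_sub_distrib]
      exact Finset.sum_congr rfl fun i _ => Finset.sum_congr rfl fun j _ => by ring
    simp only [Matrix.of_apply] at h
    linarith
  -- Subtracting `t` at position `a` makes the coordinate sum zero. The value of the form does not
  -- change, because the pairing of `x` with row `a` and the diagonal entry at `a` both vanish.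
  set t := ∑ i, x i with ht
  have h := hneg (fun i => x i - t * if i = a then 1 else 0) (by simp [← ht])
  have hx' : ∑ j, D j a * x j = 0 := by simpa only [hsymm _ a] using hx
  have : ∑ i, ∑ j, D i j * (x i - t * if i = a then 1 else 0) *
      (x j - t * if j = a then 1 else 0) = ∑ i, ∑ j, D i j * x i * x j := by
    calc _ = ∑ i, ∑ j, D i j * x i * x j -
          (∑ i, ∑ j, D i j * x i * t * (if j = a then 1 else 0)) -
          (∑ i, ∑ j, t * (D i j * x j) * (if i = a then 1 else 0)) +
          (∑ i, ∑ j, t * t * D i j * (if i = a then 1 else 0) * (if j = a then 1 else 0)) := by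
          simp only [← Finset.sum_sub_distrib, ← Finset.sum_add_distrib]
          exact Finset.sum_congr rfl fun i _ => Finset.sum_congr rfl fun j _ => by ring
      _ = ∑ i, ∑ j, D i j * x i * x j - (∑ i, D i a * x i) * t - t * (∑ j, D a j * x j) +
          t * t * D a a := by
          congr 1
          · congr 1
            · simp [Finset.sum_mul]
            · rw [Finset.sum_comm]
              simp [Finset.mul_sum]
          · simp
      _ = _ := by rw [hx', hx, hdiag]; ring
  linarith

/-- The cyclic form of a weighted pentagon is positive definite on a space of codimension two. -/
theorem pentagon_form_nonpos {a b c d e : ℝ} (pa : 0 < a) (pb : 0 < b) (pc : 0 < c) (pd : 0 < d)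
    (pe : 0 < e) {x y z v w : ℝ}
    (hx : x * (-a / (d * a * b / (e * c))) + y + w * (e / a) = 0)
    (hz : y + z * (-b / (d * a * b / (e * c))) + v * (c / b) = 0)
    (h : a * x * y + b * y * z + c * z * v + d * v * w + e * w * x ≤ 0) :
    x = 0 ∧ y = 0 ∧ z = 0 ∧ v = 0 ∧ w = 0 := by
  set k := d * a * b / (e * c) with hk
  have pk : 0 < k := by positivity
  -- The two side conditions become `a * y + e * w = a * p` and `b * y + c * v = b * q`. The
  -- constant `k` is chosen so that all three terms of the form in `p`, `q`, `y` acquire the same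
  -- coefficient.
  obtain ⟨p, hp⟩ : ∃ p, p = a / k * x := ⟨_, rfl⟩
  obtain ⟨q, hq⟩ : ∃ q, q = b / k * z := ⟨_, rfl⟩
  have g2 : x = k / a * p := by rw [hp]; field_simp
  have g4 : z = k / b * q := by rw [hq]; field_simp
  have g6 : w = a / e * (p - y) := by
    have h : w * (e / a) = p - y := by rw [hp, ← sub_eq_zero, ← hx]; ring
    rw [← h]
    field_simp
  have g5 : v = b / c * (q - y) := by
    have h : v * (c / b) = q - y := by rw [hq, ← sub_eq_zero, ← hz]; ring
    rw [← h]
    field_simp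
  have hcyc : a * x * y + b * y * z + c * z * v + d * v * w + e * w * x =
      k * (p ^ 2 + q ^ 2 + (p - y) * (q - y)) := by
    have hk' : d * (b / c) * (a / e) = k := by rw [hk]; field_simp
    have h1 : a * y + e * w = a * p := by rw [g6]; field_simp; ring
    have h2 : b * y + c * v = b * q := by rw [g5]; field_simp; ring
    calc _ = x * (a * y + e * w) + z * (b * y + c * v) + d * v * w := by ring
      _ = (k / a * p) * (a * p) + (k / b * q) * (b * q) +
          d * (b / c) * (a / e) * (p - y) * (q - y) := by
          rw [h1, h2, g2, g4, g5, g6]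
          ring
      _ = _ := by
          rw [hk']
          field_simp
  have hle : p ^ 2 + q ^ 2 + (p - y) * (q - y) ≤ 0 := by
    by_contra! hcon
    have := mul_pos pk hcon
    linarith
  -- Completing the square, the form is `(y - (p + q) / 2) ^ 2 + (3 * p ^ 2 + 2 * p * q + 3 * q ^ 2)
  -- / 4`, which is positive definite.
  have p0 : p = 0 := pow_eq_zero_iff two_ne_zero |>.1 <| le_antisymm (by
    nlinarith [sq_nonneg (y - (p + q) / 2), sq_nonneg (p + 3 * q)]) (sq_nonneg p)
  have q0 : q = 0 := pow_eq_zero_iff two_ne_zero |>.1 <| le_antisymm (by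
    nlinarith [sq_nonneg (y - (p + q) / 2), sq_nonneg (q + 3 * p)]) (sq_nonneg q)
  have y0 : y = 0 := pow_eq_zero_iff two_ne_zero |>.1 <| le_antisymm (by
    rw [p0, q0] at hle
    linarith) (sq_nonneg y)
  exact ⟨by rw [g2, p0, mul_zero], y0, by rw [g4, q0, mul_zero],
    by rw [g5, q0, y0, sub_zero, mul_zero], by rw [g6, p0, y0, sub_zero, mul_zero]⟩

/-- The reciprocal form is the sine form minus four times the cyclic form of the pentagon. At a
relation between the directions it vanishes, so the cyclic form there is a quarter of the sine form,
which is nonpositive once its row 0 annihilates `x`. Two more conditions make the cyclic form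
definite and kill the pentagon coordinates; the two twins then drop out as well. -/
theorem not_isRealizable_of_pentagon {σ : Fin 7 → Fin 7 → ℝ}
    (hσ : ∀ i j, i ≠ j → σ i j =
      if s(i, j) ∈ ({s(2, 3), s(3, 4), s(4, 5), s(5, 6), s(6, 2)} : Finset (Sym2 (Fin 7)))
        then -1 else 1) :
    ¬ IsRealizable σ := by
  rintro ⟨u, m, hu, hlt, hm⟩
  set D : Fin 7 → Fin 7 → ℝ := fun i j => √(1 - inner ℝ (u i) (u j) ^ 2) with hD
  have hsymm : ∀ i j, D i j = D j i := fun i j => by simp only [hD, real_inner_comm]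
  have hdiag : ∀ i, D i i = 0 := fun i => by simp [hD, hu i]
  have hpos : ∀ i j, i ≠ j → 0 < D i j := fun i j hij => Real.sqrt_pos.2 <| by
    have := (sq_lt_one_iff_abs_lt_one _).2 (hlt i j hij)
    linarith
  have p23 := hpos 2 3 (by decide)
  have p34 := hpos 3 4 (by decide)
  have p45 := hpos 4 5 (by decide)
  have p56 := hpos 5 6 (by decide)
  have p62 := hpos 6 2 (by decide)
  have p01 := hpos 0 1 (by decide)
  -- Seven unknowns against six conditions: one from row 0 of the sine matrix, the two of
  -- `pentagon_form_nonpos`, and three from the relation between the directions.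
  obtain ⟨x, hx0, hx⟩ := exists_ne_zero_sum_smul_eq_zero (fun i : Fin 7 =>
    (D 0 i, (![0, 0, -D 2 3 / (D 5 6 * D 2 3 * D 3 4 / (D 6 2 * D 4 5)), 1, 0, 0,
      D 6 2 / D 2 3] i : ℝ),
      (![0, 0, 0, 1, -D 3 4 / (D 5 6 * D 2 3 * D 3 4 / (D 6 2 * D 4 5)),
        D 4 5 / D 3 4, 0] i : ℝ), u i)) (by simp)
  simp only [Prod.smul_mk, Prod.ext_iff, Prod.fst_sum, Prod.snd_sum, smul_eq_mul, Prod.fst_zero,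
    Prod.snd_zero] at hx
  obtain ⟨e1, e2, e3, e4⟩ := hx
  have hneg := sum_sqrt_mul_mul_nonpos hu 0 (x := x) (by
    rw [← e1]
    exact Finset.sum_congr rfl fun j _ => mul_comm _ _)
  have hzero := sum_reciprocal_eq_zero m e4
  simp only [hm] at hzero
  have hzero' : ∑ i, ∑ j, D i j * x i * x j - 4 * (D 2 3 * x 2 * x 3 + D 3 4 * x 3 * x 4 +
      D 4 5 * x 4 * x 5 + D 5 6 * x 5 * x 6 + D 6 2 * x 6 * x 2) = 0 := by
    rw [← hzero]
    have : ∀ i j, σ i j * √(1 - inner ℝ (u i) (u j) ^ 2) * x i * x j = D i j * x i * x j -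
        2 * ((if s(i, j) ∈ ({s(2, 3), s(3, 4), s(4, 5), s(5, 6), s(6, 2)} : Finset (Sym2 (Fin 7)))
        then 1 else 0) * D i j * x i * x j) := by
      intro i j
      change σ i j * D i j * x i * x j = _
      rcases eq_or_ne i j with rfl | h
      · simp [hdiag]
      · rw [hσ i j h]
        split_ifs <;> ring
    simp only [this, Finset.sum_sub_distrib, ← Finset.mul_sum]
    rw [sub_right_inj]
    -- Each edge of the pentagon occurs as two ordered pairs; together with the factor 2 from `1 - 2
    -- * 1 = -1` this gives the 4.
    have : ∀ i j : Fin 7, s(i, j) ∈ ({s(2, 3), s(3, 4), s(4, 5), s(5, 6), s(6, 2)} :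
        Finset (Sym2 (Fin 7))) ↔ (i, j) ∈ ({(2, 3), (3, 4), (4, 5), (5, 6), (6, 2), (3, 2), (4, 3),
        (5, 4), (6, 5), (2, 6)} : Finset (Fin 7 × Fin 7)) := by decide
    simp only [this]
    rw [← Finset.sum_product' (f := fun i j => (if (i, j) ∈ ({(2, 3), (3, 4), (4, 5), (5, 6),
      (6, 2), (3, 2), (4, 3), (5, 4), (6, 5), (2, 6)} : Finset (Fin 7 × Fin 7)) then (1 : ℝ)
      else 0) * D i j * x i * x j)]
    simp only [Prod.mk.eta, ite_mul, one_mul, zero_mul, Finset.univ_product_univ,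
      Finset.sum_ite_mem, Finset.univ_inter]
    rw [Finset.sum_insert (by decide), Finset.sum_insert (by decide), Finset.sum_insert (by decide),
      Finset.sum_insert (by decide), Finset.sum_insert (by decide), Finset.sum_insert (by decide),
      Finset.sum_insert (by decide), Finset.sum_insert (by decide), Finset.sum_insert (by decide),
      Finset.sum_singleton]
    rw [hsymm 3 2, hsymm 4 3, hsymm 5 4, hsymm 6 5, hsymm 2 6]
    ring
  change ∑ i, ∑ j, D i j * x i * x j ≤ 0 at hneg
  obtain ⟨x20, x30, x40, x50, x60⟩ : x 2 = 0 ∧ x 3 = 0 ∧ x 4 = 0 ∧ x 5 = 0 ∧ x 6 = 0 :=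
    pentagon_form_nonpos p23 p34 p45 p56 p62 (by simpa [Fin.sum_univ_succ, add_assoc] using e2)
      (by simpa [Fin.sum_univ_succ, add_assoc] using e3) (by linarith)
  have x10 : x 1 = 0 := by
    have h : x 1 * D 0 1 = 0 := by
      rw [← e1]
      simp [Fin.sum_univ_seven, x20, x30, x40, x50, x60, hdiag]
    exact (mul_eq_zero.1 h).resolve_right p01.ne'
  have x00 : x 0 = 0 := by
    have h : x 0 • u 0 = 0 := by
      rw [← e4]
      simp [Fin.sum_univ_seven, x10, x20, x30, x40, x50, x60]
    refine (smul_eq_zero.1 h).resolve_right fun h0 => ?_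
    simpa [h0] using hu 0
  refine hx0 (funext fun i => ?_)
  fin_cases i <;> assumption

/-! ### Eleven points of the Paley conference matrix -/

/-- The Paley conference matrix of order fourteen. -/
def paleyMatrix (i j : Fin 14) : ℤ :=
  if i = j then 0 else if i = 0 ∨ j = 0 then 1 else
    -- The nonzero squares modulo 13, where index 0 plays the point at infinity; as -1 is among the
    -- squares, the matrix is symmetric.
    if (i.val + 13 - j.val) % 13 ∈ [1, 3, 4, 9, 10, 12] then 1 else -1

theorem paleyMatrix_comm (i j : Fin 14) : paleyMatrix i j = paleyMatrix j i := by
  revert i j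
  decide +kernel

theorem sum_paleyMatrix_mul (i k : Fin 14) :
    ∑ j, paleyMatrix i j * paleyMatrix j k = if i = k then 13 else 0 := by
  revert i k
  decide +kernel

/-- Twice the inverse of the lower left block of size seven of `paleyMatrix`. -/
def paleyBlockInverse : Fin 7 → Fin 7 → ℤ :=
  ![![1, -1, 2, -2, 2, -1, 1], ![0, -1, 1, -1, 1, -1, 1], ![1, -1, 1, -2, 2, -1, 0],
    ![0, -1, 1, -1, 0, 0, 1], ![1, 0, 0, -1, 1, -1, 0], ![0, -1, 2, -2, 1, -1, 1],
    ![1, -1, 1, -1, 1, -1, 0]]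

theorem sum_paleyBlockInverse_mul (i k : Fin 7) :
    ∑ j : Fin 7, paleyBlockInverse i j * paleyMatrix (Fin.natAdd 7 j) (Fin.castAdd 7 k) =
      if i = k then 2 else 0 := by
  revert i k
  decide +kernel

/-- From `S ^ 2 = 13` the matrix `S + √13` is positive semidefinite, and its kernel contains the
column space of `√13 - S`. The first seven columns are independent. Among their combinations, three
conditions enforce support on the first eleven coordinates and three more enforce a relation between
the directions, so one nonzero vector remains. -/
theorem not_isRealizable_paley {σ : Fin 11 → Fin 11 → ℝ}
    (hσ : ∀ i j, i ≠ j → σ i j = paleyMatrix (Fin.castAdd 3 i) (Fin.castAdd 3 j)) :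
    ¬ IsRealizable σ := by
  rintro ⟨u, m, hu, hlt, hm⟩
  set r : ℝ := √13 with hr
  have hr0 : 0 < r := Real.sqrt_pos.2 (by norm_num)
  have hrr : r * r = 13 := Real.mul_self_sqrt (by norm_num)
  set S : Fin 14 → Fin 14 → ℝ := fun i j => paleyMatrix i j with hS
  have hSsymm : ∀ i j, S i j = S j i := fun i j => by simp only [hS, paleyMatrix_comm i j]
  have hSdiag : ∀ i, S i i = 0 := fun i => by simp [hS, paleyMatrix]
  have hSS : ∀ i k, ∑ j, S i j * S j k = if i = k then 13 else 0 := fun i k => by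
    have := congrArg (Int.cast : ℤ → ℝ) (sum_paleyMatrix_mul i k)
    push_cast at this
    exact this
  -- the two spectral projections of the conference matrix
  set C : Fin 14 → Fin 14 → ℝ := fun i j => S i j + if i = j then r else 0 with hC
  set B : Fin 14 → Fin 14 → ℝ := fun i j => (if i = j then r else 0) - S i j with hB
  have hCC : ∀ i k, ∑ j, C j i * C j k = 2 * r * C i k := by
    intro i k
    simp only [hC, add_mul, mul_add, Finset.sum_add_distrib, mul_ite, ite_mul, mul_zero, zero_mul,
      Finset.sum_ite_eq', Finset.mem_univ, if_true, hSsymm _ i, hSS, hrr]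
    rcases eq_or_ne i k with rfl | h
    · simp only [if_true]
      linarith
    · simp only [if_neg h, if_neg h.symm]
      ring
  have hCB : ∀ i k, ∑ j, C i j * B j k = 0 := by
    intro i k
    simp only [hC, hB, add_mul, mul_sub, Finset.sum_add_distrib, Finset.sum_sub_distrib, mul_ite,
      ite_mul, mul_zero, zero_mul, Finset.sum_ite_eq', Finset.sum_ite_eq, Finset.mem_univ, if_true,
      hSS, hrr]
    rcases eq_or_ne i k with rfl | h
    · simp only [if_true]
      linarith
    · simp only [if_neg h]
      ring
  obtain ⟨z, hz0, hz⟩ := exists_ne_zero_sum_smul_eq_zero (fun k : Fin 7 =>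
    ((fun l : Fin 3 => B (Fin.natAdd 11 l) (Fin.castAdd 7 k)),
      ∑ i : Fin 11, B (Fin.castAdd 3 i) (Fin.castAdd 7 k) • u i)) (by simp)
  set y : Fin 14 → ℝ := fun i => ∑ k : Fin 7, B i (Fin.castAdd 7 k) * z k with hy
  have hytop : ∀ l : Fin 3, y (Fin.natAdd 11 l) = 0 := by
    intro l
    have := congrFun (congrArg Prod.fst hz) l
    simp only [Prod.smul_mk, Prod.fst_sum, Finset.sum_apply, Pi.smul_apply, smul_eq_mul,
      Prod.fst_zero, Pi.zero_apply] at this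
    rw [← this]
    exact Finset.sum_congr rfl fun k _ => mul_comm _ _
  have hyu : ∑ i : Fin 11, y (Fin.castAdd 3 i) • u i = 0 := by
    have := congrArg Prod.snd hz
    simp only [Prod.smul_mk, Prod.snd_sum, Prod.snd_zero, Finset.smul_sum, smul_smul] at this
    rw [Finset.sum_comm] at this
    rw [← this]
    simp only [hy, Finset.sum_smul]
    exact Finset.sum_congr rfl fun i _ => Finset.sum_congr rfl fun k _ => by rw [mul_comm]
  have hCy : ∀ i, ∑ j, C i j * y j = 0 := by
    intro i
    simp only [hy, Finset.mul_sum]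
    rw [Finset.sum_comm]
    refine Finset.sum_eq_zero fun k _ => ?_
    simp only [← mul_assoc]
    rw [← Finset.sum_mul, hCB, zero_mul]
  have hy0 : (fun i : Fin 11 => y (Fin.castAdd 3 i)) ≠ 0 := by
    intro h
    have hyall : ∀ i, y i = 0 := fun i => by
      refine Fin.addCases (m := 11) (n := 3) (motive := fun i => y i = 0) (fun i => ?_) hytop i
      exact congrFun h i
    -- Rows from 7 on and columns below 7 avoid the diagonal, so this block of `B` is `-S`. It is
    -- invertible, hence `y` can vanish only with `z`.
    have hbot : ∀ l : Fin 7, ∑ k : Fin 7, S (Fin.natAdd 7 l) (Fin.castAdd 7 k) * z k = 0 := by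
      intro l
      have := hyall (Fin.natAdd 7 l)
      have hne : ∀ k : Fin 7, Fin.natAdd 7 l ≠ Fin.castAdd 7 k := fun k hk => by
        have := congrArg Fin.val hk
        simp at this
        omega
      simpa only [hy, hB, hne, if_false, zero_sub, neg_mul, Finset.sum_neg_distrib, neg_eq_zero]
        using this
    refine hz0 (funext fun i => ?_)
    have : ∑ l : Fin 7, (paleyBlockInverse i l : ℝ) *
        ∑ k : Fin 7, S (Fin.natAdd 7 l) (Fin.castAdd 7 k) * z k = 2 * z i := by
      simp only [Finset.mul_sum]
      rw [Finset.sum_comm]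
      simp only [← mul_assoc, ← Finset.sum_mul]
      have h : ∀ k : Fin 7, ∑ l : Fin 7, (paleyBlockInverse i l : ℝ) *
          S (Fin.natAdd 7 l) (Fin.castAdd 7 k) = if i = k then 2 else 0 := fun k => by
        have := congrArg (Int.cast : ℤ → ℝ) (sum_paleyBlockInverse_mul i k)
        push_cast at this
        exact this
      simp only [h]
      simp
    simp only [hbot, mul_zero, Finset.sum_const_zero] at this
    simpa using this.symm
  refine false_of_posSemidef_mulVec_eq_zero
    (m := m)
    (A := Matrix.of fun i j => C (Fin.castAdd 3 i) (Fin.castAdd 3 j)) ?_ ?_ hu hlt ?_ hy0 hyu ?_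
  · refine Matrix.posSemidef_iff_sum_nonneg.2 ⟨fun i j => ?_, fun x => ?_⟩
    · simp only [Matrix.of_apply, hC, hSsymm (Fin.castAdd 3 i), eq_comm]
    -- By `hCC` the matrix `C` is the Gram matrix of its columns divided by `2 * r`, so its form is
    -- a sum of squares.
    · have : ∑ i : Fin 11, ∑ j : Fin 11, C (Fin.castAdd 3 i) (Fin.castAdd 3 j) * x i * x j =
          (∑ k, (∑ i : Fin 11, C k (Fin.castAdd 3 i) * x i) ^ 2) / (2 * r) := by
        rw [eq_div_iff (by positivity)]
        simp only [sq, Finset.sum_mul_sum]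
        symm
        rw [Finset.sum_comm, Finset.sum_mul]
        refine Finset.sum_congr rfl fun i _ => ?_
        rw [Finset.sum_comm, Finset.sum_mul]
        refine Finset.sum_congr rfl fun j _ => ?_
        rw [show C (Fin.castAdd 3 i) (Fin.castAdd 3 j) * x i * x j * (2 * r) =
          2 * r * C (Fin.castAdd 3 i) (Fin.castAdd 3 j) * (x i * x j) by ring, ← hCC,
          Finset.sum_mul]
        exact Finset.sum_congr rfl fun k _ => by ring
      simp only [Matrix.of_apply, this]
      positivity
  · intro i
    simpa [hC, hSdiag] using hr0
  · intro i j
    rw [hm]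
    rcases eq_or_ne i j with rfl | h
    · simp [hu i]
    · have : Fin.castAdd 3 i ≠ Fin.castAdd 3 j := fun h' => h (Fin.castAdd_injective _ _ h')
      rw [hσ i j h]
      simp [hC, hS, this]
  · intro i
    -- The last three coordinates of `y` vanish, so the kernel equation of `C` restricts to the
    -- principal block of size eleven.
    have := hCy (Fin.castAdd 3 i)
    rw [show (Finset.univ : Finset (Fin 14)) = (Finset.univ : Finset (Fin (11 + 3))) from rfl] at this
    rw [Fin.sum_univ_add] at this
    simpa only [hytop, mul_zero, Finset.sum_const_zero, add_zero, Matrix.of_apply] using this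

/-! ### Switching invariance, and unrealizability on eleven points -/

/-- The sign of a reciprocal product encoded by a Boolean. -/
def boolSign (b : Bool) : ℝ := bif b then -1 else 1

theorem boolSign_xor (a b : Bool) : boolSign (a ^^ b) = boolSign a * boolSign b := by
  cases a <;> cases b <;> simp [boolSign]

theorem boolSign_mul_self (a : Bool) : boolSign a * boolSign a = 1 := by
  cases a <;> simp [boolSign]

theorem abs_boolSign (a : Bool) : |boolSign a| = 1 := by
  cases a <;> simp [boolSign]

/-- A pattern contained, up to switching, in the sign pattern of a family of lines is realizable. -/
theorem IsRealizable.of_switchContains {ι : Type*} {s : ι → ι → Bool} {p : ℕ × ℕ}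
    (hs : IsRealizable fun i j => boolSign (s i j)) (h : SwitchContains s p) :
    IsRealizable fun i j : Fin p.1 => boolSign (edgeBit p.2 i j) := by
  obtain ⟨u, m, hu, hlt, hm⟩ := hs
  obtain ⟨f, ε, b, hf, hfs⟩ := h
  -- Reversing a line changes the sign of both its direction and its moment; the global negation `b`
  -- acts on the moments only.
  refine ⟨fun i => boolSign (ε i) • u (f i), fun i => (boolSign (ε i) * boolSign b) • m (f i),
    fun i => ?_, fun i j hij => ?_, fun i j => ?_⟩
  · simp [norm_smul, abs_boolSign, hu]
  · simpa [real_inner_smul_left, real_inner_smul_right, abs_mul, abs_boolSign] using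
      hlt _ _ fun h => hij (hf h)
  · have h1 : boolSign (ε i) ^ 2 = 1 := by rw [sq, boolSign_mul_self]
    have h2 : boolSign (ε j) ^ 2 = 1 := by rw [sq, boolSign_mul_self]
    have h3 : boolSign b ^ 2 = 1 := by rw [sq, boolSign_mul_self]
    have hmij := hm (f i) (f j)
    dsimp only at hmij
    simp only [real_inner_smul_left, real_inner_smul_right]
    have hT : (boolSign (ε j) * (boolSign (ε i) * inner ℝ (u (f i)) (u (f j)))) ^ 2 =
        inner ℝ (u (f i)) (u (f j)) ^ 2 := by
      rw [mul_pow, mul_pow, h1, h2, one_mul, one_mul]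
    rw [hT]
    rcases eq_or_ne i j with rfl | hij
    · have : inner ℝ (u (f i)) (m (f i)) = 0 := by
        simp [hu] at hmij
        exact hmij
      simp [hu, this]
    · calc _ = boolSign (ε i) * boolSign (ε j) * boolSign b *
            (inner ℝ (u (f i)) (m (f j)) + inner ℝ (u (f j)) (m (f i))) := by ring
        _ = boolSign (edgeBit p.2 i j) * (boolSign (ε i) ^ 2 * boolSign (ε j) ^ 2 * boolSign b ^ 2) *
            √(1 - inner ℝ (u (f i)) (u (f j)) ^ 2) := by
            rw [hmij, hfs i j hij]
            simp only [boolSign_xor]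
            ring
        _ = _ := by rw [h1, h2, h3]; ring

theorem not_isRealizable_of_mem_forbiddenPatterns {p : ℕ × ℕ} (hp : p ∈ forbiddenPatterns) :
    ¬ IsRealizable fun i j : Fin p.1 => boolSign (edgeBit p.2 i j) := by
  simp only [forbiddenPatterns, List.mem_cons, List.not_mem_nil, or_false] at hp
  rcases hp with rfl | rfl | rfl
  · have : ∀ i j : Fin 5, edgeBit 0 i j = false := by decide
    simpa [this, boolSign] using not_isRealizable_five
  · refine not_isRealizable_of_pentagon fun i j hij => ?_
    have : ∀ i j : Fin 7, i ≠ j → (edgeBit 0x124220 i j = true ↔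
      s(i, j) ∈ ({s(2, 3), s(3, 4), s(4, 5), s(5, 6), s(6, 2)} : Finset (Sym2 (Fin 7)))) := by
      decide +kernel
    simp only [← this i j hij, boolSign]
    cases edgeBit 0x124220 i j <;> simp
  · refine not_isRealizable_paley fun i j hij => ?_
    have : ∀ i j : Fin 11, i ≠ j → paleyMatrix (Fin.castAdd 3 i) (Fin.castAdd 3 j) =
      bif edgeBit 0x2789e4e4c92110 i j then -1 else 1 := by
      decide +kernel
    rw [this i j hij]
    change boolSign (edgeBit 0x2789e4e4c92110 i j) = _
    cases edgeBit 0x2789e4e4c92110 i j <;> simp [boolSign]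

/-- There are no eleven lines, pairwise not parallel, all of whose reciprocal products are equal to
the sine of the angle up to sign. -/
theorem not_isRealizable_eleven {ι : Type*} [Fintype ι] (hι : Fintype.card ι = 11)
    {s : ι → ι → Bool} (hs : ∀ i j, s i j = s j i) :
    ¬ IsRealizable fun i j => boolSign (s i j) := fun h => by
  obtain ⟨p, hp, hsp⟩ := exists_switchContains_forbiddenPatterns hι hs
  exact not_isRealizable_of_mem_forbiddenPatterns hp (h.of_switchContains hsp)

/-! ### Triple products -/

/-- The triple product of three vectors. -/
def tripleProduct (a b c : E3) : ℝ :=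
  a 0 * (b 1 * c 2 - b 2 * c 1) + a 1 * (b 2 * c 0 - b 0 * c 2) + a 2 * (b 0 * c 1 - b 1 * c 0)

/-- The vector product on Euclidean 3-space. -/
def vectorProduct (a b : E3) : E3 :=
  !₂[a 1 * b 2 - a 2 * b 1, a 2 * b 0 - a 0 * b 2, a 0 * b 1 - a 1 * b 0]

theorem inner_eq_sum_three (a b : E3) : inner ℝ a b = a 0 * b 0 + a 1 * b 1 + a 2 * b 2 := by
  simp [PiLp.inner_apply, Fin.sum_univ_three, mul_comm]

theorem inner_vectorProduct (a b c : E3) :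
    inner ℝ a (vectorProduct b c) = tripleProduct a b c := by
  simp [inner_eq_sum_three, tripleProduct, vectorProduct]

/-- This links the moments `p × u` in `IsRealizable` to the positions of the lines. -/
theorem reciprocal_eq_tripleProduct (p q u v : E3) :
    inner ℝ u (vectorProduct q v) + inner ℝ v (vectorProduct p u) = tripleProduct (p - q) u v := by
  simp only [inner_vectorProduct, tripleProduct, PiLp.sub_apply]
  ring

/-- The right side is the Gram determinant of the three vectors. -/
theorem tripleProduct_sq (a b c : E3) : tripleProduct a b c ^ 2 =
    inner ℝ a a * (inner ℝ b b * inner ℝ c c - inner ℝ b c ^ 2) -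
      inner ℝ a b * (inner ℝ a b * inner ℝ c c - inner ℝ b c * inner ℝ a c) +
      inner ℝ a c * (inner ℝ a b * inner ℝ b c - inner ℝ b b * inner ℝ a c) := by
  simp only [inner_eq_sum_three, tripleProduct]
  ring

theorem tripleProduct_sub (a a' b c : E3) :
    tripleProduct (a - a') b c = tripleProduct a b c - tripleProduct a' b c := by
  simp only [tripleProduct, PiLp.sub_apply]
  ring

/-- The reciprocal product does not depend on the points chosen on the two lines, so these may be
moved to the feet of the common perpendicular. -/
theorem tripleProduct_add_smul (a b c : E3) (s t : ℝ) :
    tripleProduct (a + s • b - t • c) b c = tripleProduct a b c := by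
  simp only [tripleProduct, PiLp.sub_apply, PiLp.add_apply, PiLp.smul_apply, smul_eq_mul]
  ring

theorem tripleProduct_smul (a b c : E3) (k : ℝ) :
    tripleProduct a (k • b) c = k * tripleProduct a b c := by
  simp only [tripleProduct, PiLp.smul_apply, smul_eq_mul]
  ring

theorem tripleProduct_combination (a b c : E3) (k l s t : ℝ) :
    tripleProduct a (k • b + l • c) (s • b + t • c) = (k * t - l * s) * tripleProduct a b c := by
  simp only [tripleProduct, PiLp.add_apply, PiLp.smul_apply, smul_eq_mul]
  ring

theorem tripleProduct_sq_of_orthogonal {a b c : E3} (hb : ‖b‖ = 1) (hc : ‖c‖ = 1)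
    (hab : inner ℝ a b = 0) : tripleProduct a b c ^ 2 =
      ‖a‖ ^ 2 * (1 - inner ℝ b c ^ 2) - inner ℝ a c ^ 2 := by
  rw [tripleProduct_sq, hab, real_inner_self_eq_norm_sq, real_inner_self_eq_norm_sq,
    real_inner_self_eq_norm_sq, hb, hc]
  ring

/-! ### Lines and their distances -/

section CommonPerpendicular

variable {F : Type*} [NormedAddCommGroup F] [InnerProductSpace ℝ F]

theorem eq_smul_of_inner_sq_eq_one {u v : F} (hu : ‖u‖ = 1) (hv : ‖v‖ = 1)
    (h : inner ℝ u v ^ 2 = 1) : v = inner ℝ u v • u := by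
  rw [← sub_eq_zero, ← norm_eq_zero, ← sq_eq_zero_iff, norm_sub_sq_real, norm_smul,
    real_inner_smul_right, real_inner_comm u v, hu, hv, mul_one, Real.norm_eq_abs, sq_abs]
  linarith

theorem inner_sq_le_one {u v : F} (hu : ‖u‖ = 1) (hv : ‖v‖ = 1) : inner ℝ u v ^ 2 ≤ 1 := by
  rw [sq_le_one_iff_abs_le_one]
  simpa [hu, hv] using abs_real_inner_le_norm u v

theorem exists_common_perpendicular (p q : F) {u v : F} (hu : ‖u‖ = 1) (hv : ‖v‖ = 1) :
    ∃ s t : ℝ, inner ℝ (p - q + s • u - t • v) u = 0 ∧ inner ℝ (p - q + s • u - t • v) v = 0 := by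
  have huu : inner ℝ u u = (1 : ℝ) := by simp [hu]
  have hvv : inner ℝ v v = (1 : ℝ) := by simp [hv]
  simp only [inner_sub_left, inner_add_left, real_inner_smul_left, huu, hvv]
  rw [← inner_sub_left, ← inner_sub_left, real_inner_comm u v]
  by_cases h : inner ℝ u v ^ 2 = 1
  -- For parallel lines the common perpendicular is not unique; the foot on the second line is taken
  -- to be `q`.
  · refine ⟨-inner ℝ (p - q) u, 0, by ring, ?_⟩
    have : inner ℝ (p - q) v = inner ℝ u v * inner ℝ (p - q) u := by
      conv_lhs => rw [eq_smul_of_inner_sq_eq_one hu hv h, real_inner_smul_right]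
    rw [this]
    ring
  · generalize inner ℝ u v = c at *
    have h' : 1 - c ^ 2 ≠ 0 := fun h0 => h (by linarith)
    refine ⟨(-inner ℝ (p - q) u + c * inner ℝ (p - q) v) / (1 - c ^ 2),
      (inner ℝ (p - q) v - c * inner ℝ (p - q) u) / (1 - c ^ 2), ?_, ?_⟩
    · field_simp
      ring
    · field_simp
      ring

theorem norm_le_of_common_perpendicular {δ u v : F} (hu : inner ℝ δ u = 0) (hv : inner ℝ δ v = 0)
    (s t : ℝ) : ‖δ‖ ≤ ‖δ + s • u - t • v‖ := by
  have h : inner ℝ δ (s • u - t • v) = 0 := by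
    simp [inner_sub_right, real_inner_smul_right, hu, hv]
  have := norm_add_sq_real δ (s • u - t • v)
  rw [h] at this
  rw [add_sub_assoc]
  refine abs_le_of_sq_le_sq' ?_ (norm_nonneg _) |>.2
  nlinarith [sq_nonneg ‖s • u - t • v‖]

end CommonPerpendicular

theorem IsLine.exists_eq_range {L : AffineSubspace ℝ E3} (hL : IsLine L) :
    ∃ p u : E3, ‖u‖ = 1 ∧ (L : Set E3) = Set.range fun t : ℝ => p + t • u := by
  obtain ⟨⟨p, hp⟩, h1⟩ := hL
  obtain ⟨⟨v, hvL⟩, hv0, hv⟩ := finrank_eq_one_iff'.1 h1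
  have hv0' : v ≠ 0 := fun h => hv0 (Subtype.ext h)
  have hn : ‖v‖ ≠ 0 := norm_ne_zero_iff.2 hv0'
  refine ⟨p, (‖v‖)⁻¹ • v, by simp [norm_smul, hn], Set.ext fun x => ⟨fun hx => ?_, ?_⟩⟩
  · obtain ⟨c, hc⟩ := hv ⟨x -ᵥ p, AffineSubspace.vsub_mem_direction hx hp⟩
    have hc' : c • v = x - p := congrArg Subtype.val hc
    refine ⟨c * ‖v‖, ?_⟩
    simp only [smul_smul]
    rw [mul_assoc, mul_inv_cancel₀ hn, mul_one, hc']
    abel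
  · rintro ⟨t, rfl⟩
    simp only [smul_smul]
    have := AffineSubspace.vadd_mem_of_mem_direction (L.direction.smul_mem (t * ‖v‖⁻¹) hvL) hp
    rwa [vadd_eq_add, add_comm] at this

theorem setDist_eq_of_forall_le {A B : Set E3} {a b : E3} (ha : a ∈ A) (hb : b ∈ B)
    (h : ∀ x ∈ A, ∀ y ∈ B, dist a b ≤ dist x y) : setDist A B = dist a b := by
  refine IsLeast.csInf_eq ⟨⟨a, ha, b, hb, rfl⟩, ?_⟩
  rintro _ ⟨x, hx, y, hy, rfl⟩
  exact h x hx y hy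

theorem exists_perpendicular_of_range (p q : E3) {u v : E3} (hu : ‖u‖ = 1) (hv : ‖v‖ = 1) :
    ∃ s t : ℝ, inner ℝ (p - q + s • u - t • v) u = 0 ∧ inner ℝ (p - q + s • u - t • v) v = 0 ∧
      (∀ x ∈ Set.range (fun t : ℝ => p + t • u), ∀ y ∈ Set.range (fun t : ℝ => q + t • v),
        dist (p + s • u) (q + t • v) ≤ dist x y) ∧
      setDist (Set.range fun t : ℝ => p + t • u) (Set.range fun t : ℝ => q + t • v) =
        ‖p - q + s • u - t • v‖ := by
  obtain ⟨s, t, h1, h2⟩ := exists_common_perpendicular p q hu hv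
  have hle : ∀ x ∈ Set.range (fun t : ℝ => p + t • u), ∀ y ∈ Set.range (fun t : ℝ => q + t • v),
        dist (p + s • u) (q + t • v) ≤ dist x y := by
    rintro _ ⟨s', rfl⟩ _ ⟨t', rfl⟩
    have := norm_le_of_common_perpendicular h1 h2 (s' - s) (t' - t)
    rw [dist_eq_norm, dist_eq_norm]
    rwa [show p + s • u - (q + t • v) = p - q + s • u - t • v by module,
      show (fun t => p + t • u) s' - (fun t => q + t • v) t' =
        p - q + s • u - t • v + (s' - s) • u - (t' - t) • v by module]
  refine ⟨s, t, h1, h2, hle, ?_⟩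
  rw [setDist_eq_of_forall_le (Set.mem_range_self s) (Set.mem_range_self t) hle, dist_eq_norm]
  congr 1
  abel

/-! ### Equidistant lines -/

/-- The component of `w` orthogonal to the unit vector `u`. -/
noncomputable def orthogonalPart (u w : E3) : E3 := w - (inner ℝ w u : ℝ) • u

theorem inner_orthogonalPart {u : E3} (hu : ‖u‖ = 1) (w : E3) :
    inner ℝ (orthogonalPart u w) u = 0 := by
  simp [orthogonalPart, inner_sub_left, real_inner_smul_left, hu]

theorem orthogonalPart_sub (u w w' : E3) :
    orthogonalPart u (w - w') = orthogonalPart u w - orthogonalPart u w' := by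
  simp only [orthogonalPart, inner_sub_left]
  module

theorem orthogonalPart_eq_of_inner_sq_eq_one {u v : E3} (hu : ‖u‖ = 1) (hv : ‖v‖ = 1)
    (h : inner ℝ u v ^ 2 = 1) (w : E3) : orthogonalPart v w = orthogonalPart u w := by
  have hvu := eq_smul_of_inner_sq_eq_one hu hv h
  generalize inner ℝ u v = c at *
  subst hvu
  simp only [orthogonalPart, real_inner_smul_right, smul_smul]
  rw [show c * inner ℝ w u * c = inner ℝ w u * c ^ 2 by ring, h, mul_one]

theorem inner_sq_eq_one_trans {u v w : E3} (hu : ‖u‖ = 1) (hv : ‖v‖ = 1)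
    (h1 : inner ℝ u v ^ 2 = 1) (h2 : inner ℝ u w ^ 2 = 1) : inner ℝ v w ^ 2 = 1 := by
  rw [eq_smul_of_inner_sq_eq_one hu hv h1, real_inner_smul_left, mul_pow, h1, h2, one_mul]

theorem tripleProduct_eq_zero_of_orthogonal {a b c u : E3} (hu : ‖u‖ = 1) (ha : inner ℝ a u = 0)
    (hb : inner ℝ b u = 0) (hc : inner ℝ c u = 0) : tripleProduct a b c = 0 := by
  have h : tripleProduct a b c * inner ℝ u u = inner ℝ a u * tripleProduct u b c +
      inner ℝ b u * tripleProduct a u c + inner ℝ c u * tripleProduct a b u := by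
    simp only [inner_eq_sum_three, tripleProduct]
    ring
  simpa [ha, hb, hc, hu] using h

/-- The lines `p i + ℝ u i` have pairwise distance `d`. -/
structure IsEquidistant {ι : Type*} (d : ℝ) (p u : ι → E3) : Prop where
  norm_eq_one : ∀ i, ‖u i‖ = 1
  setDist_eq : ∀ i j, i ≠ j → setDist (Set.range fun t : ℝ => p i + t • u i)
    (Set.range fun t : ℝ => p j + t • u j) = d

namespace IsEquidistant

variable {ι : Type*} {d : ℝ} {p u : ι → E3}

/-- At the common perpendicular the connecting vector has length `d` and is orthogonal to both
directions. The identity also covers parallel lines, where both sides are zero. -/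
theorem tripleProduct_sq (h : IsEquidistant d p u) {i j : ι} (hij : i ≠ j) :
    tripleProduct (p i - p j) (u i) (u j) ^ 2 = d ^ 2 * (1 - inner ℝ (u i) (u j) ^ 2) := by
  obtain ⟨s, t, h1, h2, -, h3⟩ := exists_perpendicular_of_range (p i) (p j) (h.norm_eq_one i)
    (h.norm_eq_one j)
  rw [h.setDist_eq i j hij] at h3
  rw [← tripleProduct_add_smul _ _ _ s t, tripleProduct_sq_of_orthogonal (h.norm_eq_one i)
    (h.norm_eq_one j) h1, h2, ← h3]
  ring

theorem norm_orthogonalPart (h : IsEquidistant d p u) {i j : ι} (hij : i ≠ j)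
    (hpar : inner ℝ (u i) (u j) ^ 2 = 1) : ‖orthogonalPart (u i) (p i - p j)‖ = d := by
  obtain ⟨s, t, h1, -, -, h3⟩ := exists_perpendicular_of_range (p i) (p j) (h.norm_eq_one i)
    (h.norm_eq_one j)
  rw [h.setDist_eq i j hij] at h3
  rw [h3]
  have huj := eq_smul_of_inner_sq_eq_one (h.norm_eq_one i) (h.norm_eq_one j) hpar
  generalize inner ℝ (u i) (u j) = c at huj
  rw [huj] at h1 ⊢
  have huu : inner ℝ (u i) (u i) = (1 : ℝ) := by simp [h.norm_eq_one i]
  have h4 : inner ℝ (p i - p j) (u i) = t * c - s := by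
    rw [inner_sub_left, inner_add_left, real_inner_smul_left, real_inner_smul_left,
      real_inner_smul_left, huu] at h1
    linarith
  rw [orthogonalPart, h4]
  congr 1
  module

/-- Projected along the common direction, the lines would become four points of a plane with all
mutual distances `d`. The three differences from one of them have Gram determinant `d ^ 6 / 2`,
whereas coplanarity makes it zero. -/
theorem false_of_four_parallel (h : IsEquidistant d p u) (hd : 0 < d) (f : Fin 4 ↪ ι)
    (hf : ∀ a b, inner ℝ (u (f a)) (u (f b)) ^ 2 = 1) : False := by
  set w : Fin 4 → E3 := fun k => orthogonalPart (u (f 0)) (p (f 0) - p (f k)) with hw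
  have hwu : ∀ k, inner ℝ (w k) (u (f 0)) = 0 := fun k => inner_orthogonalPart (h.norm_eq_one _) _
  have hwd : ∀ k, k ≠ 0 → ‖w k‖ = d := fun k hk =>
    h.norm_orthogonalPart (fun h0 => hk (f.injective h0).symm) (hf _ _)
  have hww : ∀ k l, k ≠ l → ‖w l - w k‖ = d := fun k l hkl => by
    simp only [hw]
    rw [← orthogonalPart_sub, sub_sub_sub_cancel_left,
      ← orthogonalPart_eq_of_inner_sq_eq_one (h.norm_eq_one _) (h.norm_eq_one _) (hf 0 k)]
    exact h.norm_orthogonalPart (fun h0 => hkl (f.injective h0)) (hf _ _)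
  have hin : ∀ k l, k ≠ 0 → l ≠ 0 → k ≠ l → inner ℝ (w k) (w l) = d ^ 2 / 2 :=
    fun k l hk hl hkl => by
      have := norm_sub_sq_real (w k) (w l)
      rw [hww l k hkl.symm, hwd k hk, hwd l hl] at this
      linarith
  have h0 := tripleProduct_eq_zero_of_orthogonal (h.norm_eq_one (f 0)) (hwu 1) (hwu 2) (hwu 3)
  have h1 := _root_.tripleProduct_sq (w 1) (w 2) (w 3)
  rw [h0, hin 1 2 (by decide) (by decide) (by decide), hin 1 3 (by decide) (by decide) (by decide),
    hin 2 3 (by decide) (by decide) (by decide), real_inner_self_eq_norm_sq,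
    real_inner_self_eq_norm_sq, real_inner_self_eq_norm_sq, hwd 1 (by decide), hwd 2 (by decide),
    hwd 3 (by decide)] at h1
  have : 0 < d ^ 6 := by positivity
  nlinarith

/-- A line not parallel to two given parallel lines is parallel to the plane spanned by them and
has a fixed distance from that plane. -/
theorem offset_of_parallel (h : IsEquidistant d p u) (hd : 0 < d) {i j k : ι} (hij : i ≠ j)
    (hpar : inner ℝ (u i) (u j) ^ 2 = 1) (hk : inner ℝ (u i) (u k) ^ 2 ≠ 1) :
    (∃ a b : ℝ, u k = a • u i + b • orthogonalPart (u i) (p i - p j)) ∧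
      tripleProduct (p i - p k) (u i) (orthogonalPart (u i) (p i - p j)) ^ 2 = d ^ 4 := by
  have hik : i ≠ k := by
    rintro rfl
    simp [h.norm_eq_one] at hk
  have hjk : j ≠ k := by
    rintro rfl
    exact hk hpar
  have hlt : inner ℝ (u i) (u k) ^ 2 < 1 :=
    lt_of_le_of_ne (inner_sq_le_one (h.norm_eq_one i) (h.norm_eq_one k)) hk
  have huw := inner_orthogonalPart (h.norm_eq_one i) (p i - p j)
  have hw := h.norm_orthogonalPart hij hpar
  have hA := h.tripleProduct_sq hik
  have hB : tripleProduct (p j - p k) (u i) (u k) ^ 2 = d ^ 2 * (1 - inner ℝ (u i) (u k) ^ 2) := by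
    have := h.tripleProduct_sq hjk
    rw [eq_smul_of_inner_sq_eq_one (h.norm_eq_one i) (h.norm_eq_one j) hpar,
      real_inner_smul_left, mul_pow, tripleProduct_smul, mul_pow, hpar, one_mul, one_mul] at this
    exact this
  have hC : tripleProduct (orthogonalPart (u i) (p i - p j)) (u i) (u k) =
      tripleProduct (p i - p k) (u i) (u k) - tripleProduct (p j - p k) (u i) (u k) := by
    rw [← tripleProduct_sub, sub_sub_sub_cancel_right, orthogonalPart]
    have := tripleProduct_add_smul (p i - p j) (u i) (u k) (-inner ℝ (p i - p j) (u i)) 0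
    rwa [zero_smul, sub_zero, neg_smul, ← sub_eq_add_neg] at this
  have hCsq := tripleProduct_sq_of_orthogonal (h.norm_eq_one i) (h.norm_eq_one k) huw
  rw [hw] at hCsq
  generalize orthogonalPart (u i) (p i - p j) = w at *
  have hd2 : 0 < d ^ 2 * (1 - inner ℝ (u i) (u k) ^ 2) := mul_pos (by positivity) (by linarith)
  -- The reciprocal products of line `k` with the two parallel lines agree up to sign. Opposite
  -- signs would give a difference of square `4 * d ^ 2 * (1 - inner ℝ (u i) (u k) ^ 2)`, four times
  -- what `hCsq` allows.
  have hC0 : tripleProduct w (u i) (u k) = 0 := by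
    rcases sq_eq_sq_iff_eq_or_eq_neg.1 (hA.trans hB.symm) with he | he
    · rw [hC, he, sub_self]
    · rw [hC, he] at hCsq
      nlinarith [sq_nonneg (inner ℝ w (u k))]
  rw [hC0] at hCsq
  set g : ℝ := inner ℝ w (u k) with hg
  set c : ℝ := inner ℝ (u i) (u k) with hc
  -- Here `u i` and `w` are orthogonal of lengths 1 and `d`; the squared norm of the difference is
  -- `1 - c ^ 2 - g ^ 2 / d ^ 2`, which vanishes by `hCsq`.
  have hv : u k = c • u i + (g / d ^ 2) • w := by
    have hcomm : inner ℝ (u k) w = g := real_inner_comm _ _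
    have hcomm' : inner ℝ (u k) (u i) = c := real_inner_comm _ _
    rw [← sub_eq_zero, ← norm_eq_zero, ← sq_eq_zero_iff, ← sub_sub, norm_sub_sq_real,
      norm_sub_sq_real, norm_smul, norm_smul, real_inner_smul_right, real_inner_smul_right,
      inner_sub_left, real_inner_smul_left, real_inner_comm w (u i), huw, hcomm, hcomm', hw,
      h.norm_eq_one, h.norm_eq_one, mul_one, mul_pow, Real.norm_eq_abs, Real.norm_eq_abs, sq_abs,
      sq_abs]
    field_simp
    linarith
  refine ⟨⟨c, g / d ^ 2, hv⟩, ?_⟩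
  have hz : tripleProduct (p i - p k) (u i) (u k) =
      g / d ^ 2 * tripleProduct (p i - p k) (u i) w := by
    have := tripleProduct_combination (p i - p k) (u i) w 1 0 c (g / d ^ 2)
    rw [← hv, one_smul, zero_smul, add_zero] at this
    rw [this]
    ring
  rw [hz] at hA
  have hg0 : g ^ 2 ≠ 0 := by nlinarith
  have hg2 : d ^ 2 * (1 - c ^ 2) = g ^ 2 := by linarith
  rw [hg2] at hA
  field_simp at hA
  refine mul_left_cancel₀ hg0 ?_
  linarith

/-- Given two parallel lines, every line not parallel to them lies in one of two planes parallel to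
theirs, one on each side at distance `d`. Two lines in the same plane have zero reciprocal product,
and since `d > 0` they are parallel. So there are three classes of pairwise parallel lines, none
with four members. -/
theorem inner_sq_ne_one (h : IsEquidistant d p u) (hd : 0 < d) [Fintype ι]
    (hι : 9 < Fintype.card ι) {i j : ι} (hij : i ≠ j) : inner ℝ (u i) (u j) ^ 2 ≠ 1 := by
  classical
  intro hpar
  set z : ι → ℝ := fun k =>
    tripleProduct (p i - p k) (u i) (orthogonalPart (u i) (p i - p j)) with hz
  let c : ι → Fin 3 := fun k =>
    if inner ℝ (u i) (u k) ^ 2 = 1 then 0 else if z k = d ^ 2 then 1 else 2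
  have hside : ∀ k l, inner ℝ (u i) (u k) ^ 2 ≠ 1 → inner ℝ (u i) (u l) ^ 2 ≠ 1 → z k = z l →
      inner ℝ (u k) (u l) ^ 2 = 1 := by
    intro k l hk hl hkl
    rcases eq_or_ne k l with rfl | hne
    · simp [h.norm_eq_one]
    obtain ⟨a, b, hab⟩ := (h.offset_of_parallel hd hij hpar hk).1
    obtain ⟨a', b', hab'⟩ := (h.offset_of_parallel hd hij hpar hl).1
    have h0 : tripleProduct (p k - p l) (u k) (u l) = 0 := by
      rw [hab, hab', tripleProduct_combination, ← sub_sub_sub_cancel_left (p l) (p k) (p i),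
        tripleProduct_sub]
      change _ * (z l - z k) = 0
      rw [hkl, sub_self, mul_zero]
    have h1 := h.tripleProduct_sq hne
    rw [h0] at h1
    have : d ^ 2 * (1 - inner ℝ (u k) (u l) ^ 2) = 0 := by linarith
    have := (mul_eq_zero.1 this).resolve_left (by positivity)
    linarith
  have hclass : ∀ k l, c k = c l → inner ℝ (u k) (u l) ^ 2 = 1 := by
    intro k l hkl
    by_cases hk : inner ℝ (u i) (u k) ^ 2 = 1 <;> by_cases hl : inner ℝ (u i) (u l) ^ 2 = 1
    · exact inner_sq_eq_one_trans (h.norm_eq_one i) (h.norm_eq_one k) hk hl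
    · simp only [c, hk, hl, if_true, if_false] at hkl
      split_ifs at hkl <;> simp at hkl
    · simp only [c, hk, hl, if_true, if_false] at hkl
      split_ifs at hkl <;> simp at hkl
    · refine hside k l hk hl ?_
      have hzk : z k ^ 2 = d ^ 4 := (h.offset_of_parallel hd hij hpar hk).2
      have hzl : z l ^ 2 = d ^ 4 := (h.offset_of_parallel hd hij hpar hl).2
      have hor : ∀ x, z x ^ 2 = d ^ 4 → z x ≠ d ^ 2 → z x = -d ^ 2 := fun x hx hx' =>
        (sq_eq_sq_iff_eq_or_eq_neg.1 (by rw [hx]; ring)).resolve_left hx'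
      simp only [c, hk, hl, if_false] at hkl
      split_ifs at hkl with h1 h2 h2
      · rw [h1, h2]
      · simp at hkl
      · simp at hkl
      · rw [hor k hzk h1, hor l hzl h2]
  -- More than 3 * 3 lines in three classes put at least four into one class.
  obtain ⟨y, hy⟩ := Fintype.exists_lt_card_fiber_of_mul_lt_card c (n := 3) (by simpa using hι)
  obtain ⟨e⟩ : Nonempty (Fin 4 ↪ {x // x ∈ Finset.univ.filter fun x => c x = y}) :=
    Function.Embedding.nonempty_of_card_le (by
      rw [Fintype.card_coe, Fintype.card_fin]
      exact hy)
  refine h.false_of_four_parallel hd (e.trans (Function.Embedding.subtype _)) fun a b => ?_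
  refine hclass _ _ ?_
  have ha := (Finset.mem_filter.1 (e a).2).2
  have hb := (Finset.mem_filter.1 (e b).2).2
  exact ha.trans hb.symm

/-- The lines, with moments scaled by `d⁻¹`, realize the pattern of signs of their reciprocal
products; parallelism is excluded because eleven exceeds nine. -/
theorem card_ne_eleven (h : IsEquidistant d p u) (hd : 0 < d) [Fintype ι] :
    Fintype.card ι ≠ 11 := by
  intro hι
  have hsq : ∀ i j, tripleProduct (p i - p j) (u i) (u j) ^ 2 =
      d ^ 2 * (1 - inner ℝ (u i) (u j) ^ 2) := fun i j => by
    rcases eq_or_ne i j with rfl | hij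
    · simp [tripleProduct, h.norm_eq_one]
    · exact h.tripleProduct_sq hij
  refine not_isRealizable_eleven hι
    (s := fun i j => decide (tripleProduct (p i - p j) (u i) (u j) < 0)) (fun i j => ?_)
    ⟨u, fun i => d⁻¹ • vectorProduct (p i) (u i), h.norm_eq_one, fun i j hij => ?_, fun i j => ?_⟩
  · have : tripleProduct (p i - p j) (u i) (u j) = tripleProduct (p j - p i) (u j) (u i) := by
      simp only [tripleProduct, PiLp.sub_apply]
      ring
    rw [this]
  · rw [← sq_lt_one_iff_abs_lt_one]
    exact lt_of_le_of_ne (inner_sq_le_one (h.norm_eq_one i) (h.norm_eq_one j))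
      (h.inner_sq_ne_one hd (by omega) hij)
  · rw [real_inner_smul_right, real_inner_smul_right, ← mul_add, reciprocal_eq_tripleProduct]
    have habs : |tripleProduct (p i - p j) (u i) (u j)| =
        d * √(1 - inner ℝ (u i) (u j) ^ 2) := by
      rw [← Real.sqrt_sq_eq_abs, hsq, Real.sqrt_mul (by positivity), Real.sqrt_sq hd.le]
    rw [inv_mul_eq_iff_eq_mul₀ hd.ne']
    by_cases hneg : tripleProduct (p i - p j) (u i) (u j) < 0
    · rw [abs_of_neg hneg] at habs
      simp only [hneg, decide_true, boolSign, cond_true]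
      linarith
    · rw [abs_of_nonneg (not_lt.1 hneg)] at habs
      simp only [hneg, decide_false, boolSign, cond_false]
      linarith

end IsEquidistant

theorem not_equidistant_eleven {d : ℝ} (hd : 0 < d) {L : Fin 11 → AffineSubspace ℝ E3}
    (hL : ∀ i, IsLine (L i)) (h : ∀ i j, i ≠ j → setDist (L i : Set E3) (L j : Set E3) = d) :
    False := by
  choose p u hu hpu using fun i => (hL i).exists_eq_range
  refine IsEquidistant.card_ne_eleven (d := d) (p := p) (u := u) ⟨hu, fun i j hij => ?_⟩ hd
    (Fintype.card_fin 11)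
  rw [← hpu, ← hpu, h i j hij]

/-! ### Touching cylinders -/

/-- A common point is within `r` of both axes, so these are at distance at most `2 * r`.
Disjointness of the interiors gives the converse inequality. -/
theorem setDist_eq_of_touch {r : ℝ} {L M : AffineSubspace ℝ E3} (hL : IsLine L) (hM : IsLine M)
    (h : Touch {x : E3 | Metric.infDist x (L : Set E3) ≤ r}
      {x : E3 | Metric.infDist x (M : Set E3) ≤ r}) :
    setDist (L : Set E3) (M : Set E3) = 2 * r := by
  obtain ⟨p, u, hu, hpu⟩ := hL.exists_eq_range
  obtain ⟨q, v, hv, hqv⟩ := hM.exists_eq_range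
  obtain ⟨s, t, -, -, hle, -⟩ := exists_perpendicular_of_range p q hu hv
  rw [← hpu, ← hqv] at hle
  have ha : p + s • u ∈ (L : Set E3) := hpu ▸ Set.mem_range_self s
  have hb : q + t • v ∈ (M : Set E3) := hqv ▸ Set.mem_range_self t
  generalize p + s • u = a at *
  generalize q + t • v = b at *
  rw [setDist_eq_of_forall_le ha hb hle]
  obtain ⟨⟨x, hxL, hxM⟩, hdisj⟩ := h
  refine le_antisymm ?_ ?_
  · obtain ⟨y, hy, hxy⟩ := (L.closed_of_finiteDimensional).exists_infDist_eq_dist ⟨a, ha⟩ x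
    obtain ⟨z, hz, hxz⟩ := (M.closed_of_finiteDimensional).exists_infDist_eq_dist ⟨b, hb⟩ x
    have h1 : dist x y ≤ r := hxy ▸ hxL
    have h2 : dist x z ≤ r := hxz ▸ hxM
    linarith [hle y hy z hz, dist_triangle_left y z x]
  -- Otherwise the midpoint of the shortest segment between the axes is at distance less than `r`
  -- from both, hence interior to both cylinders.
  · by_contra! hlt
    have key : ∀ (N : AffineSubspace ℝ E3) (c : E3), c ∈ (N : Set E3) →
        dist (midpoint ℝ a b) c = dist a b / 2 →
        midpoint ℝ a b ∈ interior {x : E3 | Metric.infDist x (N : Set E3) ≤ r} := by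
      intro N c hc hdist
      refine mem_interior.2 ⟨Metric.ball (midpoint ℝ a b) (r - dist a b / 2), fun x hx => ?_,
        Metric.isOpen_ball, Metric.mem_ball_self (by linarith)⟩
      refine (Metric.infDist_le_dist_of_mem hc).trans ?_
      have := dist_triangle x (midpoint ℝ a b) c
      rw [Metric.mem_ball] at hx
      linarith
    refine Set.disjoint_left.1 hdisj (key L a ha ?_) (key M b hb ?_)
    · rw [dist_midpoint_left]
      norm_num
      ring
    · rw [dist_midpoint_right]
      norm_num
      ring

theorem IsTouchingArrangement.encard_le {S : Set (Set E3)} (hS : IsTouchingArrangement S) :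
    S.encard ≤ 10 := by
  obtain ⟨r, hr, hcyl, htouch⟩ := hS
  by_contra! hlt
  have h11 : (11 : ℕ∞) ≤ S.encard := Order.add_one_le_of_lt hlt
  obtain ⟨T, hTS, hT⟩ := Set.exists_subset_encard_eq h11
  have hfin : T.Finite := Set.finite_of_encard_eq_coe hT
  have := hfin.fintype
  have hcard : Fintype.card T = 11 := by
    rw [← Set.coe_fintypeCard] at hT
    exact_mod_cast hT
  let e : Fin 11 ≃ T := (Fintype.equivFinOfCardEq hcard).symm
  choose L hL hCL using fun i => hcyl (e i) (hTS (e i).2)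
  refine not_equidistant_eleven (d := 2 * r) (by linarith) hL fun i j hij =>
    setDist_eq_of_touch (hL i) (hL j) ?_
  rw [← hCL, ← hCL]
  exact htouch (hTS (e i).2) (hTS (e j).2) fun h => hij (e.injective (Subtype.ext h))

theorem theorem1 :
    (¬ ∃ L : Fin 11 → AffineSubspace ℝ E3,
      (∀ i, IsLine (L i)) ∧ ∀ i j, i ≠ j → setDist (L i : Set E3) (L j : Set E3) = 1) ∧
    champagneGlassNumber ≤ 10 := by
  refine ⟨fun ⟨L, hL, h⟩ => not_equidistant_eleven one_pos hL h, sSup_le ?_⟩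
  rintro _ ⟨S, hS, rfl⟩
  exact hS.encard_le
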